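/- **Setting.** A structured matrix has entries that are fixed zeros or independent free real parameters ($*$). A realization of a structured system $(A,B,C)$ is a system $\dot x=\tilde Ax+\tilde Bu$, $y=\tilde Cx$ obtained by assigning values to the parameters. It is state and input observable if $y(t)=0$ for all $t\ge 0$ implies $x(t)=0$ and $u(t)=0$ for all $t\ge 0$ ($u$ is an unknown input). $(A,B,C)$ is *generically state and input observable* (GSIO) if all its realizations outside a proper algebraic variety of the parameter space are state and input observable. The minimal GSIO problem $\mathcal P$ of $(A,B)$ is to minimize the number $\|C\|_0$ of free parameters of $C\in\{0,*\}^{n\times n}$ subject to: $(A,B,C)$ is GSIO and each row of $C$ has at most one free parameter. $(A,C)$ is structurally observable if some realization of it (without input) is observable. The digraph of a system has a vertex for each state, input and sensor, and an edge for each free parameter ($x_j\to x_i$ if $A_{ij}=*$, and so on). Let $(A',e_i)$ be a structured system with $n$ states $x_1,\dots,x_n$ and one dedicated input $u$, which drives only the state $x^*=x_i$, such that every state has a self-loop ($A'_{jj}=*$ for all $j$). The *auxiliary system* $\hat A'$ has the $n+1$ states $x_1,\dots,x_n,u$; its digraph arises from that of $(A',e_i)$ by deleting all edges from states to $x^*$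 (the self-loop of $x^*$ included) and regarding $u$ as a state. A sink-SCC is a strongly connected component that no edge leaves; let $L(\hat A')$ be the number of sink-SCCs of the digraph of $\hat A'$ that are reachable from $u$. For vertex sets $V_1,V_2$ of a digraph, $\rho(V_1,V_2)$ is the maximum number of mutually vertex-disjoint $V_1$–$V_2$ paths, and $\mathcal V_{ess}(V_1,V_2)$ is the set of vertices covered by every family of $\rho(V_1,V_2)$ mutually vertex-disjoint $V_1$–$V_2$ paths. **Algorithm 1.** Input: $(A',e_i)$. (1) Construct $\hat A'$. (2) Find a set $\hat Y_{min}$ of dedicated sensors (each measuring one state of $\hat A'$) of minimum cardinality such that $\hat A'$ with these sensors is structurally observable. (3)–(4) In the digraph of $\hat A'$ with the sensors $\hat Y_{min}$, check whether there is a state $x_j$, $1\le j\le n$, with $x_j\notin\mathcal V_{ess}(\{u\},\hat Y_{min})$ and $\rho(\{u,x_j\},\hat Y_{min})=\rho(\{u\},\hat Y_{min})$. If so, return $\hat Y_{min}\cup\{y^*\}$, where $y^*$ is a sensor measuring $x^*$; otherwise return $\hat Y_{min}$. **Theorem 4.** (a) *Correctness.* If $L(\hat A')>1$, then Algorithm 1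 has a result, and, whichever minimum placement $\hat Y_{min}$ is chosen in step (2), the returned sensors measure only states among $x_1,\dots,x_n$ and form an optimal solution of $\mathcal P$ for $(A',e_i)$: with $C$ the corresponding output matrix, $(A',e_i,C)$ is GSIO and $\|C\|_0$ is minimum. (b) *Running time.* Algorithm 1 can be completed in time $O(n^{3.5})$: there are a program of a random access machine (unit-cost operations on words of $O(\log n)$ bits, the system being given by $n$, $i$ and the $n\times n$ zero pattern of $A'$) and a constant $K$ such that for every such system $(A',e_i)$ with $n$ states the program halts after at most $K n^{3.5}$ steps with a possible result of Algorithm 1 as its output. -/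

import Mathlib

/-!
Since all states have self-loops, a placement makes the auxiliary system structurally observable iff
every state reaches a sensor; so the minimum placements `T` have one sensor in each sink component.
By Menger's theorem, the test of Algorithm 1 succeeds for `T` iff there are states `j ≠ x` and `v`
such that `x` reaches `T` avoiding `j`, but neither `x` nor `j` reaches `T` avoiding `v`.

A realization is state and input observable if its Rosenbrock pencil is injective for every complex
frequency `s`. The generic pencil is injective as soon as, after removing any row that contains `s`,
there is still a matching that covers the columns: a common factor of the maximal minors would not
involve the variables of that row, and an injective substitution that absorbs `s` into the free
entries shows that it does not involve `s` either. If the test fails for `T`, Menger's theorem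
yields these matchings for the subsystem of the states not separated from `x` by the last vertex `w`
that separates `x` from `T`, together with `w`. On the other states, an invariant zero vanishes
because the walks from `x` to `w` pass through the separators in a fixed order.

If the test succeeds with `j` and `v`, then `v` is the only exit of the region of states that reach
`T` only through `v`, and a walk from `x` to `v` avoiding `j` is shorter than the dimension of the
region. So the zero dynamics with respect to `v` are nontrivial, and some state of the region must
be measured, which costs a sensor more than `T` has; a sensor on `x` is then enough.

All of this is decided by two reachability tables, each computed by `n` graph searches of `O(n²)`
steps, so that `O(n³)` steps suffice.
-/

noncomputable section

/-! ## Linear systems with unknown inputs, and structured systems -/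

/-- State and input observability of `ẋ = A x + B u`, `y = C x`: a zero output on `[0, ∞)` forces
the state and the (arbitrary, unknown) input to vanish on `[0, ∞)`. -/
def IsSIO {X U Y : Type} [Fintype X] [Fintype U]
    (A : Matrix X X ℝ) (B : Matrix X U ℝ) (C : Matrix Y X ℝ) : Prop :=
  ∀ (x : ℝ → X → ℝ) (u : ℝ → U → ℝ),
    (∀ t, 0 ≤ t → HasDerivWithinAt x (A.mulVec (x t) + B.mulVec (u t)) (Set.Ici 0) t) →
    (∀ t, 0 ≤ t → C.mulVec (x t) = 0) →
    ∀ t, 0 ≤ t → x t = 0 ∧ u t = 0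

/-- A structured matrix: `true` marks a free parameter `*`, `false` a fixed zero. -/
abbrev StructMatrix (m n : Type) := Matrix m n Bool

/-- The free positions of a structured matrix. -/
abbrev StructMatrix.Free {m n : Type} (M : StructMatrix m n) : Type :=
  {p : m × n // M p.1 p.2 = true}

/-- The realization of a structured matrix at given values of its free parameters. -/
def StructMatrix.realize {m n : Type} (M : StructMatrix m n) (θ : M.Free → ℝ) : Matrix m n ℝ :=
  fun i j => if h : M i j = true then θ ⟨(i, j), h⟩ else 0

/-- The number of free parameters of a structured matrix. -/
def StructMatrix.norm0 {m n : Type} (M : StructMatrix m n) : ℕ := Nat.card M.Free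

/-- Generic state and input observability: all realizations are state and input observable, except
for parameter values in a proper algebraic variety of the parameter space. -/
def IsGSIO {X U Y : Type} [Fintype X] [Fintype U]
    (A : StructMatrix X X) (B : StructMatrix X U) (C : StructMatrix Y X) : Prop :=
  ∃ P : MvPolynomial (A.Free ⊕ B.Free ⊕ C.Free) ℝ, P ≠ 0 ∧
    ∀ θ : A.Free ⊕ B.Free ⊕ C.Free → ℝ, MvPolynomial.eval θ P ≠ 0 →
      IsSIO (A.realize fun p => θ (Sum.inl p))
        (B.realize fun p => θ (Sum.inr (Sum.inl p)))
        (C.realize fun p => θ (Sum.inr (Sum.inr p)))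

/-- Structural observability of `(A, C)` (no inputs): some realization is observable. -/
def IsStructObservable {X Y : Type} [Fintype X]
    (A : StructMatrix X X) (C : StructMatrix Y X) : Prop :=
  ∃ (a : A.Free → ℝ) (c : C.Free → ℝ),
    IsSIO (A.realize a) (0 : Matrix X Empty ℝ) (C.realize c)

/-- The output matrix of the dedicated sensors `y_x`, `x ∈ S`, where `y_x` measures the state `x`:
row `x` has its only free parameter in column `x` if `x ∈ S`, and is a zero row (no sensor)
otherwise. -/
def sensorMatrix {X : Type} [DecidableEq X] (S : Finset X) : StructMatrix X X :=
  fun y x => decide (y = x ∧ x ∈ S)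

/-- The feasible output matrices of the minimal GSIO problem of `(A, B)`: each sensor measures at
most one state, and `(A, B, C)` is GSIO. -/
def IsFeasible {X U : Type} [Fintype X] [Fintype U]
    (A : StructMatrix X X) (B : StructMatrix X U) (C : StructMatrix X X) : Prop :=
  IsGSIO A B C ∧ ∀ y x x', C y x = true → C y x' = true → x = x'

/-- The optimal solutions of the minimal GSIO problem of `(A, B)`. -/
def IsOptimal {X U : Type} [Fintype X] [Fintype U]
    (A : StructMatrix X X) (B : StructMatrix X U) (C : StructMatrix X X) : Prop :=
  IsFeasible A B C ∧ ∀ C' : StructMatrix X X, IsFeasible A B C' → C.norm0 ≤ C'.norm0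

/-- The minimum sensor placements for structural observability of `A`. -/
def IsMinPlacement {X : Type} [Fintype X] [DecidableEq X]
    (A : StructMatrix X X) (S : Finset X) : Prop :=
  IsStructObservable A (sensorMatrix S) ∧
    ∀ S' : Finset X, IsStructObservable A (sensorMatrix S') → S.card ≤ S'.card

/-! ## Digraphs, linkings, essential vertices, sink components -/

/-- The digraph of `A` on the state vertices: an edge `x_j → x_i` for each free entry `(i, j)`. -/
def stateDigraph {X : Type} (A : StructMatrix X X) : Digraph X where
  Adj j i := A i j = true

/-- The digraph of `(A, C)`: state vertices `Sum.inl x` and output vertices `Sum.inr y`. -/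
def outputDigraph {X Y : Type} (A : StructMatrix X X) (C : StructMatrix Y X) :
    Digraph (X ⊕ Y) where
  Adj v w := match v, w with
    | Sum.inl j, Sum.inl i => A i j = true
    | Sum.inl j, Sum.inr y => C y j = true
    | Sum.inr _, _ => False

/-- A `V₁ - V₂` path, as its nonempty list of vertices: consecutive vertices are joined by edges
and no vertex is repeated. -/
def IsPath {V : Type} (G : Digraph V) (V₁ V₂ : Set V) (p : List V) : Prop :=
  p.IsChain G.Adj ∧ p.Nodup ∧ (∃ v ∈ V₁, p.head? = some v) ∧ (∃ w ∈ V₂, p.getLast? = some w)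

/-- A set of mutually (vertex-)disjoint `V₁ - V₂` paths. -/
def IsLinking {V : Type} (G : Digraph V) (V₁ V₂ : Set V) (L : Finset (List V)) : Prop :=
  (∀ p ∈ L, IsPath G V₁ V₂ p) ∧ ∀ p ∈ L, ∀ q ∈ L, p ≠ q → List.Disjoint p q

/-- `ρ(V₁, V₂)`, the maximum number of mutually disjoint `V₁ - V₂` paths (finite digraphs). -/
def rho {V : Type} [Finite V] (G : Digraph V) (V₁ V₂ : Set V) : ℕ :=
  sSup {k | ∃ L : Finset (List V), IsLinking G V₁ V₂ L ∧ L.card = k}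

/-- The essential vertices: those covered by every maximum `V₁ - V₂` linking. -/
def essentialVertices {V : Type} [Finite V] (G : Digraph V) (V₁ V₂ : Set V) : Set V :=
  {v | ∀ L : Finset (List V), IsLinking G V₁ V₂ L → L.card = rho G V₁ V₂ → ∃ p ∈ L, v ∈ p}

/-- There is a path (possibly of length zero) from `v` to `w`. -/
def Reaches {V : Type} (G : Digraph V) (v w : V) : Prop := Relation.ReflTransGen G.Adj v w

/-- The vertex sets of the strongly connected components. -/
def IsSCC {V : Type} (G : Digraph V) (S : Set V) : Prop :=
  ∃ v, S = {w | Reaches G v w ∧ Reaches G w v}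

/-- A sink component: a strongly connected component that no edge leaves. -/
def IsSinkSCC {V : Type} (G : Digraph V) (S : Set V) : Prop :=
  IsSCC G S ∧ ∀ v ∈ S, ∀ w, G.Adj v w → w ∈ S

/-- The number of sink components that can be reached from the vertex `u`. -/
def numReachableSinkSCC {V : Type} (G : Digraph V) (u : V) : ℕ :=
  Set.ncard {S : Set V | IsSinkSCC G S ∧ ∃ v ∈ S, Reaches G u v}

/-! ## One dedicated input, the auxiliary system, and the sensor placement algorithm -/

/-- The input matrix of a single dedicated input that drives the state `x`. -/
def dedicatedInput {X : Type} [DecidableEq X] (x : X) : StructMatrix X Unit :=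
  fun i _ => decide (i = x)

/-- The auxiliary system of `(A, e)`, `e` being the single dedicated input that drives `x`:
delete all edges from state vertices (`x` included) to `x`, and count the input vertex `u`,
here `Sum.inr ()`, as a state vertex. -/
def auxSystem {X : Type} [DecidableEq X] (A : StructMatrix X X) (x : X) :
    StructMatrix (X ⊕ Unit) (X ⊕ Unit) :=
  fun w v => match w, v with
    | Sum.inl i, Sum.inl j => A i j && !decide (i = x)
    | Sum.inl i, Sum.inr _ => decide (i = x)
    | Sum.inr _, _ => false

/-- The test in the loop of the algorithm: in the digraph of the auxiliary system with the sensors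
`S`, some state vertex `x_j` is not essential for `({u}, Y)` although
`ρ({u, x_j}, Y) = ρ({u}, Y)`, where `Y` is the set of the sensors in `S`. -/
def HasViolation {X : Type} [Fintype X] [DecidableEq X]
    (A : StructMatrix X X) (x : X) (S : Finset (X ⊕ Unit)) : Prop :=
  let G : Digraph ((X ⊕ Unit) ⊕ (X ⊕ Unit)) := outputDigraph (auxSystem A x) (sensorMatrix S)
  let u : (X ⊕ Unit) ⊕ (X ⊕ Unit) := Sum.inl (Sum.inr ())
  let Y : Set ((X ⊕ Unit) ⊕ (X ⊕ Unit)) := {v | ∃ s ∈ S, v = Sum.inr s}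
  ∃ j : X, (Sum.inl (Sum.inl j)) ∉ essentialVertices G {u} Y ∧
    rho G {u, Sum.inl (Sum.inl j)} Y = rho G {u} Y

/-- `R` is a possible result of the algorithm on `(A, e)`, `e` driving `x`: choose any minimum
sensor placement `S` for structural observability of the auxiliary system; return `S` together
with a sensor on `x` if some state vertex violates the condition, and `S` otherwise. -/
def AlgorithmReturns {X : Type} [Fintype X] [DecidableEq X]
    (A : StructMatrix X X) (x : X) (R : Finset (X ⊕ Unit)) : Prop :=
  ∃ S : Finset (X ⊕ Unit), IsMinPlacement (auxSystem A x) S ∧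
    ((HasViolation A x S ∧ R = insert (Sum.inl x) S) ∨ (¬ HasViolation A x S ∧ R = S))

/-! ## A word RAM with step count -/

namespace RAM

/-- Contents of the registers and of the arrays (random access memory) of the machine. -/
structure State where
  reg : ℕ → ℕ
  arr : ℕ → ℕ → ℕ

/-- Programs. All register names and array names are fixed numbers in the program text. -/
inductive Prog where
  | const (r c : ℕ)
  | add (r a b : ℕ)
  | sub (r a b : ℕ)
  | mul (r a b : ℕ)
  | load (r k a : ℕ)
  | store (k a b : ℕ)
  | seq (p q : Prog)
  | ifLt (a b : ℕ) (p q : Prog)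
  | whileLt (a b : ℕ) (p : Prog)

/-- Write `v` into register `r`. -/
def State.setReg (s : State) (r v : ℕ) : State :=
  { s with reg := Function.update s.reg r v }

/-- Write `v` into cell `i` of array `k`. -/
def State.setArr (s : State) (k i v : ℕ) : State :=
  { s with arr := Function.update s.arr k (Function.update (s.arr k) i v) }

/-- `Exec W p s t s'`: started in `s`, the program `p` halts in `s'` after exactly `t` steps, and
each number that it writes is at most `W` (the largest machine word). Each elementary operation
and each evaluation of a test takes one step. -/
inductive Exec (W : ℕ) : Prog → State → ℕ → State → Prop
  | const (s : State) (r c : ℕ) : c ≤ W → Exec W (.const r c) s 1 (s.setReg r c)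
  | add (s : State) (r a b : ℕ) : s.reg a + s.reg b ≤ W →
      Exec W (.add r a b) s 1 (s.setReg r (s.reg a + s.reg b))
  | sub (s : State) (r a b : ℕ) : s.reg a - s.reg b ≤ W →
      Exec W (.sub r a b) s 1 (s.setReg r (s.reg a - s.reg b))
  | mul (s : State) (r a b : ℕ) : s.reg a * s.reg b ≤ W →
      Exec W (.mul r a b) s 1 (s.setReg r (s.reg a * s.reg b))
  | load (s : State) (r k a : ℕ) : s.arr k (s.reg a) ≤ W →
      Exec W (.load r k a) s 1 (s.setReg r (s.arr k (s.reg a)))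
  | store (s : State) (k a b : ℕ) : s.reg b ≤ W →
      Exec W (.store k a b) s 1 (s.setArr k (s.reg a) (s.reg b))
  | seq (p q : Prog) (s s' s'' : State) (t t' : ℕ) :
      Exec W p s t s' → Exec W q s' t' s'' → Exec W (.seq p q) s (t + t') s''
  | ifTrue (a b : ℕ) (p q : Prog) (s s' : State) (t : ℕ) : s.reg a < s.reg b →
      Exec W p s t s' → Exec W (.ifLt a b p q) s (t + 1) s'
  | ifFalse (a b : ℕ) (p q : Prog) (s s' : State) (t : ℕ) : ¬ s.reg a < s.reg b →
      Exec W q s t s' → Exec W (.ifLt a b p q) s (t + 1) s'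
  | whileTrue (a b : ℕ) (p : Prog) (s s' s'' : State) (t t' : ℕ) : s.reg a < s.reg b →
      Exec W p s t s' → Exec W (.whileLt a b p) s' t' s'' →
      Exec W (.whileLt a b p) s (t + t' + 1) s''
  | whileFalse (a b : ℕ) (p : Prog) (s : State) : ¬ s.reg a < s.reg b →
      Exec W (.whileLt a b p) s 1 s

/-- The input of the algorithm: `n` in register `0`, the index of the driven state in register `1`,
the pattern of `A` row by row in array `0`, and zeros everywhere else. -/
def inputState {n : ℕ} (A : StructMatrix (Fin n) (Fin n)) (x : Fin n) : State where
  reg r := if r = 0 then n else if r = 1 then (x : ℕ) else 0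
  arr k m :=
    open Classical in
    if k = 0 ∧ ∃ i j : Fin n, m = (i : ℕ) * n + (j : ℕ) ∧ A i j = true then 1 else 0

/-- The final contents of array `1` list the measured states: cell `j` holds `1` if the state `j`
is measured, and `0` otherwise. -/
def outputIs {n : ℕ} (s : State) (T : Finset (Fin n)) : Prop :=
  ∀ j : Fin n, s.arr 1 (j : ℕ) = if j ∈ T then 1 else 0

end RAM

end

open Matrix

section Observability

variable {X U Y : Type} [Fintype X] [Fintype U]

theorem exists_linear_flow {E : Type*} [NormedAddCommGroup E] [NormedSpace ℝ E] [CompleteSpace E]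
    (g : E →L[ℝ] E) (z : E) : ∃ w : ℝ → E, w 0 = z ∧ ∀ t, HasDerivAt w (g (w t)) t := by
  refine ⟨fun t => NormedSpace.exp (t • g) z, by simp, fun t => ?_⟩
  exact ((hasDerivAt_exp_smul_const' g t).clm_apply (hasDerivAt_const t z)).congr_deriv (by simp)

/-- The feedback `u = K x` makes `V` invariant, so that a nonzero trajectory stays in `V`. -/
theorem not_isSIO_of_feedback_invariant (A : Matrix X X ℝ) (B : Matrix X U ℝ) (C : Matrix Y X ℝ)
    (K : (X → ℝ) →ₗ[ℝ] (U → ℝ)) {V : Submodule ℝ (X → ℝ)} (hV : ∀ z ∈ V, A *ᵥ z + B *ᵥ K z ∈ V)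
    (hC : ∀ z ∈ V, C *ᵥ z = 0) (hne : V ≠ ⊥) : ¬ IsSIO A B C := by
  intro h
  obtain ⟨z, hz, hz0⟩ := V.ne_bot_iff.1 hne
  let f : (X → ℝ) →ₗ[ℝ] (X → ℝ) := A.mulVecLin + B.mulVecLin ∘ₗ K
  have hf : ∀ z ∈ V, f z ∈ V := hV
  let g : V →L[ℝ] V := LinearMap.toContinuousLinearMap (f.restrict hf)
  obtain ⟨w, hw0, hw⟩ := exists_linear_flow g ⟨z, hz⟩
  have hx (t : ℝ) : HasDerivAt (fun t => (w t : X → ℝ)) (f (w t)) t :=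
    (V.subtypeL.hasFDerivAt.comp_hasDerivAt t (hw t)).congr_deriv (by simp [g])
  have hw00 := h (fun t => (w t : X → ℝ)) (fun t => K (w t))
    (fun t _ => (hx t).hasDerivWithinAt) (fun t _ => hC _ (w t).2) 0 le_rfl
  exact hz0 (by simpa [hw0] using hw00.1)

theorem mem_submodule_of_hasDerivWithinAt_Ici {E : Type*} [NormedAddCommGroup E] [NormedSpace ℝ E]
    {W : Submodule ℝ E} (hW : IsClosed (W : Set E)) {x : ℝ → E} {x' : E} {a t : ℝ} (ht : a ≤ t)
    (hx : HasDerivWithinAt x x' (Set.Ici a) t) (h : ∀ t, a ≤ t → x t ∈ W) : x' ∈ W := by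
  have hslope := hasDerivWithinAt_iff_tendsto_slope.1 (hx.mono (Set.Ici_subset_Ici.2 ht))
  rw [Set.Ici_sdiff_left] at hslope
  refine hW.mem_of_tendsto hslope ?_
  filter_upwards [self_mem_nhdsWithin] with r hr
  rw [slope_def_module]
  exact W.smul_mem _ (W.sub_mem (h _ (ht.trans (le_of_lt hr))) (h _ ht))

section OutputNulling

variable {𝕜 : Type*} [Field 𝕜] {A : Matrix X X 𝕜} {B : Matrix X U 𝕜} {C : Matrix Y X 𝕜}

/-- The states from which some input keeps the output of the discrete-time system
`z ↦ A z + B v`, `y = C z` at zero for `k` further steps. -/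
def outputNulling (A : Matrix X X 𝕜) (B : Matrix X U 𝕜) (C : Matrix Y X 𝕜) :
    ℕ → Submodule 𝕜 (X → 𝕜)
  | 0 => C.mulVecLin.ker
  | k + 1 => C.mulVecLin.ker ⊓
      Submodule.map (LinearMap.fst 𝕜 (X → 𝕜) (U → 𝕜))
        (Submodule.comap (A.mulVecLin.coprod B.mulVecLin) (outputNulling A B C k))

theorem mem_outputNulling_succ {k : ℕ} {z : X → 𝕜} :
    z ∈ outputNulling A B C (k + 1) ↔
      C *ᵥ z = 0 ∧ ∃ v, A *ᵥ z + B *ᵥ v ∈ outputNulling A B C k := by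
  simp [outputNulling]

theorem outputNulling_antitone : Antitone (outputNulling A B C) := by
  refine antitone_nat_of_succ_le fun k => ?_
  induction k with
  | zero => exact inf_le_left
  | succ k ih =>
    intro z hz
    rw [mem_outputNulling_succ] at hz ⊢
    exact ⟨hz.1, hz.2.imp fun v hv => ih hv⟩

theorem exists_feedback {W : Submodule 𝕜 (X → 𝕜)} (hW : ∀ z ∈ W, ∃ v, A *ᵥ z + B *ᵥ v ∈ W) :
    ∃ K : W →ₗ[𝕜] (U → 𝕜), ∀ z : W, A *ᵥ (z : X → 𝕜) + B *ᵥ K z ∈ W := by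
  let S : Submodule 𝕜 (W × (U → 𝕜)) :=
    W.comap (A.mulVecLin.coprod B.mulVecLin ∘ₗ W.subtype.prodMap LinearMap.id)
  let π : S →ₗ[𝕜] W := LinearMap.fst 𝕜 W (U → 𝕜) ∘ₗ S.subtype
  have hπ : π.range = ⊤ := by
    rw [LinearMap.range_eq_top]
    intro z
    obtain ⟨v, hv⟩ := hW z z.2
    exact ⟨⟨(z, v), by simpa [S] using hv⟩, rfl⟩
  obtain ⟨r, hr⟩ := π.exists_rightInverse_of_surjective hπ
  refine ⟨LinearMap.snd 𝕜 W (U → 𝕜) ∘ₗ S.subtype ∘ₗ r, fun z => ?_⟩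
  have hrz : (r z : W × (U → 𝕜)).1 = z := LinearMap.congr_fun hr z
  have hrS : A.mulVecLin.coprod B.mulVecLin ((r z : W × (U → 𝕜)).1, (r z : W × (U → 𝕜)).2) ∈ W :=
    (r z).2
  simpa [hrz] using hrS

/-- The Rosenbrock pencil `[A - s I, B; C, 0]` has trivial kernel for each `s`: the system has no
invariant zeros. -/
def HasInjectivePencil (A : Matrix X X 𝕜) (B : Matrix X U 𝕜) (C : Matrix Y X 𝕜) : Prop :=
  ∀ (s : 𝕜) (z : X → 𝕜) (v : U → 𝕜), A *ᵥ z + B *ᵥ v = s • z → C *ᵥ z = 0 → z = 0 ∧ v = 0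

theorem HasInjectivePencil.eq_bot [IsAlgClosed 𝕜] (h : HasInjectivePencil A B C)
    {W : Submodule 𝕜 (X → 𝕜)} (hC : ∀ z ∈ W, C *ᵥ z = 0)
    (hW : ∀ z ∈ W, ∃ v, A *ᵥ z + B *ᵥ v ∈ W) : W = ⊥ := by
  by_contra hne
  obtain ⟨K, hK⟩ := exists_feedback hW
  let F : W →ₗ[𝕜] W := (A.mulVecLin ∘ₗ W.subtype + B.mulVecLin ∘ₗ K).codRestrict W hK
  have : Nontrivial W := Submodule.nontrivial_iff_ne_bot.2 hne
  obtain ⟨s, hs⟩ := Module.End.exists_eigenvalue F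
  obtain ⟨z, hz⟩ := hs.exists_hasEigenvector
  have hFz : (F z : X → 𝕜) = s • (z : X → 𝕜) := by rw [hz.apply_eq_smul]; rfl
  exact hz.2 (Subtype.ext (h s z (K z) hFz (hC z z.2)).1)

theorem HasInjectivePencil.exists_outputNulling_eq_bot [IsAlgClosed 𝕜]
    (h : HasInjectivePencil A B C) : ∃ N, outputNulling A B C N = ⊥ := by
  obtain ⟨N, hN⟩ := monotone_stabilizes_iff_artinian.2 (inferInstance : IsArtinian 𝕜 (X → 𝕜))
    ⟨fun k => OrderDual.toDual (outputNulling A B C k), outputNulling_antitone.dual_right⟩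
  have hstable : outputNulling A B C N = outputNulling A B C (N + 1) := hN (N + 1) (Nat.le_succ N)
  have hmem (z : X → 𝕜) (hz : z ∈ outputNulling A B C N) :=
    mem_outputNulling_succ.1 (hstable ▸ hz)
  exact ⟨N, h.eq_bot (fun z hz => (hmem z hz).1) fun z hz => (hmem z hz).2⟩

end OutputNulling

theorem ofReal_mulVec (A : Matrix Y X ℝ) (z : X → ℝ) :
    A.map Complex.ofReal *ᵥ (fun i => (z i : ℂ)) = fun i => ((A *ᵥ z) i : ℂ) := by
  ext i
  simp [mulVec, dotProduct]

/-- Repeated differentiation of `y = 0` drives the state into each of the output-nulling subspaces,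
the last of which is trivial. -/
theorem HasInjectivePencil.isSIO {A : Matrix X X ℝ} {B : Matrix X U ℝ} {C : Matrix Y X ℝ}
    (h : HasInjectivePencil (A.map Complex.ofReal) (B.map Complex.ofReal)
      (C.map Complex.ofReal)) : IsSIO A B C := by
  set A' := A.map Complex.ofReal with hA'
  set B' := B.map Complex.ofReal with hB'
  set C' := C.map Complex.ofReal with hC'
  intro x u hx hy
  let xc (t : ℝ) : X → ℂ := fun i => x t i
  let uc (t : ℝ) : U → ℂ := fun k => u t k
  have hxc (t : ℝ) (ht : 0 ≤ t) :
      HasDerivWithinAt xc (A' *ᵥ xc t + B' *ᵥ uc t) (Set.Ici 0) t := by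
    refine hasDerivWithinAt_pi.2 fun i =>
      ((hasDerivWithinAt_pi.1 (hx t ht) i).ofReal_comp).congr_deriv ?_
    simp only [hA', hB', xc, uc, ofReal_mulVec, Pi.add_apply, Complex.ofReal_add]
  have hyc (t : ℝ) (ht : 0 ≤ t) : C' *ᵥ xc t = 0 := by
    simp only [hC', xc, ofReal_mulVec, hy t ht]
    ext; simp
  have hmem (k : ℕ) (t : ℝ) (ht : 0 ≤ t) : xc t ∈ outputNulling A' B' C' k := by
    induction k generalizing t with
    | zero => exact hyc t ht
    | succ k ih =>
      let W := (outputNulling A' B' C' k).restrictScalars ℝ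
      exact mem_outputNulling_succ.2 ⟨hyc t ht, uc t,
        mem_submodule_of_hasDerivWithinAt_Ici W.closed_of_finiteDimensional ht (hxc t ht) ih⟩
  obtain ⟨N, hN⟩ := h.exists_outputNulling_eq_bot
  have hx0 (t : ℝ) (ht : 0 ≤ t) : xc t = 0 := by simpa [hN] using hmem N t ht
  intro t ht
  have hderiv : A' *ᵥ xc t + B' *ᵥ uc t = 0 := mem_submodule_of_hasDerivWithinAt_Ici (W := ⊥)
    isClosed_singleton ht (hxc t ht) fun t ht => by simpa using hx0 t ht
  have huc : uc t = 0 :=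
    (h 0 0 _ (by simpa [hx0 t ht] using hderiv) (by simp)).2
  exact ⟨funext fun i => by simpa [xc] using congrFun (hx0 t ht) i,
    funext fun k => by simpa [uc] using congrFun huc k⟩

end Observability

section Generically

open MvPolynomial

variable {σ τ : Type*}

/-- The property `p` holds outside a proper algebraic variety of the parameter space `σ → ℝ`. -/
def Generically (p : (σ → ℝ) → Prop) : Prop :=
  ∃ P : MvPolynomial σ ℝ, P ≠ 0 ∧ ∀ θ, eval θ P ≠ 0 → p θ

theorem Generically.mono {p q : (σ → ℝ) → Prop} (hp : Generically p) (h : ∀ θ, p θ → q θ) :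
    Generically q :=
  let ⟨P, hP, hPθ⟩ := hp
  ⟨P, hP, fun θ hθ => h θ (hPθ θ hθ)⟩

theorem Generically.and {p q : (σ → ℝ) → Prop} (hp : Generically p) (hq : Generically q) :
    Generically fun θ => p θ ∧ q θ := by
  obtain ⟨P, hP, hPθ⟩ := hp
  obtain ⟨Q, hQ, hQθ⟩ := hq
  refine ⟨P * Q, mul_ne_zero hP hQ, fun θ hθ => ?_⟩
  rw [map_mul] at hθ
  exact ⟨hPθ θ (left_ne_zero_of_mul hθ), hQθ θ (right_ne_zero_of_mul hθ)⟩

theorem Generically.comp_injective {p : (σ → ℝ) → Prop} (hp : Generically p) {f : σ → τ}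
    (hf : Function.Injective f) : Generically fun θ : τ → ℝ => p (θ ∘ f) := by
  obtain ⟨P, hP, hPθ⟩ := hp
  refine ⟨rename f P, fun h => hP (rename_injective f hf (by simpa using h)), fun θ hθ => ?_⟩
  exact hPθ _ (by rwa [eval_rename] at hθ)

theorem generically_ne_zero [Finite σ] : Generically fun θ : σ → ℝ => ∀ e, θ e ≠ 0 := by
  have := Fintype.ofFinite σ
  refine ⟨∏ e, X e, Finset.prod_ne_zero_iff.2 fun e _ => X_ne_zero e, fun θ hθ e => ?_⟩
  rw [map_prod, Finset.prod_ne_zero_iff] at hθ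
  simpa using hθ e (Finset.mem_univ e)

theorem Generically.exists_pos {p : (σ → ℝ) → Prop} (hp : Generically p) :
    ∃ θ, (∀ e, 0 < θ e) ∧ p θ := by
  obtain ⟨P, hP, hPθ⟩ := hp
  by_contra! hcon
  refine hP (funext_set (fun _ => Set.Ioi (0 : ℝ)) (fun _ => Set.Ioi_infinite 0) fun θ hθ => ?_)
  rw [map_zero]
  by_contra hne
  exact hcon θ (fun e => hθ e (Set.mem_univ e)) (hPθ θ hne)

end Generically

section CoprimePolynomials

open Polynomial

variable {R : Type*} [CommRing R] [IsDomain R]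

/-- Gauss's lemma: the primitive part of a common factor over the field of fractions is a common
factor over `R`. -/
theorem isUnit_of_forall_dvd_map [IsGCDMonoid R] {S : Set R[X]}
    (h : ∀ φ : R[X], (∀ f ∈ S, φ ∣ f) → φ.natDegree = 0) {q : (FractionRing R)[X]} (hq0 : q ≠ 0)
    (hq : ∀ f ∈ S, q ∣ f.map (algebraMap R (FractionRing R))) : IsUnit q := by
  let : NormalizedGCDMonoid R := Nonempty.some inferInstance
  obtain ⟨b, hb, hbq⟩ := IsLocalization.integerNormalization_spec (nonZeroDivisors R) q
  set r := IsLocalization.integerNormalization (nonZeroDivisors R) q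
  have hb0 : algebraMap R (FractionRing R) b ≠ 0 := by
    simpa using nonZeroDivisors.ne_zero hb
  have hrq : r.map (algebraMap R (FractionRing R)) = C (algebraMap R (FractionRing R) b) * q := by
    rw [hbq, Algebra.smul_def, Polynomial.algebraMap_apply]
  have hdvd : ∀ f ∈ S, r.primPart ∣ f := fun f hf => by
    refine r.isPrimitive_primPart.dvd_of_fraction_map_dvd_fraction_map (K := FractionRing R) ?_
    refine dvd_trans ?_ (hq f hf)
    rw [← (isUnit_C.2 hb0.isUnit).dvd_mul_left, ← hrq]
    exact Polynomial.map_dvd _ r.primPart_dvd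
  refine isUnit_or_eq_zero_of_isUnit_integerNormalization_primPart (R := R) hq0 ?_
  have hC := eq_C_of_natDegree_eq_zero (h _ hdvd)
  rw [hC]
  exact isUnit_C.2 (r.isPrimitive_primPart _ (by rw [← hC]))

theorem exists_C_mem_span_of_forall_natDegree_eq_zero [IsGCDMonoid R] {S : Set R[X]}
    (hS : ∃ f ∈ S, f ≠ 0) (h : ∀ φ : R[X], (∀ f ∈ S, φ ∣ f) → φ.natDegree = 0) :
    ∃ P : R, P ≠ 0 ∧ C P ∈ Ideal.span S := by
  let K := FractionRing R
  let := Polynomial.algebra R K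
  have := Polynomial.isLocalization (nonZeroDivisors R) K
  let I : Ideal K[X] := (Ideal.span S).map (algebraMap R[X] K[X])
  obtain ⟨q, hIq⟩ := (IsPrincipalIdealRing.principal I).principal
  change I = Ideal.span {q} at hIq
  have hq : ∀ f ∈ S, q ∣ f.map (algebraMap R K) := fun f hf => by
    rw [← Ideal.mem_span_singleton, ← hIq]
    exact Ideal.mem_map_of_mem _ (Ideal.subset_span hf)
  have hq0 : q ≠ 0 := by
    rintro rfl
    obtain ⟨f, hf, hf0⟩ := hS
    exact hf0 ((Polynomial.map_eq_zero_iff (IsFractionRing.injective R K)).1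
      (zero_dvd_iff.1 (hq f hf)))
  have hI : I = ⊤ := by
    rw [hIq, Ideal.span_singleton_eq_top]
    exact isUnit_of_forall_dvd_map h hq0 hq
  have h1 : algebraMap R[X] K[X] 1 ∈ I := by rw [hI]; trivial
  obtain ⟨_, ⟨P, hP, rfl⟩, hmem⟩ := (IsLocalization.algebraMap_mem_map_algebraMap_iff
    ((nonZeroDivisors R).map C) K[X] (Ideal.span S) 1).1 h1
  exact ⟨P, nonZeroDivisors.ne_zero hP, by simpa using hmem⟩

end CoprimePolynomials

section MvPolynomialLemmas

open MvPolynomial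

variable {σ R : Type*}

theorem mem_supported_of_dvd [CommSemiring R] [NoZeroDivisors R] {s : Set σ}
    {f g : MvPolynomial σ R} (hg : g ∈ supported R s) (hg0 : g ≠ 0) (h : f ∣ g) :
    f ∈ supported R s := by
  obtain ⟨f', rfl⟩ := h
  rw [mem_supported] at hg ⊢
  intro i hi
  refine hg (mem_vars_iff_degreeOf_ne_zero.2 ?_)
  rw [degreeOf_mul_eq (left_ne_zero_of_mul hg0) (right_ne_zero_of_mul hg0)]
  exact fun h => mem_vars_iff_degreeOf_ne_zero.1 hi (Nat.add_eq_zero_iff.1 h).1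

theorem det_mem_of_forall_mem {n : Type*} [Fintype n] [DecidableEq n] {k A : Type*}
    [CommRing k] [CommRing A] [Algebra k A] (S : Subalgebra k A) {M : Matrix n n A}
    (h : ∀ i j, M i j ∈ S) : M.det ∈ S := by
  rw [det_apply]
  exact S.sum_mem fun τ _ => S.zsmul_mem (S.prod_mem fun i _ => h _ _) _

theorem natDegree_optionEquivLeft_eq_zero_iff [CommSemiring R] {f : MvPolynomial (Option σ) R} :
    (optionEquivLeft R σ f).natDegree = 0 ↔ f ∈ supported R (Set.range some) := by
  rw [natDegree_optionEquivLeft, ← not_ne_iff, ← mem_vars_iff_degreeOf_ne_zero, mem_supported,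
    Set.subset_def]
  simp [Option.forall]

theorem exists_rename_some_mem_span {k : Type*} [Field k] {S : Set (MvPolynomial (Option σ) k)}
    (hS : ∃ f ∈ S, f ≠ 0)
    (h : ∀ φ, (∀ f ∈ S, φ ∣ f) → φ ∈ supported k (Set.range (some : σ → Option σ))) :
    ∃ P : MvPolynomial σ k, P ≠ 0 ∧ rename some P ∈ Ideal.span S := by
  let e := optionEquivLeft k σ
  obtain ⟨f₀, hf₀, hf₀0⟩ := hS
  obtain ⟨P, hP, hmem⟩ := exists_C_mem_span_of_forall_natDegree_eq_zero (S := e '' S)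
    ⟨e f₀, ⟨f₀, hf₀, rfl⟩, by simpa using hf₀0⟩ fun φ hφ => by
      rw [← e.apply_symm_apply φ]
      refine natDegree_optionEquivLeft_eq_zero_iff.2 (h _ fun f hf => ?_)
      simpa using map_dvd e.symm (hφ _ ⟨f, hf, rfl⟩)
  have he : e (rename some P) = Polynomial.C P := by
    have : (e : _ →+* _).comp (rename some : _ →ₐ[k] MvPolynomial (Option σ) k).toRingHom =
        Polynomial.C :=
      MvPolynomial.ringHom_ext (fun r => by simp [e]) fun i => by simp [e]
    exact RingHom.congr_fun this P
  refine ⟨P, hP, ?_⟩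
  rw [← he, show e '' S = (e : _ →+* _) '' S from rfl, ← Ideal.map_span] at hmem
  exact (Ideal.mem_map_of_equiv e _).1 hmem |>.elim fun g hg => e.injective hg.2 ▸ hg.1

end MvPolynomialLemmas

section GenericPencil

open MvPolynomial

variable {ρ γ : Type} {k : Type*} [CommRing k]

/-- The generic realization of a structured matrix: the free entries are independent variables. -/
noncomputable def StructMatrix.generic (k : Type*) [CommRing k] (M : StructMatrix ρ γ) :
    Matrix ρ γ (MvPolynomial M.Free k) :=
  fun i c => if h : M i c = true then X ⟨(i, c), h⟩ else 0

/-- The generic pencil `M - s E`; the variable `s` is `X none`. -/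
noncomputable def StructMatrix.pencil (M : StructMatrix ρ γ) (E : Matrix ρ γ k) :
    Matrix ρ γ (MvPolynomial (Option M.Free) k) :=
  (M.generic k).map (rename some) - E.map fun a => C a * X none

/-- The substitution that absorbs the term `- s E` of the generic pencil into the free entries. -/
noncomputable def StructMatrix.shift (M : StructMatrix ρ γ) (E : Matrix ρ γ k) :
    MvPolynomial (Option M.Free) k →ₐ[k] MvPolynomial (Option M.Free) k :=
  aeval fun v => v.elim (X none) fun p => X (some p) + C (E p.1.1 p.1.2) * X none

/-- A choice of distinct rows, one for each column, in which the column has a free entry. -/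
def StructMatrix.IsTransversal (M : StructMatrix ρ γ) (f : γ → ρ) : Prop :=
  Function.Injective f ∧ ∀ c, M (f c) c = true

variable {M : StructMatrix ρ γ} {E : Matrix ρ γ k} {f : γ → ρ}

theorem StructMatrix.pencil_mem_supported [Nontrivial k] (i : ρ) (c : γ) :
    M.pencil E i c ∈ supported k {v : Option M.Free | ∀ p ∈ v, p.1.1 = i} := by
  refine Subalgebra.sub_mem _ ?_ (Subalgebra.mul_mem _ (Subalgebra.algebraMap_mem _ _) ?_)
  · rw [map_apply, StructMatrix.generic]
    split_ifs with h
    · rw [rename_X]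
      refine X_mem_supported.2 fun p hp => ?_
      rw [← Option.mem_some_iff.1 hp]
    · rw [map_zero]
      exact Subalgebra.zero_mem _
  · exact X_mem_supported.2 (by simp)

theorem StructMatrix.shift_pencil (hE : ∀ i c, E i c ≠ 0 → M i c = true) (i : ρ) (c : γ) :
    M.shift E (M.pencil E i c) = rename some (M.generic k i c) := by
  by_cases h : M i c = true
  · simp [StructMatrix.shift, StructMatrix.pencil, StructMatrix.generic, h]
  · simp [StructMatrix.shift, StructMatrix.pencil, StructMatrix.generic, h,
      not_not.1 (mt (hE i c) h)]

theorem StructMatrix.shift_eq_self {φ : MvPolynomial (Option M.Free) k}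
    (hφ : φ ∈ supported k {v : Option M.Free | ∀ p ∈ v, E p.1.1 p.1.2 = 0}) :
    M.shift E φ = φ := by
  conv_rhs => rw [← aeval_X_left_apply φ]
  refine eval₂Hom_congr' rfl (fun v hv _ => ?_) rfl
  have := mem_supported.1 hφ hv
  cases v with
  | none => rfl
  | some p => simp [this p rfl]

variable [Fintype γ] [DecidableEq γ]

theorem StructMatrix.IsTransversal.det_generic_ne_zero [Nontrivial k] (hf : M.IsTransversal f) :
    ((M.generic k).submatrix f id).det ≠ 0 := by
  classical
  let θ : M.Free → k := fun p => if p.1.1 = f p.1.2 then 1 else 0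
  have hθ : ((M.generic k).submatrix f id).map (eval θ) = 1 := by
    ext c c'
    by_cases h : M (f c) c' = true
    · simp [StructMatrix.generic, h, θ, one_apply, hf.1.eq_iff]
    · have hcc' : c ≠ c' := fun hcc' => h (hcc' ▸ hf.2 c)
      simp [StructMatrix.generic, h, hcc']
  intro h0
  have h1 := congrArg (eval θ) h0
  rw [RingHom.map_det, RingHom.mapMatrix_apply, hθ, det_one, map_zero] at h1
  exact one_ne_zero h1

theorem StructMatrix.det_pencil_mem_supported [Nontrivial k] :
    ((M.pencil E).submatrix f id).det ∈
      supported k {v : Option M.Free | ∀ p ∈ v, p.1.1 ∈ Set.range f} :=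
  det_mem_of_forall_mem _ fun c c' =>
    supported_mono (fun _ hv p hp => ⟨c, (hv p hp).symm⟩) (pencil_mem_supported (f c) c')

theorem StructMatrix.shift_det_pencil (hE : ∀ i c, E i c ≠ 0 → M i c = true) :
    M.shift E ((M.pencil E).submatrix f id).det =
      rename some ((M.generic k).submatrix f id).det := by
  rw [AlgHom.map_det, AlgHom.map_det]
  congr 1
  ext1 c c'
  exact shift_pencil hE (f c) c'

theorem StructMatrix.IsTransversal.det_pencil_ne_zero [Nontrivial k] (hf : M.IsTransversal f)
    (hE : ∀ i c, E i c ≠ 0 → M i c = true) : ((M.pencil E).submatrix f id).det ≠ 0 := by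
  intro h0
  have h1 := shift_det_pencil (f := f) hE
  rw [h0, map_zero] at h1
  exact hf.det_generic_ne_zero (rename_injective some (Option.some_injective _)
    (h1.symm.trans (map_zero _).symm))

/-- The shift fixes `φ`, as no variable that it moves occurs in all the minors, and it maps the
minors to polynomials without `s`. -/
theorem StructMatrix.mem_supported_of_forall_dvd_det_pencil [IsDomain k]
    (hE : ∀ i c, E i c ≠ 0 → M i c = true) (hM : ∃ f, M.IsTransversal f)
    (havoid : ∀ i c, E i c ≠ 0 → ∃ f, M.IsTransversal f ∧ i ∉ Set.range f)
    {φ : MvPolynomial (Option M.Free) k}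
    (hφ : ∀ f, M.IsTransversal f → φ ∣ ((M.pencil E).submatrix f id).det) :
    φ ∈ supported k (Set.range (some : M.Free → Option M.Free)) := by
  have hfix : M.shift E φ = φ := by
    refine shift_eq_self (mem_supported.2 fun v hv p hp => ?_)
    by_contra hEp
    obtain ⟨f, hf, hpf⟩ := havoid _ _ hEp
    exact hpf (mem_supported.1 (mem_supported_of_dvd det_pencil_mem_supported
      (hf.det_pencil_ne_zero hE) (hφ f hf)) hv p hp)
  obtain ⟨f, hf⟩ := hM
  have hdvd := map_dvd (M.shift E) (hφ f hf)
  rw [hfix, shift_det_pencil hE] at hdvd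
  refine mem_supported_of_dvd ?_ ?_ hdvd
  · classical
    refine mem_supported.2 fun v hv => ?_
    obtain ⟨p, -, rfl⟩ := Finset.mem_image.1 (vars_rename some _ hv)
    exact ⟨p, rfl⟩
  · exact fun h => hf.det_generic_ne_zero
      (rename_injective some (Option.some_injective _) (h.trans (map_zero _).symm))

omit [DecidableEq γ] in
theorem StructMatrix.generically_injective_pencil {M : StructMatrix ρ γ} {E : Matrix ρ γ ℝ}
    (hE : ∀ i c, E i c ≠ 0 → M i c = true) (hM : ∃ f, M.IsTransversal f)
    (havoid : ∀ i c, E i c ≠ 0 → ∃ f, M.IsTransversal f ∧ i ∉ Set.range f) :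
    Generically fun θ => ∀ (s : ℂ) (z : γ → ℂ),
      ((M.realize θ).map Complex.ofReal - s • E.map Complex.ofReal) *ᵥ z = 0 → z = 0 := by
  classical
  obtain ⟨f₀, hf₀⟩ := hM
  let D : (γ → ρ) → MvPolynomial (Option M.Free) ℝ := fun f => ((M.pencil E).submatrix f id).det
  obtain ⟨P, hP, hmem⟩ := exists_rename_some_mem_span (S := D '' {f | M.IsTransversal f})
    ⟨_, ⟨f₀, hf₀, rfl⟩, hf₀.det_pencil_ne_zero hE⟩ fun φ hφ =>
      mem_supported_of_forall_dvd_det_pencil hE ⟨f₀, hf₀⟩ havoid fun f hf => hφ _ ⟨f, hf, rfl⟩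
  refine ⟨P, hP, fun θ hθ s z hz => ?_⟩
  let ev : MvPolynomial (Option M.Free) ℝ →+* ℂ :=
    eval₂Hom Complex.ofRealHom fun v => v.elim s fun p => (θ p : ℂ)
  have hev (f : γ → ρ) : ev (D f) =
      (((M.realize θ).map Complex.ofReal - s • E.map Complex.ofReal).submatrix f id).det := by
    rw [RingHom.map_det]
    congr 1
    ext c c'
    by_cases h : M (f c) c' = true <;>
      simp [ev, StructMatrix.pencil, StructMatrix.generic, StructMatrix.realize, h, mul_comm]
  by_contra hz0
  have hle : Ideal.span (D '' {f | M.IsTransversal f}) ≤ RingHom.ker ev := by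
    rw [Ideal.span_le]
    rintro _ ⟨f, -, rfl⟩
    refine (hev f).trans (exists_mulVec_eq_zero_iff.1 ⟨z, hz0, ?_⟩)
    exact funext fun c => congrFun hz (f c)
  have hevP : ev (rename some P) = Complex.ofReal (eval θ P) := by
    simp only [ev, eval₂Hom_rename]
    exact (map_eval₂Hom (RingHom.id ℝ) θ Complex.ofRealHom P).symm
  have h0 : ev (rename some P) = 0 := hle hmem
  rw [hevP] at h0
  exact hθ (Complex.ofReal_eq_zero.1 h0)

end GenericPencil

open Relation

section Walks

variable {V : Type*} {E : V → V → Prop} {Q : Set V} {T : Finset V} {a b c v w e : V}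

/-- There is a walk from `a` to `b` that avoids the vertices in `Q`. -/
def AvoidReach (E : V → V → Prop) (Q : Set V) (a b : V) : Prop :=
  a ∉ Q ∧ ReflTransGen (fun c d => E c d ∧ d ∉ Q) a b

/-- There is a walk from `a` into `T` that avoids the vertex `v`; that is, `v` does not separate
`a` from `T`. -/
def Escapes (E : V → V → Prop) (T : Finset V) (v a : V) : Prop :=
  ∃ s ∈ T, AvoidReach E {v} a s

theorem AvoidReach.refl (h : a ∉ Q) : AvoidReach E Q a a := ⟨h, .refl⟩

theorem AvoidReach.head (ha : a ∉ Q) (h : E a b) (hb : AvoidReach E Q b c) :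
    AvoidReach E Q a c :=
  ⟨ha, hb.2.head ⟨h, hb.1⟩⟩

theorem AvoidReach.trans (h : AvoidReach E Q a b) (h' : AvoidReach E Q b c) :
    AvoidReach E Q a c :=
  ⟨h.1, h.2.trans h'.2⟩

theorem AvoidReach.notMem_right (h : AvoidReach E Q a b) : b ∉ Q := by
  rcases h.2.cases_tail with rfl | ⟨c, -, -, hb⟩
  exacts [h.1, hb]

theorem AvoidReach.anti {Q' : Set V} (hQ : Q' ⊆ Q) (h : AvoidReach E Q a b) :
    AvoidReach E Q' a b :=
  ⟨fun ha => h.1 (hQ ha), h.2.lift id fun _ _ h => ⟨h.1, fun hd => h.2 (hQ hd)⟩⟩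

theorem AvoidReach.mem_of_forall_mem {Z : Set V} (h : AvoidReach E Q a b) (ha : a ∈ Z)
    (hZ : ∀ c d, c ∈ Z → E c d → d ∉ Q → d ∈ Z) : b ∈ Z := by
  obtain ⟨-, h⟩ := h
  induction h with
  | refl => exact ha
  | tail _ h ih => exact hZ _ _ ih h.1 h.2

theorem Escapes.head (ha : a ≠ v) (h : E a b) (hb : Escapes E T v b) : Escapes E T v a :=
  let ⟨s, hs, hr⟩ := hb
  ⟨s, hs, hr.head ha h⟩

theorem Escapes.ne (h : Escapes E T v a) : a ≠ v :=
  let ⟨_, _, hr⟩ := h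
  hr.1

theorem not_escapes_self : ¬ Escapes E T v v := fun h => h.ne rfl

theorem escapes_of_mem (ha : a ∈ T) (hav : a ≠ v) : Escapes E T v a := ⟨a, ha, .refl hav⟩

theorem AvoidReach.escapes (h : AvoidReach E {v} a b) (hb : Escapes E T v b) : Escapes E T v a :=
  let ⟨s, hs, hr⟩ := hb
  ⟨s, hs, h.trans hr⟩

theorem Escapes.mono {E' : V → V → Prop} (h : Escapes E T v a) (hE : ∀ c d, E c d → E' c d) :
    Escapes E' T v a :=
  let ⟨s, hs, hav, hr⟩ := h
  ⟨s, hs, hav, hr.lift id fun _ _ h => ⟨hE _ _ h.1, h.2⟩⟩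

theorem Escapes.subtype {p : V → Prop} [DecidablePred p] {v a : Subtype p}
    (h : Escapes (fun c d => E c d ∧ p d) T (v : V) a) :
    Escapes (fun c d : Subtype p => E c d) (T.subtype p) v a := by
  obtain ⟨s, hs, hav, hr⟩ := h
  suffices ∃ hb : p s, ReflTransGen (fun c d : Subtype p => E c d ∧ d ∉ ({v} : Set _)) a ⟨s, hb⟩ by
    obtain ⟨hb, hr⟩ := this
    exact ⟨⟨s, hb⟩, Finset.mem_subtype.2 hs, fun h => hav (congrArg Subtype.val h), hr⟩
  clear hs
  induction hr with
  | refl => exact ⟨a.2, .refl⟩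
  | tail _ h ih =>
    obtain ⟨_, ih⟩ := ih
    exact ⟨h.1.2, ih.tail ⟨h.1.1, fun hd => h.2 (congrArg Subtype.val hd)⟩⟩

theorem exists_last_not {r : V → V → Prop} {p : V → Prop} (h : ReflTransGen r a b) (ha : ¬ p a) :
    ∃ w, ¬ p w ∧ ReflTransGen (fun c d => r c d ∧ p d) w b := by
  induction h with
  | refl => exact ⟨a, ha, .refl⟩
  | @tail c d _ hcd ih =>
    by_cases hd : p d
    · obtain ⟨w, hw, hwc⟩ := ih
      exact ⟨w, hw, hwc.tail ⟨hcd, hd⟩⟩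
    · exact ⟨d, hd, .refl⟩

theorem avoidReach_or_avoidReach (hne : w ≠ e) (h : ReflTransGen E a w) :
    AvoidReach E {e} a w ∨ AvoidReach E {w} a e := by
  induction h using ReflTransGen.head_induction_on with
  | refl => exact .inl (.refl hne)
  | @head a c h _ ih =>
    by_cases hae : a = e
    · exact .inr (hae ▸ .refl (hae ▸ hne.symm))
    by_cases haw : a = w
    · exact .inl (haw ▸ .refl (haw ▸ hae))
    · exact ih.imp (.head hae h) (.head haw h)

theorem reach_through_of_not_escapes (hb : b ∈ T) (h : ReflTransGen E a b)
    (hv : ¬ Escapes E T v a) : ReflTransGen E a v ∧ ReflTransGen E v b := by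
  induction h using ReflTransGen.head_induction_on with
  | refl =>
    obtain rfl : b = v := by_contra fun hbv => hv (escapes_of_mem hb hbv)
    exact ⟨.refl, .refl⟩
  | @head a c h h' ih =>
    by_cases hav : a = v
    · exact ⟨hav ▸ .refl, hav ▸ h'.head h⟩
    · exact (ih fun hc => hv (hc.head hav h)).imp_left (.head h)

theorem exists_nodup_chain (h : ReflTransGen E a b) :
    ∃ l : List V, l.IsChain E ∧ l.Nodup ∧ l.head? = some a ∧ l.getLast? = some b := by
  induction h using ReflTransGen.head_induction_on with
  | refl => exact ⟨[b], by simp⟩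
  | @head a c h _ ih =>
    obtain ⟨l, hl, hn, hh, hlast⟩ := ih
    by_cases ha : a ∈ l
    · obtain ⟨l₁, l₂, rfl⟩ := List.append_of_mem ha
      refine ⟨a :: l₂, hl.right_of_append, (List.nodup_append.1 hn).2.1, rfl, ?_⟩
      rwa [List.getLast?_append_of_ne_nil _ (by simp)] at hlast
    · obtain ⟨l, rfl⟩ : ∃ l', l = c :: l' := by simpa [List.head?_eq_some_iff] using hh
      exact ⟨a :: c :: l, List.isChain_cons_cons.2 ⟨h, hl⟩, List.nodup_cons.2 ⟨ha, hn⟩, rfl,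
        by simpa using hlast⟩

theorem reach_of_mem_chain {l : List V} (hl : l.IsChain E) (hh : l.head? = some a) (hc : c ∈ l) :
    ReflTransGen E a c := by
  induction l generalizing a with
  | nil => simp at hh
  | cons d l ih =>
    obtain rfl : d = a := by simpa using hh
    rcases List.mem_cons.1 hc with rfl | hc
    · exact .refl
    · cases l with
      | nil => simp at hc
      | cons d' l =>
        rw [List.isChain_cons_cons] at hl
        exact (ih hl.2 rfl hc).head hl.1

theorem eq_of_reach_of_leftUnique (hE : Relator.LeftUnique E) (ha : ∀ d, ¬ E d a)
    (hb : ∀ d, ¬ E d b) (hac : ReflTransGen E a c) (hbc : ReflTransGen E b c) : a = b := by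
  induction hac with
  | refl =>
    rcases hbc.cases_tail with h | ⟨d, -, h⟩
    · exact h
    · exact absurd h (ha d)
  | tail _ h ih =>
    rcases hbc.cases_tail with rfl | ⟨d, hd, h'⟩
    · exact absurd h (hb _)
    · exact ih (hE h' h ▸ hd)

end Walks

section Matching

variable {V : Type*} {E : V → V → Prop} {S B : Finset V}

open Classical in
/-- The possible partners of a vertex in a matching that encodes disjoint walks from `B` to `S`:
a successor or the vertex itself, outside `B`, or, as `Sum.inr`, the end of a walk in `S`. -/
noncomputable def linkPartners [Fintype V] (E : V → V → Prop) (S B : Finset V) (c : V) :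
    Finset (V ⊕ V) :=
  {r | r.elim (fun d => d ∉ B ∧ (E c d ∨ c = d)) fun s => s = c ∧ c ∈ S}

theorem inl_mem_linkPartners [Fintype V] {c d : V} :
    Sum.inl d ∈ linkPartners E S B c ↔ d ∉ B ∧ (E c d ∨ c = d) := by
  simp [linkPartners]

theorem inr_mem_linkPartners [Fintype V] {c s : V} :
    Sum.inr s ∈ linkPartners E S B c ↔ s = c ∧ c ∈ S := by
  simp [linkPartners]

/-- A violation `Z` of Hall's condition is separated from its complement and from `S` by its
partners other than `Z \ B`. -/
theorem exists_separator_of_card_biUnion_lt [Fintype V] [DecidableEq V] {Z : Finset V}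
    (hZ : (Z.biUnion (linkPartners E S B)).card < Z.card) :
    ∃ Q : Finset V, Q.card < B.card ∧ ∀ b ∈ B, ∀ s ∈ S, ¬ AvoidReach E (Q : Set V) b s := by
  let U := Z.biUnion (linkPartners E S B)
  let N : Finset (V ⊕ V) := (Z \ B).image Sum.inl
  let Q : Finset V := (U \ N).image (Sum.elim id id) ∪ (B \ Z)
  have hNU : N ⊆ U := by
    intro r hr
    obtain ⟨d, hd, rfl⟩ := Finset.mem_image.1 hr
    rw [Finset.mem_sdiff] at hd
    exact Finset.mem_biUnion.2 ⟨d, hd.1, inl_mem_linkPartners.2 ⟨hd.2, .inr rfl⟩⟩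
  have hmemQ (r : V ⊕ V) (hrU : r ∈ U) (hrN : r ∉ N) : Sum.elim id id r ∈ Q :=
    Finset.mem_union_left _ (Finset.mem_image_of_mem _ (Finset.mem_sdiff.2 ⟨hrU, hrN⟩))
  refine ⟨Q, ?_, fun b hb s hs hbs => ?_⟩
  · have hQ : Q.card ≤ (U \ N).card + (B \ Z).card :=
      (Finset.card_union_le _ _).trans (Nat.add_le_add_right Finset.card_image_le _)
    have hN : N.card = (Z \ B).card := Finset.card_image_of_injective _ Sum.inl_injective
    have hUN := Finset.card_sdiff_add_card_eq_card hNU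
    have hZB := Finset.card_sdiff_add_card_inter Z B
    have hBZ := Finset.card_sdiff_add_card_inter B Z
    rw [Finset.inter_comm] at hBZ
    change U.card < Z.card at hZ
    lia
  · have hbZ : b ∈ Z := by_contra fun hbZ => hbs.1 (by simp [Q, hb, hbZ])
    have hsZ : s ∈ (Z : Set V) := hbs.mem_of_forall_mem hbZ fun c d hc hcd hd => by
      by_contra hdZ
      by_cases hdB : d ∈ B
      · exact hd (by simp [Q, hdB, mt Finset.mem_coe.2 hdZ])
      · refine hd (hmemQ (Sum.inl d) (Finset.mem_biUnion.2
          ⟨c, hc, inl_mem_linkPartners.2 ⟨hdB, .inl hcd⟩⟩) ?_)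
        simp [N, mt Finset.mem_coe.2 hdZ]
    exact hbs.notMem_right (hmemQ (Sum.inr s) (Finset.mem_biUnion.2
      ⟨s, hsZ, inr_mem_linkPartners.2 ⟨rfl, hs⟩⟩) (by simp [N]))

/-- Menger's theorem as a statement about matchings, deduced from Hall's theorem. -/
theorem exists_matching_of_not_separated [Finite V] (h : ∀ Q : Finset V, Q.card < B.card →
      ∃ b ∈ B, ∃ s ∈ S, AvoidReach E (Q : Set V) b s) :
    ∃ f : V → V ⊕ V, Function.Injective f ∧
      (∀ c d, f c = Sum.inl d → d ∉ B ∧ (E c d ∨ c = d)) ∧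
      ∀ c s, f c = Sum.inr s → s = c ∧ c ∈ S := by
  classical
  have := Fintype.ofFinite V
  obtain ⟨f, hf, hft⟩ := (Finset.all_card_le_biUnion_card_iff_exists_injective
    (linkPartners E S B)).1 fun Z => by
      by_contra! hZ
      obtain ⟨Q, hQ, hsep⟩ := exists_separator_of_card_biUnion_lt hZ
      obtain ⟨b, hb, s, hs, hbs⟩ := h Q hQ
      exact hsep b hb s hs hbs
  exact ⟨f, hf, fun c d hd => inl_mem_linkPartners.1 (hd ▸ hft c),
    fun c s hs => inr_mem_linkPartners.1 (hs ▸ hft c)⟩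

theorem exists_matching_of_two_sources [Finite V] {a b : V} (hab : a ≠ b)
    (h : ∀ v, Escapes E S v a ∨ Escapes E S v b) :
    ∃ f : V → V ⊕ V, Function.Injective f ∧
      (∀ c d, f c = Sum.inl d → d ≠ a ∧ d ≠ b ∧ (E c d ∨ c = d)) ∧
      ∀ c s, f c = Sum.inr s → s = c ∧ c ∈ S := by
  classical
  obtain ⟨f, hf, hinl, hinr⟩ := exists_matching_of_not_separated (E := E) (S := S) (B := {a, b})
    fun Q hQ => by
      rw [Finset.card_pair hab, Nat.lt_succ_iff] at hQ
      have : Nonempty V := ⟨a⟩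
      obtain ⟨v, hv⟩ := Finset.card_le_one_iff_subset_singleton.1 hQ
      have hv' : (Q : Set V) ⊆ {v} := by exact_mod_cast hv
      rcases h v with ⟨s, hs, hr⟩ | ⟨s, hs, hr⟩
      · exact ⟨a, by simp, s, hs, hr.anti hv'⟩
      · exact ⟨b, by simp, s, hs, hr.anti hv'⟩
  refine ⟨f, hf, fun c d hcd => ?_, hinr⟩
  obtain ⟨hd, hcd⟩ := hinl c d hcd
  simp only [Finset.mem_insert, Finset.mem_singleton, not_or] at hd
  exact ⟨hd.1, hd.2, hcd⟩

end Matching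

section LastSeparator

variable {V : Type*} {E : V → V → Prop} {T : Finset V} {x w e d j v : V}

/-- `w` is the last of the vertices that separate `x` from `T`: from `w`, some walk reaches `T`
through vertices that do not separate. -/
structure IsLastSeparator (E : V → V → Prop) (T : Finset V) (x w : V) : Prop where
  exists_reach : ∃ s ∈ T, ReflTransGen E x s
  not_escapes : ¬ Escapes E T w x
  exists_tail : ∃ s ∈ T, ReflTransGen (fun c d => E c d ∧ Escapes E T d x) w s

theorem exists_isLastSeparator (h : ∃ s ∈ T, ReflTransGen E x s) : ∃ w, IsLastSeparator E T x w :=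
  let ⟨s, hs, hr⟩ := h
  let ⟨w, hw, hws⟩ := exists_last_not (p := fun d => Escapes E T d x) hr not_escapes_self
  ⟨w, ⟨s, hs, hr⟩, hw, s, hs, hws⟩

namespace IsLastSeparator

theorem reach_of_not_escapes (h : IsLastSeparator E T x w) (he : ¬ Escapes E T e x) :
    ReflTransGen E x e :=
  let ⟨_, hs, hr⟩ := h.exists_reach
  (reach_through_of_not_escapes hs hr he).1

theorem escapes_of_not_escapes (h : IsLastSeparator E T x w) (hwe : w ≠ e)
    (he : ¬ Escapes E T e x) : Escapes E T e w := by
  obtain ⟨s, hs, hr⟩ := h.exists_tail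
  refine ⟨s, hs, hwe, hr.lift id fun c d hcd => ⟨hcd.1, ?_⟩⟩
  rintro rfl
  exact he hcd.2

theorem not_escapes_separator (h : IsLastSeparator E T x w) (he : ¬ Escapes E T e x)
    (hne : e ≠ w) : ¬ Escapes E T w e := by
  intro hew
  rcases avoidReach_or_avoidReach hne.symm (h.reach_of_not_escapes h.not_escapes) with hxw | hxe
  · exact he (hxw.escapes (h.escapes_of_not_escapes hne.symm he))
  · exact h.not_escapes (hxe.escapes hew)

theorem reach_separator (h : IsLastSeparator E T x w) (he : ¬ Escapes E T e x) (hne : e ≠ w) :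
    ReflTransGen E e w := by
  obtain ⟨s, hs, hr⟩ := h.exists_reach
  exact (reach_through_of_not_escapes hs (reach_through_of_not_escapes hs hr he).2
    (h.not_escapes_separator he hne)).1

theorem notMem (h : IsLastSeparator E T x w) (he : ¬ Escapes E T e x) (hne : e ≠ w) : e ∉ T :=
  fun heT => h.not_escapes_separator he hne (escapes_of_mem heT hne)

theorem not_escapes_of_edge (h : IsLastSeparator E T x w)
    (hsep : ∀ j v, Escapes E T j x → Escapes E T v x ∨ Escapes E T v j)
    (he : ¬ Escapes E T e x) (hne : e ≠ w) (hed : E e d) : ¬ Escapes E T d x := fun hd =>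
  h.not_escapes_separator he hne (.head hne hed ((hsep d w hd).resolve_left h.not_escapes))

/-- Two members of `Z` with a common successor, from which a walk reaches `w` outside `Z`, are both
separators, so each would have to precede the other on every walk from `x`. -/
theorem eq_empty_of_forall_edge (h : IsLastSeparator E T x w) {Z : Set V}
    (hZ : ∀ e ∈ Z, ¬ Escapes E T e x ∧ e ≠ w)
    (hstep : ∀ e ∈ Z, ∀ f ∉ Z, E e f → ∃ c ∈ Z, c ≠ e ∧ E c f) : Z = ∅ := by
  by_contra! hne
  obtain ⟨e₀, he₀⟩ := hne
  obtain ⟨e, he, hew⟩ := exists_last_not (p := (· ∉ Z))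
    (h.reach_separator (hZ e₀ he₀).1 (hZ e₀ he₀).2) (not_not.2 he₀)
  rw [not_not] at he
  rcases hew.cases_head with heq | ⟨f, ⟨hef, hfZ⟩, hfw⟩
  · exact (hZ e he).2 heq
  have hreach : ∀ g ∈ Z, AvoidReach E {g} f w := fun g hg =>
    AvoidReach.anti (Set.singleton_subset_iff.2 hg) ⟨hfZ, hfw⟩
  have hnot : ∀ g, ∀ g' ∈ Z, E g f → g ≠ g' → ¬ AvoidReach E {g'} x g :=
    fun g g' hg' hgf hgg hxg => (hZ g' hg').1 <| hxg.escapes <| .head hgg hgf <|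
      (hreach g' hg').escapes (h.escapes_of_not_escapes (hZ g' hg').2.symm (hZ g' hg').1)
  obtain ⟨c, hc, hce, hcf⟩ := hstep e he f hfZ hef
  rcases avoidReach_or_avoidReach hce (h.reach_of_not_escapes (hZ c hc).1) with hxc | hxe
  · exact hnot c e he hcf hce hxc
  · exact hnot e c hc hef hce.symm hxe

theorem escapes_tail (h : IsLastSeparator E T x w) (hv : Escapes E T v x) :
    Escapes (fun c d => E c d ∧ (Escapes E T d x ∨ d = w)) T v w := by
  obtain ⟨s, hs, hr⟩ := id hv
  obtain ⟨w', hw', hr'⟩ := exists_last_not (p := fun d => Escapes E T d x) hr.2 not_escapes_self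
  obtain rfl : w' = w := by
    by_contra hne
    refine h.not_escapes_separator hw' hne ⟨s, hs, hne, hr'.lift id fun c d hcd => ⟨hcd.1.1, ?_⟩⟩
    rintro rfl
    exact h.not_escapes hcd.2
  refine ⟨s, hs, ?_, hr'.lift id fun c d hcd => ⟨⟨hcd.1.1, .inl hcd.2⟩, hcd.1.2⟩⟩
  rintro rfl
  exact hw' hv

theorem escapes_tail_of_escapes (h : IsLastSeparator E T x w) (hj : Escapes E T w j) :
    Escapes (fun c d => E c d ∧ (Escapes E T d x ∨ d = w)) T w j := by
  obtain ⟨s, hs, hjw, hr⟩ := hj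
  refine ⟨s, hs, hjw, ?_⟩
  clear hjw
  induction hr using ReflTransGen.head_induction_on with
  | refl => exact .refl
  | @head a c hac hcs ih =>
    have hc : Escapes E T c x :=
      by_contra fun hc => h.not_escapes_separator hc hac.2 ⟨s, hs, hac.2, hcs⟩
    exact ih.head ⟨⟨hac.1, .inl hc⟩, hac.2⟩

end IsLastSeparator

end LastSeparator

/-- The edges of the auxiliary system between the original states. -/
def auxEdge {X : Type} (A : StructMatrix X X) (x : X) (a b : X) : Prop := A b a = true ∧ b ≠ x

/-- Every state reaches a state in `T`. -/
def Hits {X : Type} (A : StructMatrix X X) (x : X) (T : Finset X) : Prop :=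
  ∀ j, ∃ s ∈ T, ReflTransGen (auxEdge A x) j s

section Linkings

variable {V : Type} {G : Digraph V} {V₁ V₂ : Set V}

theorem IsLinking.card_le {L : Finset (List V)} (hL : IsLinking G V₁ V₂ L) {F : Finset V}
    (hF : V₁ ⊆ F) : L.card ≤ F.card := by
  classical
  rw [← Finset.card_image_of_injective F (Option.some_injective V)]
  refine Finset.card_le_card_of_injOn List.head? ?_ ?_
  · intro p hp
    obtain ⟨v, hv, hpv⟩ := (hL.1 p hp).2.2.1
    exact Finset.mem_coe.2 (Finset.mem_image.2 ⟨v, hF hv, hpv.symm⟩)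
  · intro p hp q hq hpq
    by_contra hne
    obtain ⟨v, -, hpv⟩ := (hL.1 p hp).2.2.1
    exact hL.2 p hp q hq hne (List.mem_of_mem_head? hpv) (List.mem_of_mem_head? (hpq ▸ hpv))

theorem rho_le [Finite V] {k : ℕ} (h : ∀ L, IsLinking G V₁ V₂ L → L.card ≤ k) :
    rho G V₁ V₂ ≤ k := by
  refine csSup_le' ?_
  rintro _ ⟨L, hL, rfl⟩
  exact h L hL

theorem IsLinking.le_rho [Finite V] {L : Finset (List V)} (hL : IsLinking G V₁ V₂ L) :
    L.card ≤ rho G V₁ V₂ := by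
  have := Fintype.ofFinite V
  refine le_csSup ⟨(Finset.univ : Finset V).card, ?_⟩ ⟨L, hL, rfl⟩
  rintro _ ⟨L', hL', rfl⟩
  exact hL'.card_le (by simp)

theorem IsPath.isLinking {p : List V} (hp : IsPath G V₁ V₂ p) : IsLinking G V₁ V₂ {p} :=
  ⟨by simpa using hp, by simp⟩

theorem exists_linking_card_eq_two {r : V → V → Prop} {a b c d : V}
    (hrG : ∀ g g', r g g' → G.Adj g g') (hr : Relator.LeftUnique r) (ha : ∀ g, ¬ r g a)
    (hb : ∀ g, ¬ r g b) (hab : a ≠ b) (hac : ReflTransGen r a c) (hbd : ReflTransGen r b d)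
    (hc : c ∈ V₂) (hd : d ∈ V₂) : ∃ L, IsLinking G {a, b} V₂ L ∧ L.card = 2 := by
  classical
  obtain ⟨p, hp, hpn, hph, hpl⟩ := exists_nodup_chain hac
  obtain ⟨q, hq, hqn, hqh, hql⟩ := exists_nodup_chain hbd
  have hdisj : List.Disjoint p q := fun g hgp hgq => hab <|
    eq_of_reach_of_leftUnique hr ha hb (reach_of_mem_chain hp hph hgp)
      (reach_of_mem_chain hq hqh hgq)
  have hpq : p ≠ q := by
    rintro rfl
    exact hdisj (List.mem_of_mem_head? hph) (List.mem_of_mem_head? hph)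
  refine ⟨{p, q}, ⟨?_, ?_⟩, Finset.card_pair hpq⟩ <;>
    simp only [Finset.mem_insert, Finset.mem_singleton, forall_eq_or_imp, forall_eq]
  · exact ⟨⟨hp.imp hrG, hpn, ⟨a, .inl rfl, hph⟩, c, hc, hpl⟩,
      hq.imp hrG, hqn, ⟨b, .inr rfl, hqh⟩, d, hd, hql⟩
  · exact ⟨⟨fun h => absurd rfl h, fun _ => hdisj⟩, fun _ => hdisj.symm, fun h => absurd rfl h⟩

theorem exists_reach_of_injective {W : Type} [Finite V] {f : V → V ⊕ W}
    (hf : Function.Injective f) {a : V} (ha : ∀ c, f c ≠ Sum.inl a) :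
    ∃ c s, ReflTransGen (fun c d => f c = Sum.inl d ∧ c ≠ d) a c ∧ f c = Sum.inr s := by
  classical
  have := Fintype.ofFinite V
  by_contra! hno
  let O : Finset V := {c | ReflTransGen (fun c d => f c = Sum.inl d ∧ c ≠ d) a c}
  have haO : a ∈ O := by simp [O, ReflTransGen.refl]
  have hmaps : Set.MapsTo f O ((O.erase a).image Sum.inl : Finset (V ⊕ W)) := by
    intro c hc
    cases hfc : f c with
    | inr s => exact absurd hfc (hno c s (by simpa [O] using hc))
    | inl d =>
      refine Finset.mem_coe.2 (Finset.mem_image_of_mem _ (Finset.mem_erase.2 ⟨?_, ?_⟩))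
      · rintro rfl
        exact ha c hfc
      · by_cases hcd : c = d
        · exact hcd ▸ hc
        · simpa [O] using ReflTransGen.tail (by simpa [O] using hc) ⟨hfc, hcd⟩
  have hcard := Finset.card_le_card_of_injOn f hmaps hf.injOn
  rw [Finset.card_image_of_injective _ Sum.inl_injective] at hcard
  exact absurd hcard (not_le.2 (Finset.card_erase_lt_of_mem haO))

end Linkings

section MatchingEdge

variable {X : Type} {f : X → X ⊕ X} {x : X} {T : Finset X}

/-- The edges of `sensorDigraph` that a matching `f` of states with later states or sensors selects,
together with the edge that leaves the input. -/
def matchingEdge (f : X → X ⊕ X) (x : X) :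
    (X ⊕ Unit) ⊕ (X ⊕ Unit) → (X ⊕ Unit) ⊕ (X ⊕ Unit) → Prop
  | Sum.inl (Sum.inr _), Sum.inl (Sum.inl b) => b = x
  | Sum.inl (Sum.inl a), Sum.inl (Sum.inl b) => f a = Sum.inl b ∧ a ≠ b
  | Sum.inl (Sum.inl a), Sum.inr (Sum.inl b) => f a = Sum.inr b
  | _, _ => False

theorem matchingEdge_leftUnique (hf : Function.Injective f)
    (hfx : ∀ c, f c ≠ Sum.inl x) : Relator.LeftUnique (matchingEdge f x) := by
  rintro ((a | k) | y) ((a' | k') | y') ((b | l) | (b | l)) h h' <;>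
    simp only [matchingEdge] at h h' <;> try rfl
  · rw [hf (h.1.trans h'.1.symm)]
  · rw [hf (h.trans h'.symm)]
  · exact absurd (h' ▸ h.1) (hfx a)
  · exact absurd (h ▸ h'.1) (hfx a')

theorem matchingEdge_reach [Finite X] (hf : Function.Injective f)
    (hinr : ∀ c s, f c = Sum.inr s → s = c ∧ c ∈ T) {a : X} (ha : ∀ c, f c ≠ Sum.inl a) :
    ∃ s ∈ T, ReflTransGen (matchingEdge f x) (Sum.inl (Sum.inl a)) (Sum.inr (Sum.inl s)) := by
  obtain ⟨c, s, hac, hcs⟩ := exists_reach_of_injective hf ha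
  obtain ⟨rfl, hs⟩ := hinr c s hcs
  exact ⟨s, hs, (hac.lift (fun a => Sum.inl (Sum.inl a)) fun _ _ h => h).tail hcs⟩

end MatchingEdge

section Violation

variable {X : Type} [DecidableEq X] {A : StructMatrix X X} {x : X} {T : Finset X}

/-- The digraph of the auxiliary system with sensors on the states in `T`. -/
abbrev sensorDigraph (A : StructMatrix X X) (x : X) (T : Finset X) :
    Digraph ((X ⊕ Unit) ⊕ (X ⊕ Unit)) :=
  outputDigraph (auxSystem A x) (sensorMatrix (T.image Sum.inl))

/-- The sensor vertices of `sensorDigraph`. -/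
abbrev sensorVertices (T : Finset X) : Set ((X ⊕ Unit) ⊕ (X ⊕ Unit)) :=
  {v | ∃ s ∈ T.image (Sum.inl : X → X ⊕ Unit), v = Sum.inr s}

theorem sensorDigraph_adj_state {a b : X} :
    (sensorDigraph A x T).Adj (Sum.inl (Sum.inl a)) (Sum.inl (Sum.inl b)) ↔ auxEdge A x a b := by
  simp [outputDigraph, auxSystem, auxEdge]

theorem sensorDigraph_adj_sensor {a : X} {y : X ⊕ Unit} :
    (sensorDigraph A x T).Adj (Sum.inl (Sum.inl a)) (Sum.inr y) ↔ y = Sum.inl a ∧ a ∈ T := by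
  simp [outputDigraph, sensorMatrix]

theorem sensorDigraph_adj_state_input {a : X} {k : Unit} :
    ¬ (sensorDigraph A x T).Adj (Sum.inl (Sum.inl a)) (Sum.inl (Sum.inr k)) := by
  simp [outputDigraph, auxSystem]

theorem sensorDigraph_adj_input_state {b : X} {k : Unit} :
    (sensorDigraph A x T).Adj (Sum.inl (Sum.inr k)) (Sum.inl (Sum.inl b)) ↔ b = x := by
  simp [outputDigraph, auxSystem]

theorem sensorDigraph_adj_input {k : Unit} {g : (X ⊕ Unit) ⊕ (X ⊕ Unit)}
    (h : (sensorDigraph A x T).Adj (Sum.inl (Sum.inr k)) g) : g = Sum.inl (Sum.inl x) := by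
  rcases g with (b | k') | y
  · rw [sensorDigraph_adj_input_state] at h
    rw [h]
  · simp [outputDigraph, auxSystem] at h
  · simp [outputDigraph, sensorMatrix] at h

theorem escapes_of_chain {v a : X} {p : List ((X ⊕ Unit) ⊕ (X ⊕ Unit))}
    (hp : p.IsChain (sensorDigraph A x T).Adj) (hh : p.head? = some (Sum.inl (Sum.inl a)))
    (hl : ∃ w ∈ sensorVertices T, p.getLast? = some w) (hv : Sum.inl (Sum.inl v) ∉ p) :
    Escapes (auxEdge A x) T v a := by
  induction p generalizing a with
  | nil => simp at hh
  | cons g p ih =>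
    simp only [List.head?_cons, Option.some.injEq] at hh
    subst hh
    have hav : a ≠ v := by rintro rfl; simp at hv
    cases p with
    | nil =>
      obtain ⟨w, ⟨s, -, rfl⟩, hw⟩ := hl
      simp at hw
    | cons g' p =>
      rw [List.isChain_cons_cons] at hp
      rcases g' with (b | k) | y
      · refine (ih hp.2 rfl (by simpa using hl) fun h => hv (List.mem_cons_of_mem _ h)).head hav
          (sensorDigraph_adj_state.1 hp.1)
      · exact absurd hp.1 sensorDigraph_adj_state_input
      · exact ⟨a, (sensorDigraph_adj_sensor.1 hp.1).2, .refl (by simpa using hav)⟩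

theorem escapes_of_path {v : X} {p : List ((X ⊕ Unit) ⊕ (X ⊕ Unit))}
    (hp : IsPath (sensorDigraph A x T) {Sum.inl (Sum.inr ())} (sensorVertices T) p)
    (hv : Sum.inl (Sum.inl v) ∉ p) : Escapes (auxEdge A x) T v x := by
  obtain ⟨hc, -, ⟨_, rfl, hh⟩, hl⟩ := hp
  cases p with
  | nil => simp at hh
  | cons g p =>
    simp only [List.head?_cons, Option.some.injEq] at hh
    subst hh
    cases p with
    | nil =>
      obtain ⟨w, ⟨s, -, rfl⟩, hw⟩ := hl
      simp at hw
    | cons g' p =>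
      rw [List.isChain_cons_cons] at hc
      obtain rfl := sensorDigraph_adj_input hc.1
      exact escapes_of_chain hc.2 rfl (by simpa using hl) fun h => hv (List.mem_cons_of_mem _ h)

theorem exists_path_of_avoidReach {Q : Set X} {s : X} (hs : s ∈ T)
    (h : AvoidReach (auxEdge A x) Q x s) :
    ∃ p, IsPath (sensorDigraph A x T) {Sum.inl (Sum.inr ())} (sensorVertices T) p ∧
      ∀ v ∈ Q, Sum.inl (Sum.inl v) ∉ p := by
  obtain ⟨hx, hr⟩ := h
  let r : (X ⊕ Unit) ⊕ (X ⊕ Unit) → (X ⊕ Unit) ⊕ (X ⊕ Unit) → Prop := fun g g' =>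
    (sensorDigraph A x T).Adj g g' ∧ ∀ v ∈ Q, g' ≠ Sum.inl (Sum.inl v)
  have h1 : ReflTransGen r (Sum.inl (Sum.inl x)) (Sum.inl (Sum.inl s)) :=
    hr.lift (fun a => Sum.inl (Sum.inl a)) fun a b hab =>
      ⟨sensorDigraph_adj_state.2 hab.1, fun v hv hbv =>
        hab.2 (Sum.inl_injective (Sum.inl_injective hbv) ▸ hv)⟩
  have h2 : ReflTransGen r (Sum.inl (Sum.inr ())) (Sum.inr (Sum.inl s)) :=
    (h1.tail ⟨sensorDigraph_adj_sensor.2 ⟨rfl, hs⟩, by simp⟩).head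
      ⟨sensorDigraph_adj_input_state.2 rfl, fun v hv hxv =>
        hx (Sum.inl_injective (Sum.inl_injective hxv) ▸ hv)⟩
  obtain ⟨p, hp, hn, hh, hl⟩ := exists_nodup_chain h2
  refine ⟨p, ⟨hp.imp fun _ _ h => h.1, hn, ⟨_, rfl, hh⟩, ⟨_, ⟨_, ?_, rfl⟩, hl⟩⟩, fun v hv hvp => ?_⟩
  · exact Finset.mem_image_of_mem _ hs
  · rcases (reach_of_mem_chain hp hh hvp).cases_tail with h | ⟨g, -, h⟩
    · simp at h
    · exact h.2 v hv rfl

theorem exists_disjoint_paths [Finite X] {j : X} (hj : x ≠ j)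
    (h : ∀ v, Escapes (auxEdge A x) T v x ∨ Escapes (auxEdge A x) T v j) :
    ∃ L, IsLinking (sensorDigraph A x T) {Sum.inl (Sum.inr ()), Sum.inl (Sum.inl j)}
      (sensorVertices T) L ∧ L.card = 2 := by
  obtain ⟨f, hf, hinl, hinr⟩ := exists_matching_of_two_sources hj h
  have hadj : ∀ g g', matchingEdge f x g g' → (sensorDigraph A x T).Adj g g' := by
    rintro ((a | k) | y) ((b | k') | (b | k')) h <;> simp only [matchingEdge] at h
    · exact sensorDigraph_adj_state.2 ((hinl a b h.1).2.2.resolve_right h.2)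
    · obtain ⟨rfl, hb⟩ := hinr a b h
      exact sensorDigraph_adj_sensor.2 ⟨rfl, hb⟩
    · exact sensorDigraph_adj_input_state.2 h
  have hfx : ∀ c, f c ≠ Sum.inl x := fun c hc => (hinl c x hc).1 rfl
  obtain ⟨s, hs, hxs⟩ := matchingEdge_reach (x := x) hf hinr hfx
  obtain ⟨t, ht, hjt⟩ := matchingEdge_reach (x := x) hf hinr fun c hc => (hinl c j hc).2.1 rfl
  refine exists_linking_card_eq_two hadj (matchingEdge_leftUnique hf hfx) ?_ ?_ (by simp)
    (hxs.head (show matchingEdge f x (Sum.inl (Sum.inr ())) (Sum.inl (Sum.inl x)) from rfl)) hjt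
    ⟨_, Finset.mem_image_of_mem _ hs, rfl⟩ ⟨_, Finset.mem_image_of_mem _ ht, rfl⟩
  · rintro ((a | k) | y) h <;> exact h
  · rintro ((a | k) | y) h <;> simp only [matchingEdge] at h
    · exact (hinl _ _ h.1).2.1 rfl
    · exact hj h.symm

theorem rho_input_eq_one [Finite X] (hT : ∃ s ∈ T, ReflTransGen (auxEdge A x) x s) :
    rho (sensorDigraph A x T) {Sum.inl (Sum.inr ())} (sensorVertices T) = 1 := by
  obtain ⟨s, hs, hr⟩ := hT
  obtain ⟨p, hp, -⟩ := exists_path_of_avoidReach (Q := ∅) hs ⟨by simp, by simpa using hr⟩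
  refine le_antisymm (rho_le fun L hL => ?_) hp.isLinking.le_rho
  exact hL.card_le (F := {Sum.inl (Sum.inr ())}) (by simp)

theorem notMem_essentialVertices_iff [Finite X] {j : X}
    (hT : ∃ s ∈ T, ReflTransGen (auxEdge A x) x s) :
    Sum.inl (Sum.inl j) ∉ essentialVertices (sensorDigraph A x T)
      {Sum.inl (Sum.inr ())} (sensorVertices T) ↔ Escapes (auxEdge A x) T j x := by
  constructor
  · intro hj
    simp only [essentialVertices, Set.mem_ofPred_eq, not_forall, not_exists, not_and,
      rho_input_eq_one hT] at hj
    obtain ⟨L, hL, hcard, hLj⟩ := hj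
    obtain ⟨p, rfl⟩ := Finset.card_eq_one.1 hcard
    exact escapes_of_path (hL.1 p (by simp)) (hLj p (by simp))
  · rintro ⟨s, hs, hr⟩ hess
    obtain ⟨p, hp, hpj⟩ := exists_path_of_avoidReach hs hr
    obtain ⟨q, hq, hqj⟩ := hess {p} hp.isLinking (by rw [rho_input_eq_one hT]; simp)
    obtain rfl := Finset.mem_singleton.1 hq
    exact hpj j rfl hqj

theorem rho_pair_eq_one_iff [Finite X] {j : X} (hT : ∃ s ∈ T, ReflTransGen (auxEdge A x) x s)
    (hj : x ≠ j) :
    rho (sensorDigraph A x T) {Sum.inl (Sum.inr ()), Sum.inl (Sum.inl j)} (sensorVertices T) = 1 ↔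
      ∃ v, ¬ Escapes (auxEdge A x) T v x ∧ ¬ Escapes (auxEdge A x) T v j := by
  constructor
  · intro hrho
    by_contra! hno
    obtain ⟨L, hL, hcard⟩ := exists_disjoint_paths hj fun v => or_iff_not_imp_left.2 (hno v)
    have := hL.le_rho
    lia
  · rintro ⟨v, hvx, hvj⟩
    refine le_antisymm (rho_le fun L hL => ?_) ?_
    · have hvL : ∀ p ∈ L, Sum.inl (Sum.inl v) ∈ p := by
        intro p hp
        by_contra hvp
        obtain ⟨hc, hn, ⟨g, rfl | rfl, hh⟩, hl⟩ := hL.1 p hp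
        · exact hvx (escapes_of_path ⟨hc, hn, ⟨_, rfl, hh⟩, hl⟩ hvp)
        · exact hvj (escapes_of_chain hc hh hl hvp)
      refine Finset.card_le_one.2 fun p hp q hq => ?_
      by_contra hne
      exact hL.2 p hp q hq hne (hvL p hp) (hvL q hq)
    · obtain ⟨s, hs, hr⟩ := hT
      obtain ⟨p, ⟨hc, hn, ⟨g, hg, hh⟩, hl⟩, -⟩ :=
        exists_path_of_avoidReach (Q := ∅) hs ⟨by simp, by simpa using hr⟩
      exact (IsPath.isLinking ⟨hc, hn, ⟨g, .inl hg, hh⟩, hl⟩).le_rho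

theorem hasViolation_iff [Fintype X] (hT : ∃ s ∈ T, ReflTransGen (auxEdge A x) x s) :
    HasViolation A x (T.image Sum.inl) ↔
    ∃ j v, Escapes (auxEdge A x) T j x ∧ ¬ Escapes (auxEdge A x) T v x ∧
      ¬ Escapes (auxEdge A x) T v j := by
  refine exists_congr fun j => ?_
  rw [exists_and_left]
  refine (and_congr_left' (notMem_essentialVertices_iff hT)).trans (and_congr_right fun hj => ?_)
  rw [← rho_pair_eq_one_iff hT hj.ne, ← rho_input_eq_one hT]

end Violation

section StateInjective

variable {X : Type} [DecidableEq X] {A : StructMatrix X X} {W T : Finset X}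

/-- The structured rows of the state equations of the states outside `W` and of the sensors on the
states in `T`. -/
def measuredRows (A : StructMatrix X X) (W T : Finset X) :
    StructMatrix ({i // i ∉ W} ⊕ X) X :=
  fromRows (A.submatrix Subtype.val id) (sensorMatrix T)

/-- The parameters of `measuredRows`, among those of `A` and of the sensors. -/
def measuredParam : (measuredRows A W T).Free → A.Free ⊕ (sensorMatrix T).Free
  | ⟨(Sum.inl i, c), h⟩ => Sum.inl ⟨(i, c), h⟩
  | ⟨(Sum.inr y, c), h⟩ => Sum.inr ⟨(y, c), h⟩

theorem measuredParam_injective :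
    Function.Injective (measuredParam : (measuredRows A W T).Free → _) := by
  rintro ⟨⟨i | y, c⟩, h⟩ ⟨⟨i' | y', c'⟩, h'⟩ heq <;>
    simp_all [measuredParam, Subtype.ext_iff]

theorem realize_measuredRows (θ : A.Free ⊕ (sensorMatrix T).Free → ℝ) :
    (measuredRows A W T).realize (θ ∘ measuredParam) =
      fromRows ((A.realize (θ ∘ Sum.inl)).submatrix Subtype.val id)
        ((sensorMatrix T).realize (θ ∘ Sum.inr)) := by
  ext (i | y) c <;> rfl

theorem exists_isTransversal_measuredRows [Finite X] (hA : ∀ i ∉ W, A i i = true) {j : X}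
    (hsep : ∀ Q : Finset X, Q.card < (insert j W).card →
      ∃ b ∈ insert j W, ∃ s ∈ T, AvoidReach (stateDigraph A).Adj (Q : Set X) b s) :
    ∃ f, (measuredRows A W T).IsTransversal f ∧ ∀ c i, f c = Sum.inl i → (i : X) ≠ j := by
  obtain ⟨f, hf, hinl, hinr⟩ := exists_matching_of_not_separated hsep
  have hlift : ∀ c, ∃ r : {i // i ∉ W} ⊕ X, Sum.map Subtype.val id r = f c := by
    intro c
    cases hfc : f c with
    | inl d => exact ⟨Sum.inl ⟨d, fun hd => (hinl c d hfc).1 (Finset.mem_insert_of_mem hd)⟩, rfl⟩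
    | inr s => exact ⟨Sum.inr s, rfl⟩
  choose g hg using hlift
  refine ⟨g, ⟨Function.Injective.of_comp (f := Sum.map Subtype.val id) ?_, fun c => ?_⟩,
    fun c i hi hij => ?_⟩
  · rwa [show Sum.map Subtype.val id ∘ g = f from funext hg]
  · specialize hg c
    cases hgc : g c with
    | inl i =>
      rcases (hinl c i (by rw [← hg, hgc]; rfl)).2 with h | rfl
      · exact h
      · exact hA _ i.2
    | inr y =>
      obtain ⟨rfl, hc⟩ := hinr c y (by rw [← hg, hgc]; rfl)
      simpa [measuredRows, sensorMatrix] using hc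
  · exact (hinl c j (by rw [← hg, hi, ← hij]; rfl)).1 (Finset.mem_insert_self j W)

theorem generically_state_injective [Fintype X] (hA : ∀ i ∉ W, A i i = true) (hW : ∃ j, j ∉ W)
    (hsep : ∀ j ∉ W, ∀ Q : Finset X, Q.card ≤ W.card →
      ∃ b ∈ insert j W, ∃ s ∈ T, AvoidReach (stateDigraph A).Adj (Q : Set X) b s) :
    Generically fun θ : A.Free ⊕ (sensorMatrix T).Free → ℝ => ∀ (s : ℂ) (z : X → ℂ),
      (∀ i ∉ W, ((A.realize (θ ∘ Sum.inl)).map Complex.ofReal *ᵥ z) i = s * z i) →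
      ((sensorMatrix T).realize (θ ∘ Sum.inr)).map Complex.ofReal *ᵥ z = 0 → z = 0 := by
  have htrans : ∀ j ∉ W, ∃ f, (measuredRows A W T).IsTransversal f ∧
      ∀ c i, f c = Sum.inl i → (i : X) ≠ j := fun j hj =>
    exists_isTransversal_measuredRows hA fun Q hQ => hsep j hj Q
      (Nat.lt_succ_iff.1 (by rwa [Finset.card_insert_of_notMem hj] at hQ))
  let E : Matrix ({i // i ∉ W} ⊕ X) X ℝ := fromRows ((1 : Matrix X X ℝ).submatrix Subtype.val id) 0
  have hE : ∀ r c, E r c ≠ 0 → ∃ i, r = Sum.inl i ∧ (i : X) = c := by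
    rintro (i | y) c h
    · exact ⟨i, rfl, by_contra fun hic => h (by simp [E, hic])⟩
    · exact absurd rfl h
  obtain ⟨j, hj⟩ := hW
  have hgen := StructMatrix.generically_injective_pencil (M := measuredRows A W T) (E := E)
    (by
      intro r c h
      obtain ⟨i, rfl, rfl⟩ := hE r c h
      exact hA i i.2)
    ((htrans j hj).imp fun _ h => h.1)
    (by
      intro r c h
      obtain ⟨i, rfl, rfl⟩ := hE r c h
      exact (htrans i i.2).imp fun f hf => ⟨hf.1, fun ⟨c, hc⟩ => hf.2 c i hc rfl⟩)
  refine (hgen.comp_injective measuredParam_injective).mono fun θ hθ s z hz hy => hθ s z ?_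
  rw [realize_measuredRows, sub_mulVec, sub_eq_zero]
  funext r
  rw [smul_mulVec, Pi.smul_apply, smul_eq_mul]
  rcases r with i | y
  · refine (hz i i.2).trans (congrArg _ ?_)
    simp [E, mulVec, dotProduct, Matrix.one_apply, apply_ite Complex.ofReal]
  · refine (congrFun hy y).trans ?_
    simp [E, mulVec, dotProduct]

end StateInjective

section Realization

variable {m n : Type} {M : StructMatrix m n}

theorem StructMatrix.eq_true_of_realize_ne_zero {θ : M.Free → ℝ} {i : m} {j : n}
    (h : M.realize θ i j ≠ 0) : M i j = true := by
  by_contra hM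
  exact h (dif_neg hM)

theorem StructMatrix.exists_realize_eq {N : Matrix m n ℝ} (h : ∀ i j, N i j ≠ 0 → M i j = true) :
    ∃ θ, M.realize θ = N := by
  refine ⟨fun p => N p.1.1 p.1.2, Matrix.ext fun i j => ?_⟩
  rw [StructMatrix.realize]
  split_ifs with hM
  · rfl
  · exact (not_imp_comm.1 (h i j) hM).symm

theorem mulVec_apply_eq_zero_of_mem_spanSubset {𝕜 : Type*} [Semiring 𝕜] {m n : Type*} [Fintype n]
    {N : Matrix m n 𝕜} {D : Set n} {z : n → 𝕜} (hz : z ∈ Pi.spanSubset 𝕜 D) {i : m}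
    (h : ∀ d ∈ D, N i d = 0) : (N *ᵥ z) i = 0 := by
  refine Finset.sum_eq_zero fun d _ => ?_
  by_cases hd : d ∈ D
  · exact mul_eq_zero_of_left (h d hd) _
  · rw [Pi.mem_spanSubset_iff.1 hz d hd, mul_zero]

theorem StructMatrix.realize_mulVec_eq_zero [Fintype n] {θ : M.Free → ℝ} {D : Set n} {z : n → ℝ}
    (hz : z ∈ Pi.spanSubset ℝ D) {i : m} (h : ∀ d ∈ D, M i d ≠ true) :
    (M.realize θ *ᵥ z) i = 0 :=
  mulVec_apply_eq_zero_of_mem_spanSubset hz fun d hd =>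
    not_imp_comm.1 eq_true_of_realize_ne_zero (h d hd)

end Realization

section Placement

variable {X : Type} {A : StructMatrix X X} {x : X}

theorem spanSubset_ne_bot [Finite X] {D : Set X} (hD : D.Nonempty) : Pi.spanSubset ℝ D ≠ ⊥ := by
  classical
  obtain ⟨t, ht⟩ := hD
  refine (Submodule.ne_bot_iff _).2 ⟨Pi.single t 1, Pi.mem_spanSubset_iff.2 fun i hi => ?_, by simp⟩
  exact Pi.single_eq_of_ne (ne_of_mem_of_not_mem ht hi).symm 1

variable [Fintype X]

theorem hits_of_isStructObservable [DecidableEq X] {S : Finset (X ⊕ Unit)}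
    (h : IsStructObservable (auxSystem A x) (sensorMatrix S)) (j : X) :
    ∃ s, Sum.inl s ∈ S ∧ ReflTransGen (auxEdge A x) j s := by
  by_contra! hno
  obtain ⟨a, c, hac⟩ := h
  let D : Set (X ⊕ Unit) := Sum.inl '' {k | ReflTransGen (auxEdge A x) j k}
  refine not_isSIO_of_feedback_invariant _ _ _ 0 (V := Pi.spanSubset ℝ D) ?_ ?_ ?_ hac
  · intro z hz
    rw [zero_mulVec, add_zero, Pi.mem_spanSubset_iff]
    refine fun g hg => StructMatrix.realize_mulVec_eq_zero hz ?_
    rintro _ ⟨k, hk, rfl⟩ hgk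
    rcases g with i | _
    · exact hg ⟨i, hk.tail (by simpa [auxSystem, auxEdge] using hgk), rfl⟩
    · exact Bool.false_ne_true hgk
  · refine fun z hz => funext fun y => StructMatrix.realize_mulVec_eq_zero hz ?_
    rintro _ ⟨k, hk, rfl⟩ hyk
    exact hno k (of_decide_eq_true hyk).2 hk
  · exact spanSubset_ne_bot ⟨Sum.inl j, j, .refl, rfl⟩

/-- Observability is invariant under `N ↦ N - τ I`, so that a free parameter may be added on the
diagonal of row `x` and then normalized to `0`. -/
theorem exists_observable_of_hits {T : Finset X} (hA : ∀ j, A j j = true) (h : Hits A x T) :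
    ∃ N C : Matrix X X ℝ, (∀ i j, N i j ≠ 0 → auxEdge A x j i) ∧
      (∀ y j, C y j ≠ 0 → y = j ∧ j ∈ T) ∧
      HasInjectivePencil (N.map Complex.ofReal) (0 : Matrix X Empty ℂ) (C.map Complex.ofReal) := by
  classical
  let M : StructMatrix X X := fun i j => decide (auxEdge A x j i ∨ i = j)
  obtain ⟨θ, -, hθ⟩ := (generically_state_injective (A := M) (W := ∅) (T := T)
    (fun i _ => by simp [M]) ⟨x, Finset.notMem_empty x⟩ fun j _ Q hQ => by
      obtain rfl : Q = ∅ := by simpa using hQ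
      obtain ⟨s, hs, hr⟩ := h j
      refine ⟨j, Finset.mem_insert_self j _, s, hs, by simp, hr.lift id fun c d hcd => ?_⟩
      exact ⟨decide_eq_true (.inl hcd), by simp⟩).exists_pos
  set R := M.realize (θ ∘ Sum.inl)
  refine ⟨R - R x x • 1, (sensorMatrix T).realize (θ ∘ Sum.inr), fun i j hij => ?_,
    fun y j hyj => by simpa [sensorMatrix] using StructMatrix.eq_true_of_realize_ne_zero hyj,
    fun s z v hz hy => ⟨?_, Subsingleton.elim _ _⟩⟩
  · rcases eq_or_ne i j with rfl | hne
    · refine ⟨hA i, ?_⟩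
      rintro rfl
      simp at hij
    · have hR : R i j ≠ 0 := by simpa [hne] using hij
      have hM : auxEdge A x j i ∨ i = j := by
        simpa [M] using StructMatrix.eq_true_of_realize_ne_zero hR
      exact hM.resolve_right hne
  · refine hθ (s + R x x) z (fun i _ => ?_) hy
    have := congrFun hz i
    have hmap : (R - R x x • 1).map Complex.ofReal =
        R.map Complex.ofReal - (R x x : ℂ) • (1 : Matrix X X ℂ) := by
      ext i j
      simp [Matrix.one_apply, apply_ite Complex.ofReal]
    rw [hmap, zero_mulVec, add_zero, sub_mulVec, smul_mulVec, one_mulVec] at this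
    simp only [Pi.sub_apply, Pi.smul_apply, smul_eq_mul] at this
    linear_combination this

theorem isStructObservable_of_hits [DecidableEq X] {T : Finset X} (hA : ∀ j, A j j = true)
    (h : Hits A x T) : IsStructObservable (auxSystem A x) (sensorMatrix (T.image Sum.inl)) := by
  obtain ⟨N, C, hN, hC, hNC⟩ := exists_observable_of_hits hA h
  obtain ⟨a, ha⟩ := StructMatrix.exists_realize_eq (M := auxSystem A x)
    (N := fromBlocks N (Matrix.of fun i _ => if i = x then 1 else 0) 0 0) (by
      rintro (i | _) (j | _) hij
      · simpa [auxSystem, auxEdge] using hN i j hij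
      · simpa [auxSystem] using hij
      all_goals exact absurd rfl hij)
  obtain ⟨c, hc⟩ := StructMatrix.exists_realize_eq (M := sensorMatrix (T.image Sum.inl))
    (N := fromBlocks C 0 0 (0 : Matrix Unit Unit ℝ)) (by
      rintro (y | _) (j | _) hyj
      · simpa [sensorMatrix] using hC y j hyj
      all_goals exact absurd rfl hyj)
  refine ⟨a, c, HasInjectivePencil.isSIO fun s z v hz hy => ⟨?_, Subsingleton.elim _ _⟩⟩
  simp only [ha, hc, fromBlocks_map, fromBlocks_mulVec, Matrix.map_zero _ Complex.ofReal_zero,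
    zero_mulVec, add_zero] at hz hy
  have hzX (i : X) := congrFun hz (Sum.inl i)
  have hu : s = 0 ∨ z (Sum.inr ()) = 0 := by simpa using congrFun hz (Sum.inr ())
  have hNx : (N.map Complex.ofReal *ᵥ (z ∘ Sum.inl)) x = 0 := Finset.sum_eq_zero fun j _ =>
    mul_eq_zero_of_left (Complex.ofReal_eq_zero.2 (by_contra fun h => (hN x j h).2 rfl)) _
  have hzu : z ∘ Sum.inr = 0 := by
    have hxu : z (Sum.inr ()) = s * z (Sum.inl x) := by
      have hx := hzX x
      rw [Sum.elim_inl, Pi.add_apply, hNx, zero_add] at hx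
      simpa [mulVec, dotProduct] using hx
    funext k
    rcases hu with rfl | h0
    · simpa using hxu
    · exact h0
  rw [← Sum.elim_comp_inl_inr z, hzu, (hNC s (z ∘ Sum.inl) v ?_ ?_).1, Sum.elim_zero_zero]
  · ext i
    simpa [hzu] using hzX i
  · exact funext fun y => congrFun hy (Sum.inl y)

theorem isMinPlacement_iff [DecidableEq X] (hA : ∀ j, A j j = true) {S : Finset (X ⊕ Unit)} :
    IsMinPlacement (auxSystem A x) S ↔ ∃ T : Finset X, S = T.image Sum.inl ∧ Hits A x T ∧
      ∀ s ∈ T, ∀ t ∈ T, ReflTransGen (auxEdge A x) s t → s = t := by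
  constructor
  · rintro ⟨hobs, hmin⟩
    have hT : Hits A x S.toLeft := fun j => by
      simpa using hits_of_isStructObservable hobs j
    have hTS : S.toLeft.image Sum.inl ⊆ S := by simp [Finset.subset_iff]
    refine ⟨S.toLeft, (Finset.eq_of_subset_of_card_le hTS
      (hmin _ (isStructObservable_of_hits hA hT))).symm, hT, ?_⟩
    intro s hs t ht hst
    by_contra hne
    have herase : Hits A x (S.toLeft.erase s) := fun j => by
      obtain ⟨r, hr, hjr⟩ := hT j
      by_cases hrs : r = s
      · exact ⟨t, Finset.mem_erase.2 ⟨Ne.symm hne, ht⟩, (hrs ▸ hjr).trans hst⟩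
      · exact ⟨r, Finset.mem_erase.2 ⟨hrs, hr⟩, hjr⟩
    have hle := (Finset.card_le_card hTS).trans (hmin _ (isStructObservable_of_hits hA herase))
    rw [Finset.card_image_of_injective _ Sum.inl_injective,
      Finset.card_image_of_injective _ Sum.inl_injective] at hle
    exact hle.not_gt (Finset.card_erase_lt_of_mem hs)
  · rintro ⟨T, rfl, hT, hanti⟩
    refine ⟨isStructObservable_of_hits hA hT, fun S' hS' => ?_⟩
    choose g hgS hg using hits_of_isStructObservable hS'
    rw [Finset.card_image_of_injective _ Sum.inl_injective]
    refine Finset.card_le_card_of_injOn (fun s => Sum.inl (g s)) (fun s _ => hgS s) ?_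
    intro s hs t ht hst
    obtain ⟨r, hr, hgr⟩ := hT (g s)
    have hsr := hanti s hs r hr ((hg s).trans hgr)
    rw [Sum.inl_injective hst] at hgr
    exact hsr.trans (hanti t ht r hr ((hg t).trans hgr)).symm

end Placement

section Restriction

theorem submatrix_val_mulVec {R n m m' : Type*} [NonUnitalNonAssocSemiring R] [Fintype n]
    {p : n → Prop} [DecidablePred p] {M : Matrix m n R} {f : m' → m} {i : m'}
    (h : ∀ j, ¬ p j → M (f i) j = 0) (z : n → R) :
    (M.submatrix f Subtype.val *ᵥ fun j : Subtype p => z j) i = (M *ᵥ z) (f i) := by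
  refine (Finset.sum_subtype (Finset.univ.filter p) (by simp)
    fun j => M (f i) j * z j).symm.trans ?_
  exact Finset.sum_filter_of_ne fun j _ hj => by_contra fun hp => hj (by simp [h j hp])

end Restriction

section GenericPlacement

variable {X : Type} [Fintype X] [DecidableEq X] {A : StructMatrix X X} {T : Finset X} {w x : X}

theorem generically_state_injective_of_escapes (hA : ∀ j, A j j = true) (hw : ∃ j, j ≠ w)
    (hsep : ∀ j ≠ w, ∀ v, Escapes (stateDigraph A).Adj T v w ∨ Escapes (stateDigraph A).Adj T v j) :
    Generically fun θ : A.Free ⊕ (sensorMatrix T).Free → ℝ => ∀ (s : ℂ) (z : X → ℂ),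
      (∀ i ≠ w, ((A.realize (θ ∘ Sum.inl)).map Complex.ofReal *ᵥ z) i = s * z i) →
      ((sensorMatrix T).realize (θ ∘ Sum.inr)).map Complex.ofReal *ᵥ z = 0 → z = 0 := by
  simp only [← Finset.notMem_singleton]
  refine generically_state_injective (fun i _ => hA i) (by simpa using hw) fun j hj Q hQ => ?_
  have : Nonempty X := ⟨w⟩
  obtain ⟨v, hv⟩ := Finset.card_le_one_iff_subset_singleton.1 hQ
  have hQv : (Q : Set X) ⊆ {v} := by exact_mod_cast hv
  rcases hsep j (Finset.notMem_singleton.1 hj) v with ⟨s, hs, hr⟩ | ⟨s, hs, hr⟩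
  · exact ⟨w, by simp, s, hs, hr.anti hQv⟩
  · exact ⟨j, by simp, s, hs, hr.anti hQv⟩

/-- The subsystem on the states in `p`. -/
abbrev subsystem (A : StructMatrix X X) (p : X → Prop) : StructMatrix (Subtype p) (Subtype p) :=
  fun i j => A i j

/-- The inclusion of the parameters of the subsystem on the states in `p`. -/
def subsystemParam (A : StructMatrix X X) (T : Finset X) (p : X → Prop) [DecidablePred p] :
    (subsystem A p).Free ⊕ (sensorMatrix (T.subtype p)).Free → A.Free ⊕ (sensorMatrix T).Free :=
  Sum.map (fun q => ⟨(q.1.1, q.1.2), q.2⟩) fun q =>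
    ⟨(q.1.1, q.1.2), by simpa [sensorMatrix, Subtype.ext_iff] using q.2⟩

omit [Fintype X] in
theorem subsystemParam_injective {p : X → Prop} [DecidablePred p] :
    Function.Injective (subsystemParam A T p) :=
  Sum.map_injective.2
    ⟨fun q q' h => by simpa [Subtype.ext_iff, Prod.ext_iff] using h,
      fun q q' h => by simpa [Subtype.ext_iff, Prod.ext_iff] using h⟩

omit [Fintype X] in
theorem realize_sensorMatrix_subtype {p : X → Prop} [DecidablePred p]
    (θ : A.Free ⊕ (sensorMatrix T).Free → ℝ) :
    (sensorMatrix (T.subtype p)).realize ((θ ∘ subsystemParam A T p) ∘ Sum.inr) =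
      ((sensorMatrix T).realize (θ ∘ Sum.inr)).submatrix Subtype.val Subtype.val := by
  ext y j
  have h : sensorMatrix (T.subtype p) y j = sensorMatrix T y j := by
    simp [sensorMatrix, Subtype.ext_iff]
  by_cases hs : sensorMatrix T y j = true
  · simp only [Matrix.submatrix_apply, StructMatrix.realize]
    rw [dif_pos (h.trans hs), dif_pos hs]
    rfl
  · simp only [Matrix.submatrix_apply, StructMatrix.realize]
    rw [dif_neg (h ▸ hs), dif_neg hs]

/-- The rows of the states in `p` other than `w`, and those of the sensors, only involve the states
in `p`. -/
theorem generically_state_eq_zero {p : X → Prop} (hA : ∀ j, A j j = true)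
    (hw : p w) (hex : ∃ j, p j ∧ j ≠ w)
    (hout : ∀ e, ¬ p e → e ∉ T ∧ ∀ d, p d → d ≠ w → A d e ≠ true)
    (hsep : ∀ j, p j → j ≠ w → ∀ v, p v →
      Escapes (fun c d => (stateDigraph A).Adj c d ∧ p d) T v w ∨
        Escapes (fun c d => (stateDigraph A).Adj c d ∧ p d) T v j) :
    Generically fun θ : A.Free ⊕ (sensorMatrix T).Free → ℝ => ∀ (s : ℂ) (z : X → ℂ),
      (∀ i, p i → i ≠ w → ((A.realize (θ ∘ Sum.inl)).map Complex.ofReal *ᵥ z) i = s * z i) →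
      ((sensorMatrix T).realize (θ ∘ Sum.inr)).map Complex.ofReal *ᵥ z = 0 →
      ∀ c, p c → z c = 0 := by
  classical
  have hgen := generically_state_injective_of_escapes (A := subsystem A p) (T := T.subtype p)
    (w := ⟨w, hw⟩) (fun j => hA j) (by simpa [Subtype.ext_iff] using hex) fun j hj v =>
      (hsep j j.2 (fun h => hj (Subtype.ext h)) v v.2).imp
        (fun h => h.subtype (a := ⟨w, hw⟩)) fun h => h.subtype
  refine (hgen.comp_injective subsystemParam_injective).mono fun θ hθ s z hz hy c hc => ?_
  refine congrFun (hθ s (fun j => z j) (fun i hi => ?_) (funext fun y => ?_)) ⟨c, hc⟩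
  · have hiw : (i : X) ≠ w := fun h => hi (Subtype.ext h)
    refine Eq.trans ?_ (hz i i.2 hiw)
    refine submatrix_val_mulVec (M := (A.realize (θ ∘ Sum.inl)).map Complex.ofReal)
      (f := Subtype.val) (fun j hj => ?_) z
    rw [Matrix.map_apply, Complex.ofReal_eq_zero]
    exact dif_neg ((hout j hj).2 i i.2 hiw)
  · rw [realize_sensorMatrix_subtype]
    refine Eq.trans ?_ (congrFun hy y)
    refine submatrix_val_mulVec (M := ((sensorMatrix T).realize (θ ∘ Sum.inr)).map Complex.ofReal)
      (f := Subtype.val) (fun j hj => ?_) z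
    simp [StructMatrix.realize, sensorMatrix, (hout j hj).1]

omit [Fintype X] in
theorem realize_dedicatedInput (b : (dedicatedInput x).Free → ℝ) :
    (dedicatedInput x).realize b =
      replicateCol Unit (Pi.single x (b ⟨(x, ()), decide_eq_true rfl⟩)) := by
  ext i k
  rcases eq_or_ne i x with rfl | hi
  · simp [StructMatrix.realize, dedicatedInput]
  · simp [StructMatrix.realize, dedicatedInput, hi]

theorem isGSIO_of_generically_state_injective {Y : Type} {C : StructMatrix Y X}
    (h : Generically fun θ : A.Free ⊕ C.Free → ℝ => ∀ (s : ℂ) (z : X → ℂ),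
      (∀ i ≠ x, ((A.realize (θ ∘ Sum.inl)).map Complex.ofReal *ᵥ z) i = s * z i) →
      (C.realize (θ ∘ Sum.inr)).map Complex.ofReal *ᵥ z = 0 → z = 0) :
    IsGSIO A (dedicatedInput x) C := by
  have hinj : Function.Injective
      (Sum.map id Sum.inr : A.Free ⊕ C.Free → A.Free ⊕ (dedicatedInput x).Free ⊕ C.Free) :=
    Sum.map_injective.2 ⟨Function.injective_id, Sum.inr_injective⟩
  have hb := (generically_ne_zero (σ := (dedicatedInput x).Free)).comp_injective
    ((Sum.inr_injective (α := A.Free)).comp (Sum.inl_injective (β := C.Free)))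
  refine ((h.comp_injective hinj).and hb).mono fun θ ⟨hθ, hθb⟩ => ?_
  refine HasInjectivePencil.isSIO fun s z v hz hy => ?_
  rw [realize_dedicatedInput] at hz
  obtain rfl : z = 0 := by
    refine hθ s z (fun i hi => (left_eq_add.2 ?_).trans (congrFun hz i)) hy
    simp [mulVec, dotProduct, hi]
  refine ⟨rfl, funext fun k => ?_⟩
  have hx := congrFun hz x
  have hbx : θ (Sum.inr (Sum.inl ⟨(x, ()), decide_eq_true rfl⟩)) ≠ 0 := hθb _
  simpa [mulVec, dotProduct, hbx] using hx

theorem isGSIO_insert (hA : ∀ j, A j j = true) (hT : Hits A x T) (hx : ∃ j, j ≠ x) :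
    IsGSIO A (dedicatedInput x) (sensorMatrix (insert x T)) := by
  refine isGSIO_of_generically_state_injective
    (generically_state_injective_of_escapes hA hx fun j hj v => ?_)
  rcases eq_or_ne x v with rfl | hv
  · obtain ⟨s, hs, hr⟩ := hT j
    exact .inr ⟨s, Finset.mem_insert_of_mem hs, hj, hr⟩
  · exact .inl (escapes_of_mem (Finset.mem_insert_self x T) hv)

theorem isGSIO_of_no_violation (hA : ∀ j, A j j = true) (hT : Hits A x T)
    (hex : ∃ j, Escapes (auxEdge A x) T j x)
    (hnv : ∀ j v, Escapes (auxEdge A x) T j x → Escapes (auxEdge A x) T v x ∨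
      Escapes (auxEdge A x) T v j) :
    IsGSIO A (dedicatedInput x) (sensorMatrix T) := by
  obtain ⟨w, hw⟩ := exists_isLastSeparator (hT x)
  have hpx : ∀ d, Escapes (auxEdge A x) T d x ∨ d = w → d ≠ w → d ≠ x := fun d hd hdw hdx =>
    not_escapes_self (hdx ▸ hd.resolve_right hdw)
  have hgen := generically_state_eq_zero (T := T)
    (p := fun c => Escapes (auxEdge A x) T c x ∨ c = w) hA (.inr rfl)
    (hex.imp fun j hj => ⟨.inl hj, fun h => hw.not_escapes (h ▸ hj)⟩)
    (fun e he => by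
      obtain ⟨he, hew⟩ := not_or.1 he
      exact ⟨hw.notMem he hew, fun d hd hdw hde =>
        hw.not_escapes_of_edge hnv he hew ⟨hde, hpx d hd hdw⟩ (hd.resolve_right hdw)⟩)
    fun j hj hjw v hv => by
      rcases hv with hv | rfl
      · exact .inl ((hw.escapes_tail hv).mono fun c d h => ⟨h.1.1, h.2⟩)
      · have hj := (hnv j v (hj.resolve_right hjw)).resolve_left hw.not_escapes
        exact .inr ((hw.escapes_tail_of_escapes hj).mono fun c d h => ⟨h.1.1, h.2⟩)
  refine isGSIO_of_generically_state_injective ?_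
  refine (hgen.and generically_ne_zero).mono fun θ ⟨hθ, hne⟩ s z hz hy => ?_
  have hz0 := hθ s z (fun i hi hiw => hz i (hpx i hi hiw)) hy
  suffices {c | z c ≠ 0} = ∅ by
    simpa [Set.eq_empty_iff_forall_notMem, funext_iff] using this
  refine hw.eq_empty_of_forall_edge (fun e he => not_or.1 fun h => he (hz0 e h))
    fun e he f hf hef => ?_
  by_contra! hno
  have hrow := hz f hef.2
  rw [not_not.1 hf, mul_zero, mulVec, dotProduct, Finset.sum_eq_single e] at hrow
  · have hfe : A.realize (θ ∘ Sum.inl) f e ≠ 0 := by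
      simp [StructMatrix.realize, hef.1, hne]
    exact mul_ne_zero (Complex.ofReal_ne_zero.2 hfe) he hrow
  · intro c _ hce
    by_cases hzc : z c = 0
    · rw [hzc, mul_zero]
    · have hfc : A f c ≠ true := fun h => hno c hzc hce ⟨h, hef.2⟩
      simp [StructMatrix.realize, hfc]
  · simp

end GenericPlacement

section ZeroDynamics

variable {X 𝕜 : Type*} [Fintype X] [DecidableEq X] [Field 𝕜] {M : Matrix X X 𝕜} {D : Finset X}
  {v x : X} {N : ℕ}

/-- The states of `z ↦ M z` supported in `D` for which the output at `v` vanishes at the times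
`1, …, N`: the space of the zero dynamics when `N` is the relative degree from input to `v`. -/
noncomputable def zeroDynamics (M : Matrix X X 𝕜) (D : Finset X) (v : X) (N : ℕ) :
    Submodule 𝕜 (X → 𝕜) :=
  Pi.spanSubset 𝕜 D ⊓ ⨅ k : Fin N, (LinearMap.proj v ∘ₗ (M ^ (k + 1 : ℕ)).mulVecLin).ker

theorem mem_zeroDynamics {z : X → 𝕜} :
    z ∈ zeroDynamics M D v N ↔
      z ∈ Pi.spanSubset 𝕜 (D : Set X) ∧ ∀ k < N, (M ^ (k + 1) *ᵥ z) v = 0 := by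
  simp [zeroDynamics, Submodule.mem_iInf, Fin.forall_iff]

theorem zeroDynamics_ne_bot (h : N < D.card) : zeroDynamics M D v N ≠ ⊥ := by
  let L : Pi.spanSubset 𝕜 (D : Set X) →ₗ[𝕜] Fin N → 𝕜 := LinearMap.pi fun k =>
    (LinearMap.proj v ∘ₗ (M ^ (k + 1 : ℕ)).mulVecLin) ∘ₗ Submodule.subtype _
  have hdim : Module.finrank 𝕜 (Fin N → 𝕜) < Module.finrank 𝕜 (Pi.spanSubset 𝕜 (D : Set X)) := by
    simpa [Pi.dim_spanSubset] using h
  obtain ⟨z, hz, hz0⟩ :=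
    (Submodule.ne_bot_iff _).1 (LinearMap.ker_ne_bot_of_finrank_lt (f := L) hdim)
  refine (Submodule.ne_bot_iff _).2
    ⟨z, mem_zeroDynamics.2 ⟨z.2, fun k hk => ?_⟩, by simpa using hz0⟩
  exact congrFun (LinearMap.mem_ker.1 hz) ⟨k, hk⟩

/-- The feedback acts on `x` only and cancels the output at `v` at time `N + 1`, the first one it
influences. -/
theorem zeroDynamics_feedback_invariant (hx : x ∈ D) (hv : v ∉ D)
    (hD : ∀ d ∈ D, ∀ i ∉ D, i ≠ v → M i d = 0) (hN : (M ^ N) v x ≠ 0)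
    (hmin : ∀ k < N, (M ^ k) v x = 0) {z : X → 𝕜} (hz : z ∈ zeroDynamics M D v N) :
    M *ᵥ z + Pi.single x (-((M ^ N) v x)⁻¹ * (M ^ (N + 1) *ᵥ z) v) ∈ zeroDynamics M D v N := by
  obtain ⟨hzD, hzv⟩ := mem_zeroDynamics.1 hz
  have hN0 : 0 < N := by
    refine Nat.pos_of_ne_zero fun h => hN ?_
    rw [h, pow_zero, one_apply_ne (ne_of_mem_of_not_mem hx hv).symm]
  refine mem_zeroDynamics.2 ⟨Pi.mem_spanSubset_iff.2 fun i hi => ?_, fun k hk => ?_⟩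
  · rw [Pi.add_apply, Pi.single_eq_of_ne (ne_of_mem_of_not_mem hx hi).symm, add_zero]
    rcases eq_or_ne i v with rfl | hiv
    · simpa using hzv 0 hN0
    · exact mulVec_apply_eq_zero_of_mem_spanSubset hzD fun d hd => hD d hd i hi hiv
  · rw [mulVec_add, mulVec_mulVec, ← pow_succ, Pi.add_apply, mulVec_single, Pi.smul_apply]
    rcases Nat.lt_or_eq_of_le (Nat.succ_le_of_lt hk) with hk | rfl
    · simp [hzv (k + 1) hk, hmin (k + 1) hk]
    · simp [hN]

end ZeroDynamics

section LowerBounds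

variable {X Y : Type} [Fintype X] {A : StructMatrix X X} {C : StructMatrix Y X} {x : X}

theorem pow_apply_pos_of_chain [DecidableEq X] {M : Matrix X X ℝ} (h0 : ∀ i j, 0 ≤ M i j)
    {r : X → X → Prop} (hr : ∀ c d, r c d → 0 < M d c) {a v : X} {l : List X} (hl : l.IsChain r)
    (hh : l.head? = some a) (hlast : l.getLast? = some v) : 0 < (M ^ (l.length - 1)) v a := by
  induction l generalizing a with
  | nil => exact absurd hh (by simp)
  | cons c l ih =>
    obtain rfl : c = a := by simpa using hh
    cases l with
    | nil =>
      obtain rfl : c = v := by simpa using hlast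
      simp
    | cons d l =>
      obtain ⟨hcd, hl⟩ := List.isChain_cons_cons.1 hl
      have hpow : 0 < (M ^ ((d :: l).length - 1)) v d := ih hl rfl (by simpa using hlast)
      rw [show (c :: d :: l).length - 1 = (d :: l).length - 1 + 1 by simp, pow_succ, mul_apply]
      exact Finset.sum_pos'
        (fun k _ => mul_nonneg (pow_apply_nonneg h0 _ _ _) (h0 _ _))
        ⟨d, Finset.mem_univ d, mul_pos hpow (hr c d hcd)⟩

theorem not_isGSIO_of_feedback_invariant [DecidableEq X] [Finite Y] {D : Set X}
    (hC : ∀ d ∈ D, ∀ y, C y d ≠ true)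
    (hV : ∀ θ : A.Free → ℝ, (∀ e, 0 < θ e) → ∃ V ≤ Pi.spanSubset ℝ D, V ≠ ⊥ ∧
      ∃ κ : (X → ℝ) →ₗ[ℝ] ℝ, ∀ z ∈ V, A.realize θ *ᵥ z + Pi.single x (κ z) ∈ V) :
    ¬ IsGSIO A (dedicatedInput x) C := by
  intro h
  have : Finite C.Free := Subtype.finite
  obtain ⟨θ, hθ, hsio⟩ := Generically.exists_pos h
  obtain ⟨V, hVD, hne, κ, hκ⟩ := hV (θ ∘ Sum.inl) fun _ => hθ _
  set b := θ (Sum.inr (Sum.inl ⟨(x, ()), decide_eq_true rfl⟩)) with hb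
  have hb0 : b ≠ 0 := (hθ _).ne'
  refine not_isSIO_of_feedback_invariant _ _ _ (LinearMap.pi fun _ => b⁻¹ • κ) (fun z hz => ?_)
    (fun z hz => funext fun y => ?_) hne hsio
  · convert hκ z hz using 1
    refine congrArg (A.realize (θ ∘ Sum.inl) *ᵥ z + ·) (funext fun i => ?_)
    rw [realize_dedicatedInput, ← hb]
    rcases eq_or_ne i x with rfl | hi
    · simp [mulVec, dotProduct, hb0]
    · simp [mulVec, dotProduct, hi]
  · exact StructMatrix.realize_mulVec_eq_zero (hVD hz) fun d hd => hC d hd y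

theorem exists_measured_of_isGSIO [DecidableEq X] [Finite Y]
    (hC : IsGSIO A (dedicatedInput x) C) (t : X) :
    ∃ m, ReflTransGen (auxEdge A x) t m ∧ ∃ y, C y m = true := by
  by_contra! hno
  refine not_isGSIO_of_feedback_invariant (D := {k | ReflTransGen (auxEdge A x) t k}) hno
    (fun θ _ => ⟨_, le_rfl, spanSubset_ne_bot ⟨t, .refl⟩,
      -(LinearMap.proj x ∘ₗ (A.realize θ).mulVecLin), fun z hz => ?_⟩) hC
  refine Pi.mem_spanSubset_iff.2 fun i hi => ?_
  rcases eq_or_ne i x with rfl | hix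
  · simp
  · rw [Pi.add_apply, Pi.single_eq_of_ne hix, add_zero]
    exact StructMatrix.realize_mulVec_eq_zero hz fun d hd hid => hi (hd.tail ⟨hid, hix⟩)

theorem exists_chain_of_exit {V : Type*} {E : V → V → Prop} {D : Finset V}
    {a v j : V} (hD : ∀ d ∈ D, ∀ e, E d e → e ∈ D ∨ e = v) (ha : a ∈ D) (hv : v ∉ D) (hj : j ∈ D)
    (hav : AvoidReach E {j} a v) :
    ∃ l : List V, l.IsChain E ∧ l.head? = some a ∧ l.getLast? = some v ∧ l.length ≤ D.card := by
  classical
  let r : V → V → Prop := fun c d => E c d ∧ d ≠ j ∧ (d ∈ D ∨ d = v)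
  have hr : ReflTransGen r a v := by
    refine ReflTransGen.head_induction_on (motive := fun c _ => c ∈ D ∨ c = v → ReflTransGen r c v)
      hav.2 (fun _ => .refl) (fun {c d} hcd _ ih hc => ?_) (.inl ha)
    rcases hc with hc | rfl
    · exact (ih (hD c hc d hcd.1)).head ⟨hcd.1, hcd.2, hD c hc d hcd.1⟩
    · exact .refl
  obtain ⟨l, hl, hnodup, hhead, hlast⟩ := exists_nodup_chain hr
  have hmem : ∀ c ∈ l, c ≠ j ∧ (c ∈ D ∨ c = v) := fun c hc => by
    rcases (reach_of_mem_chain hl hhead hc).cases_tail with rfl | ⟨g, -, h⟩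
    · exact ⟨hav.1, .inl ha⟩
    · exact h.2
  have hsub : l.toFinset ⊆ insert v (D.erase j) := fun c hc => by
    obtain ⟨hcj, hcD⟩ := hmem c (List.mem_toFinset.1 hc)
    rw [Finset.mem_insert, Finset.mem_erase]
    exact hcD.symm.imp_right fun h => ⟨hcj, h⟩
  refine ⟨l, hl.imp fun _ _ h => h.1, hhead, hlast, ?_⟩
  calc l.length = l.toFinset.card := (List.toFinset_card_of_nodup hnodup).symm
    _ ≤ (insert v (D.erase j)).card := Finset.card_le_card hsub
    _ = D.card := by
      rw [Finset.card_insert_of_notMem (by simp [hv]), Finset.card_erase_add_one hj]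

/-- The zero dynamics with respect to the single exit `v` of the region `D` are nontrivial, since a
walk from `x` to `v` that misses `j` is shorter than the dimension of the region. -/
theorem not_isGSIO_of_exit [DecidableEq X] [Finite Y] {D : Finset X} {v j : X}
    (hD : ∀ d ∈ D, ∀ e, auxEdge A x d e → e ∈ D ∨ e = v) (hx : x ∈ D) (hv : v ∉ D) (hj : j ∈ D)
    (hxv : AvoidReach (auxEdge A x) {j} x v) (hC : ∀ d ∈ D, ∀ y, C y d ≠ true) :
    ¬ IsGSIO A (dedicatedInput x) C := by
  refine not_isGSIO_of_feedback_invariant (D := (D : Set X)) hC fun θ hθ => ?_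
  set M := A.realize θ with hM
  obtain ⟨l, hl, hhead, hlast, hcard⟩ := exists_chain_of_exit hD hx hv hj hxv
  have hpow : (M ^ (l.length - 1)) v x ≠ 0 := by
    refine (pow_apply_pos_of_chain (fun i k => ?_) (fun c d h => ?_) hl hhead hlast).ne'
    · rw [hM, StructMatrix.realize]
      split_ifs
      exacts [(hθ _).le, le_rfl]
    · simp [hM, StructMatrix.realize, h.1, hθ]
  have hdeg : ∃ n, (M ^ n) v x ≠ 0 := ⟨_, hpow⟩
  classical
  have hlt : Nat.find hdeg < D.card := by
    have hl0 : l ≠ [] := by rintro rfl; simp at hhead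
    have := Nat.find_min' hdeg hpow
    have := List.length_pos_iff.2 hl0
    omega
  refine ⟨zeroDynamics M D v (Nat.find hdeg), inf_le_left, zeroDynamics_ne_bot hlt,
    -((M ^ Nat.find hdeg) v x)⁻¹ • LinearMap.proj v ∘ₗ (M ^ (Nat.find hdeg + 1)).mulVecLin,
    fun z hz => zeroDynamics_feedback_invariant hx hv (fun d hd i hi hiv => ?_) (Nat.find_spec hdeg)
      (fun k hk => not_not.1 (Nat.find_min hdeg hk)) hz⟩
  refine dif_neg fun hid => ?_
  exact (hD d hd i ⟨hid, fun h => hi (h ▸ hx)⟩).elim hi hiv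

end LowerBounds

section SinkComponents

variable {V : Type} {G : Digraph V} {S : Set V} {v w : V}

theorem IsSCC.eq_of_mem (hS : IsSCC G S) (hv : v ∈ S) :
    S = {w | Reaches G v w ∧ Reaches G w v} := by
  obtain ⟨u, rfl⟩ := hS
  ext w
  exact ⟨fun h => ⟨hv.2.trans h.1, h.2.trans hv.1⟩, fun h => ⟨hv.1.trans h.1, h.2.trans hv.2⟩⟩

theorem IsSinkSCC.mem_of_reaches (hS : IsSinkSCC G S) (hv : v ∈ S) (h : Reaches G v w) : w ∈ S := by
  induction h with
  | refl => exact hv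
  | tail _ h ih => exact hS.2 _ ih _ h

variable {X : Type} [DecidableEq X] {A : StructMatrix X X} {x : X} {T : Finset X}

theorem stateDigraph_auxSystem_adj_inl {a : X} {g : X ⊕ Unit} :
    (stateDigraph (auxSystem A x)).Adj (Sum.inl a) g ↔ ∃ b, g = Sum.inl b ∧ auxEdge A x a b := by
  cases g <;> simp [stateDigraph, auxSystem, auxEdge]

theorem stateDigraph_auxSystem_adj_inr {k : Unit} {g : X ⊕ Unit} :
    (stateDigraph (auxSystem A x)).Adj (Sum.inr k) g ↔ g = Sum.inl x := by
  cases g <;> simp [stateDigraph, auxSystem]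

theorem reaches_inl_iff {a : X} {g : X ⊕ Unit} :
    Reaches (stateDigraph (auxSystem A x)) (Sum.inl a) g ↔
      ∃ b, g = Sum.inl b ∧ ReflTransGen (auxEdge A x) a b := by
  refine ⟨fun h => ?_, ?_⟩
  · induction h with
    | refl => exact ⟨a, rfl, .refl⟩
    | tail _ h ih =>
      obtain ⟨b, rfl, hb⟩ := ih
      obtain ⟨c, rfl, hc⟩ := stateDigraph_auxSystem_adj_inl.1 h
      exact ⟨c, rfl, hb.tail hc⟩
  · rintro ⟨b, rfl, h⟩
    exact h.lift Sum.inl fun c d hcd => stateDigraph_auxSystem_adj_inl.2 ⟨d, rfl, hcd⟩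

theorem exists_mem_isSinkSCC (hT : Hits A x T) {S : Set (X ⊕ Unit)}
    (hS : IsSinkSCC (stateDigraph (auxSystem A x)) S)
    (hr : ∃ g ∈ S, Reaches (stateDigraph (auxSystem A x)) (Sum.inr ()) g) :
    ∃ s ∈ T, Sum.inl s ∈ S ∧ ReflTransGen (auxEdge A x) x s := by
  obtain ⟨a, ha, hxa⟩ : ∃ a, Sum.inl a ∈ S ∧ ReflTransGen (auxEdge A x) x a := by
    obtain ⟨g, hg, hr⟩ := hr
    rcases hr.cases_head with rfl | ⟨g', hg', hr⟩
    · exact ⟨x, hS.2 _ hg _ (stateDigraph_auxSystem_adj_inr.2 rfl), .refl⟩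
    · obtain rfl := stateDigraph_auxSystem_adj_inr.1 hg'
      obtain ⟨a, rfl, hxa⟩ := reaches_inl_iff.1 hr
      exact ⟨a, hg, hxa⟩
  obtain ⟨s, hs, has⟩ := hT a
  exact ⟨s, hs, hS.mem_of_reaches ha (reaches_inl_iff.2 ⟨s, rfl, has⟩), hxa.trans has⟩

theorem exists_two_sensors (hT : Hits A x T)
    (h : 1 < numReachableSinkSCC (stateDigraph (auxSystem A x)) (Sum.inr ())) :
    ∃ s₁ ∈ T, ∃ s₂ ∈ T, s₁ ≠ s₂ ∧ ReflTransGen (auxEdge A x) x s₁ ∧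
      ReflTransGen (auxEdge A x) x s₂ := by
  obtain ⟨S₁, ⟨hS₁, hr₁⟩, S₂, ⟨hS₂, hr₂⟩, hne⟩ :=
    (Set.one_lt_ncard_iff_nontrivial_and_finite.1 h).1
  obtain ⟨s₁, hs₁, hsS₁, hx₁⟩ := exists_mem_isSinkSCC hT hS₁ hr₁
  obtain ⟨s₂, hs₂, hsS₂, hx₂⟩ := exists_mem_isSinkSCC hT hS₂ hr₂
  refine ⟨s₁, hs₁, s₂, hs₂, ?_, hx₁, hx₂⟩
  rintro rfl
  exact hne ((hS₁.1.eq_of_mem hsS₁).trans (hS₂.1.eq_of_mem hsS₂).symm)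

end SinkComponents

section SensorMatrix

variable {X : Type} [DecidableEq X]

theorem sensorMatrix_eq_true_iff {T : Finset X} {y m : X} :
    sensorMatrix T y m = true ↔ y = m ∧ m ∈ T := by
  simp [sensorMatrix]

theorem norm0_sensorMatrix (T : Finset X) : (sensorMatrix T).norm0 = T.card := by
  rw [StructMatrix.norm0, ← Nat.card_eq_finsetCard]
  refine Nat.card_congr ⟨fun p => ⟨p.1.2, (sensorMatrix_eq_true_iff.1 p.2).2⟩,
    fun t => ⟨(t, t), sensorMatrix_eq_true_iff.2 ⟨rfl, t.2⟩⟩, ?_, fun t => rfl⟩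
  rintro ⟨⟨y, m⟩, h⟩
  simpa using (sensorMatrix_eq_true_iff.1 h).1.symm

end SensorMatrix

section Correctness

variable {X : Type} [Fintype X] [DecidableEq X] {A C : StructMatrix X X} {x : X} {T : Finset X}

omit [DecidableEq X] in
theorem card_measured_le_norm0 (C : StructMatrix X X) :
    (Finset.univ.filter fun m => ∃ y, C y m = true).card ≤ C.norm0 := by
  classical
  rw [StructMatrix.norm0, Nat.card_eq_fintype_card, ← Finset.card_univ]
  refine (Finset.card_le_card fun m hm => ?_).trans
    (Finset.card_image_le (s := Finset.univ) (f := fun p : C.Free => p.1.2))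
  obtain ⟨y, hy⟩ := (Finset.mem_filter.1 hm).2
  exact Finset.mem_image.2 ⟨⟨(y, m), hy⟩, Finset.mem_univ _, rfl⟩

theorem exists_injOn_measured (hT : Hits A x T)
    (hanti : ∀ s ∈ T, ∀ t ∈ T, ReflTransGen (auxEdge A x) s t → s = t)
    (hC : IsGSIO A (dedicatedInput x) C) :
    ∃ g : X → X, Set.InjOn g T ∧ (∀ t, ReflTransGen (auxEdge A x) t (g t)) ∧
      Set.MapsTo g T (Finset.univ.filter fun m => ∃ y, C y m = true : Finset X) := by
  choose g hg hgC using exists_measured_of_isGSIO hC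
  refine ⟨g, fun s hs t ht hst => ?_, hg, fun t _ => by simpa using hgC t⟩
  obtain ⟨r, hr, hgr⟩ := hT (g s)
  exact (hanti s hs r hr ((hg s).trans hgr)).trans
    (hanti t ht r hr ((hg t).trans (hst ▸ hgr))).symm

theorem card_le_of_isGSIO (hT : Hits A x T)
    (hanti : ∀ s ∈ T, ∀ t ∈ T, ReflTransGen (auxEdge A x) s t → s = t)
    (hC : IsGSIO A (dedicatedInput x) C) : T.card ≤ C.norm0 := by
  obtain ⟨g, hinj, -, hmaps⟩ := exists_injOn_measured hT hanti hC
  exact (Finset.card_le_card_of_injOn g hmaps hinj).trans (card_measured_le_norm0 C)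

theorem exists_reach_of_measured (hT : Hits A x T)
    (hanti : ∀ s ∈ T, ∀ t ∈ T, ReflTransGen (auxEdge A x) s t → s = t)
    (hC : IsGSIO A (dedicatedInput x) C) (hle : C.norm0 ≤ T.card) {y m : X} (hm : C y m = true) :
    ∃ t ∈ T, ReflTransGen (auxEdge A x) t m := by
  obtain ⟨g, hinj, hg, hmaps⟩ := exists_injOn_measured hT hanti hC
  obtain ⟨t, ht, rfl⟩ := Finset.surjOn_of_injOn_of_card_le g hmaps hinj
    ((card_measured_le_norm0 C).trans hle) (show m ∈ _ by simpa using ⟨y, hm⟩)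
  exact ⟨t, ht, hg t⟩

/-- The states that reach `T` only through `v` form a region with the single exit `v`. A placement
of at most `T.card` sensors cannot measure it: each of its sensors can be reached from some `t` in
`T`, which would then reach both `s₁` and `s₂` through `v`. -/
theorem card_lt_of_isGSIO (hT : Hits A x T)
    (hanti : ∀ s ∈ T, ∀ t ∈ T, ReflTransGen (auxEdge A x) s t → s = t)
    {s₁ s₂ : X} (hs₁ : s₁ ∈ T) (hs₂ : s₂ ∈ T) (hne : s₁ ≠ s₂)
    (hx₁ : ReflTransGen (auxEdge A x) x s₁) (hx₂ : ReflTransGen (auxEdge A x) x s₂) {j v : X}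
    (hj : Escapes (auxEdge A x) T j x) (hv : ¬ Escapes (auxEdge A x) T v x)
    (hvj : ¬ Escapes (auxEdge A x) T v j) (hC : IsGSIO A (dedicatedInput x) C) :
    T.card < C.norm0 := by
  classical
  by_contra! hle
  have hvx : x ≠ v := by
    rintro rfl
    obtain ⟨s, hs, hr⟩ := hT j
    exact hvj ⟨s, hs, hj.ne.symm, hr.lift id fun c d h => ⟨h, h.2⟩⟩
  have hjv : j ≠ v := by
    rintro rfl
    exact hv hj
  have hxv : AvoidReach (auxEdge A x) {j} x v := by
    obtain ⟨s, hs, hxj, hr⟩ := hj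
    refine ⟨hxj, (reach_through_of_not_escapes hs hr fun h => hv ?_).1⟩
    exact h.mono fun c d h => h.1
  let D : Finset X := Finset.univ.filter fun d => ¬ Escapes (auxEdge A x) T v d ∧ d ≠ v
  have hmem {d : X} : d ∈ D ↔ ¬ Escapes (auxEdge A x) T v d ∧ d ≠ v := by simp [D]
  refine not_isGSIO_of_exit (D := D) (v := v) (j := j) (fun d hd e hde => ?_) (hmem.2 ⟨hv, hvx⟩)
    (fun h => (hmem.1 h).2 rfl) (hmem.2 ⟨hvj, hjv⟩) hxv (fun d hd y hy => hne ?_) hC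
  · rw [hmem] at hd ⊢
    by_cases hev : e = v
    · exact .inr hev
    · exact .inl ⟨fun he => hd.1 (he.head hd.2 hde), hev⟩
  · obtain ⟨t, ht, htd⟩ := exists_reach_of_measured hT hanti hC hle hy
    obtain ⟨r, hr, hdr⟩ := hT d
    have htv := htd.trans (reach_through_of_not_escapes hr hdr (hmem.1 hd).1).1
    have h₁ := hanti t ht s₁ hs₁ (htv.trans (reach_through_of_not_escapes hs₁ hx₁ hv).2)
    have h₂ := hanti t ht s₂ hs₂ (htv.trans (reach_through_of_not_escapes hs₂ hx₂ hv).2)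
    exact h₁.symm.trans h₂

theorem exists_algorithmReturns (hA : ∀ j, A j j = true) : ∃ R, AlgorithmReturns A x R := by
  obtain ⟨S, hS, hmin⟩ := (measure Finset.card).wf.has_min
    {S : Finset (X ⊕ Unit) | IsStructObservable (auxSystem A x) (sensorMatrix S)}
    ⟨_, isStructObservable_of_hits hA fun j => ⟨j, Finset.mem_univ j, .refl⟩⟩
  have hS : IsMinPlacement (auxSystem A x) S := ⟨hS, fun S' hS' => not_lt.1 (hmin S' hS')⟩
  by_cases hv : HasViolation A x S
  · exact ⟨_, S, hS, .inl ⟨hv, rfl⟩⟩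
  · exact ⟨_, S, hS, .inr ⟨hv, rfl⟩⟩

theorem isOptimal_of_algorithmReturns (hA : ∀ j, A j j = true)
    (hL : 1 < numReachableSinkSCC (stateDigraph (auxSystem A x)) (Sum.inr ()))
    {R : Finset (X ⊕ Unit)} (hR : AlgorithmReturns A x R) :
    ∃ T : Finset X, R = T.image Sum.inl ∧ IsOptimal A (dedicatedInput x) (sensorMatrix T) := by
  obtain ⟨S, hS, hR⟩ := hR
  obtain ⟨T, rfl, hT, hanti⟩ := (isMinPlacement_iff hA).1 hS
  obtain ⟨s₁, hs₁, s₂, hs₂, hne, hx₁, hx₂⟩ := exists_two_sensors hT hL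
  have hrow (T : Finset X) (y m m' : X) (h : sensorMatrix T y m = true)
      (h' : sensorMatrix T y m' = true) : m = m' :=
    (sensorMatrix_eq_true_iff.1 h).1.symm.trans (sensorMatrix_eq_true_iff.1 h').1
  have hxT : x ∉ T := fun hx => hne ((hanti x hx s₁ hs₁ hx₁).symm.trans (hanti x hx s₂ hs₂ hx₂))
  rw [hasViolation_iff (hT x)] at hR
  rcases hR with ⟨⟨j, v, hj, hv, hvj⟩, rfl⟩ | ⟨hnv, rfl⟩
  · refine ⟨insert x T, by simp, ⟨isGSIO_insert hA hT ⟨j, hj.ne.symm⟩, hrow _⟩, fun C hC => ?_⟩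
    rw [norm0_sensorMatrix, Finset.card_insert_of_notMem hxT]
    exact card_lt_of_isGSIO hT hanti hs₁ hs₂ hne hx₁ hx₂ hj hv hvj hC.1
  · have hex : Escapes (auxEdge A x) T s₁ x := by
      by_contra h
      exact hne (hanti s₁ hs₁ s₂ hs₂ (reach_through_of_not_escapes hs₂ hx₂ h).2)
    refine ⟨T, rfl, ⟨isGSIO_of_no_violation hA hT ⟨s₁, hex⟩ fun j v hj => ?_, hrow _⟩,
      fun C hC => ?_⟩
    · by_contra! h
      exact hnv ⟨j, v, hj, h.1, h.2⟩
    · rw [norm0_sensorMatrix]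
      exact card_le_of_isGSIO hT hanti hC.1

end Correctness

/-! ## Loop programs of the word RAM -/

namespace RAM

@[simp]
theorem State.setReg_reg (s : State) (r v r' : ℕ) :
    (s.setReg r v).reg r' = if r' = r then v else s.reg r' := by
  simp [State.setReg, Function.update_apply]

@[simp]
theorem State.setReg_arr (s : State) (r v : ℕ) : (s.setReg r v).arr = s.arr := rfl

@[simp]
theorem State.setArr_reg (s : State) (k i v : ℕ) : (s.setArr k i v).reg = s.reg := rfl

@[simp]
theorem State.setArr_arr (s : State) (k i v k' : ℕ) : (s.setArr k i v).arr k' =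
    if k' = k then Function.update (s.arr k) i v else s.arr k' := by
  simp [State.setArr, Function.update_apply]

@[simp]
theorem State.setReg_setReg (s : State) (r v v' : ℕ) :
    (s.setReg r v).setReg r v' = s.setReg r v' := by
  simp [State.setReg]

/-- Whether register `r` is the target of an instruction of the program. -/
def Prog.writesReg : Prog → ℕ → Bool
  | .const i _, r | .add i _ _, r | .sub i _ _, r | .mul i _ _, r | .load i _ _, r => r == i
  | .store _ _ _, _ => false
  | .seq p q, r | .ifLt _ _ p q, r => p.writesReg r || q.writesReg r
  | .whileLt _ _ p, r => p.writesReg r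

/-- Whether array `k` is the target of an instruction of the program. -/
def Prog.writesArr : Prog → ℕ → Bool
  | .const _ _, _ | .add _ _ _, _ | .sub _ _ _, _ | .mul _ _ _, _ | .load _ _ _, _ => false
  | .store i _ _, k => k == i
  | .seq p q, k | .ifLt _ _ p q, k => p.writesArr k || q.writesArr k
  | .whileLt _ _ p, k => p.writesArr k

/-- The frame condition of `p`: the states `s` and `s'` agree on all registers and arrays that are
not targets of `p`. -/
structure Frame (p : Prog) (s s' : State) : Prop where
  reg : ∀ r, p.writesReg r = false → s'.reg r = s.reg r
  arr : ∀ k, p.writesArr k = false → s'.arr k = s.arr k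

theorem Frame.refl (p : Prog) (s : State) : Frame p s s := ⟨fun _ _ => rfl, fun _ _ => rfl⟩

theorem Frame.trans {p : Prog} {s s' s'' : State} (h : Frame p s s') (h' : Frame p s' s'') :
    Frame p s s'' :=
  ⟨fun r hr => (h'.reg r hr).trans (h.reg r hr), fun k hk => (h'.arr k hk).trans (h.arr k hk)⟩

theorem Frame.mono {p q : Prog} {s s' : State} (h : Frame p s s')
    (hreg : ∀ r, q.writesReg r = false → p.writesReg r = false)
    (harr : ∀ k, q.writesArr k = false → p.writesArr k = false) : Frame q s s' :=
  ⟨fun r hr => h.reg r (hreg r hr), fun k hk => h.arr k (harr k hk)⟩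

theorem Frame.setReg {p : Prog} {r : ℕ} (hr : p.writesReg r = true) (s : State) (v : ℕ) :
    Frame p s (s.setReg r v) where
  reg r' hr' := by
    have hne : r' ≠ r := fun h => by simp [← h, hr'] at hr
    rw [State.setReg_reg, if_neg hne]
  arr _ _ := rfl

theorem Frame.setArr {p : Prog} {k : ℕ} (hk : p.writesArr k = true) (s : State) (i v : ℕ) :
    Frame p s (s.setArr k i v) where
  reg _ _ := rfl
  arr k' hk' := by
    have hne : k' ≠ k := fun h => by simp [← h, hk'] at hk
    rw [State.setArr_arr, if_neg hne]

theorem Exec.frame {W : ℕ} {p : Prog} {s s' : State} {t : ℕ} (h : Exec W p s t s') :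
    Frame p s s' := by
  induction h with
  | const | add | sub | mul | load => exact .setReg (by simp [Prog.writesReg]) _ _
  | store => exact .setArr (by simp [Prog.writesArr]) _ _ _
  | seq _ _ _ _ _ _ _ _ _ ih ih' =>
    exact (ih.mono (by simp +contextual [Prog.writesReg])
      (by simp +contextual [Prog.writesArr])).trans
      (ih'.mono (by simp +contextual [Prog.writesReg]) (by simp +contextual [Prog.writesArr]))
  | ifTrue | ifFalse =>
    rename_i ih
    exact ih.mono (by simp +contextual [Prog.writesReg]) (by simp +contextual [Prog.writesArr])
  | whileTrue _ _ _ _ _ _ _ _ _ _ _ ih ih' =>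
    exact Frame.trans (ih.mono (fun _ h => h) fun _ h => h) ih'
  | whileFalse => exact .refl _ _

/-- An upper bound for the running time of a program in which no loop is iterated more than `n`
times. -/
def Prog.time (n : ℕ) : Prog → ℕ
  | .const _ _ | .add _ _ _ | .sub _ _ _ | .mul _ _ _ | .load _ _ _ | .store _ _ _ => 1
  | .seq p q => p.time n + q.time n
  | .ifLt _ _ p q => p.time n + q.time n + 1
  | .whileLt _ _ p => (p.time n + 1) * n + 1

/-- The weakest precondition of total correctness with resource bounds: started in `s`, the program
`p` halts within `p.time n` steps, writes only words up to `W`, and establishes `Q`. -/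
def WP (W n : ℕ) (p : Prog) (Q : State → Prop) (s : State) : Prop :=
  ∃ t s', Exec W p s t s' ∧ t ≤ p.time n ∧ Q s'

namespace WP

variable {W n : ℕ} {Q Q' : State → Prop} {s : State}

theorem mono {p : Prog} (h : WP W n p Q s) (hQ : ∀ s', Q s' → Frame p s s' → Q' s') :
    WP W n p Q' s := by
  obtain ⟨t, s', he, ht, hq⟩ := h
  exact ⟨t, s', he, ht, hQ s' hq he.frame⟩

theorem const {r c : ℕ} (hc : c ≤ W) (h : Q (s.setReg r c)) : WP W n (.const r c) Q s :=
  ⟨1, _, .const s r c hc, le_rfl, h⟩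

theorem add {r a b : ℕ} (hc : s.reg a + s.reg b ≤ W) (h : Q (s.setReg r (s.reg a + s.reg b))) :
    WP W n (.add r a b) Q s :=
  ⟨1, _, .add s r a b hc, le_rfl, h⟩

theorem mul {r a b : ℕ} (hc : s.reg a * s.reg b ≤ W) (h : Q (s.setReg r (s.reg a * s.reg b))) :
    WP W n (.mul r a b) Q s :=
  ⟨1, _, .mul s r a b hc, le_rfl, h⟩

theorem load {r k a : ℕ} (hc : s.arr k (s.reg a) ≤ W) (h : Q (s.setReg r (s.arr k (s.reg a)))) :
    WP W n (.load r k a) Q s :=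
  ⟨1, _, .load s r k a hc, le_rfl, h⟩

theorem store {k a b : ℕ} (hc : s.reg b ≤ W) (h : Q (s.setArr k (s.reg a) (s.reg b))) :
    WP W n (.store k a b) Q s :=
  ⟨1, _, .store s k a b hc, le_rfl, h⟩

theorem seq {p q : Prog} (h : WP W n p (WP W n q Q) s) : WP W n (.seq p q) Q s := by
  obtain ⟨t, s', he, ht, t', s'', he', ht', hq⟩ := h
  exact ⟨t + t', s'', .seq p q _ _ _ _ _ he he', Nat.add_le_add ht ht', hq⟩

theorem ifLt {a b : ℕ} {p q : Prog} (hp : s.reg a < s.reg b → WP W n p Q s)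
    (hq : ¬ s.reg a < s.reg b → WP W n q Q s) : WP W n (.ifLt a b p q) Q s := by
  by_cases h : s.reg a < s.reg b
  · obtain ⟨t, s', he, ht, hs⟩ := hp h
    exact ⟨t + 1, s', .ifTrue _ _ _ _ _ _ _ h he, by simp only [Prog.time]; lia, hs⟩
  · obtain ⟨t, s', he, ht, hs⟩ := hq h
    exact ⟨t + 1, s', .ifFalse _ _ _ _ _ _ _ h he, by simp only [Prog.time]; lia, hs⟩

theorem whileLt {a b : ℕ} {p : Prog} (I : ℕ → State → Prop) (h0 : I 0 s)
    (hbody : ∀ i < n, ∀ s, I i s → s.reg a < s.reg b ∧ WP W n p (I (i + 1)) s)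
    (hexit : ∀ s, I n s → ¬ s.reg a < s.reg b) : WP W n (.whileLt a b p) (I n) s := by
  suffices h : ∀ k i s, i + k = n → I i s →
      ∃ t s', Exec W (.whileLt a b p) s t s' ∧ t ≤ (p.time n + 1) * k + 1 ∧ I n s' from
    h n 0 s (zero_add n) h0
  intro k
  induction k with
  | zero =>
    rintro n s rfl hI
    exact ⟨1, s, .whileFalse _ _ _ _ (hexit s hI), le_add_self, hI⟩
  | succ k ih =>
    intro i s hik hI
    obtain ⟨hlt, t, s', he, ht, hI'⟩ := hbody i (by lia) s hI
    obtain ⟨t', s'', he', ht', hI''⟩ := ih (i + 1) s' (by lia) hI'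
    exact ⟨t + t' + 1, s'', .whileTrue _ _ _ _ _ _ _ _ hlt he he', by rw [Nat.mul_succ]; lia, hI''⟩

end WP

/-- The loop `for r = 0, …, n - 1`, where register `0` holds `n` and register `2` holds `1`. -/
def forLoop (r : ℕ) (body : Prog) : Prog :=
  .seq (.const r 0) (.whileLt r 0 (.seq body (.add r r 2)))

theorem WP.forLoop {W n : ℕ} {s : State} {r : ℕ} {body : Prog} (I : ℕ → State → Prop)
    (hn : s.reg 0 = n) (h1 : s.reg 2 = 1) (hW : n ≤ W) (h0 : I 0 (s.setReg r 0))
    (hbody : ∀ (i : Fin n) s₁, I i s₁ → s₁.reg r = i → Frame (forLoop r body) s s₁ →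
      WP W n body (fun s₂ => I (i + 1) (s₂.setReg r (i + 1))) s₁)
    (hr0 : r ≠ 0 := by decide) (hr2 : r ≠ 2 := by decide) (hb : body.writesReg r = false := by rfl)
    (hb0 : body.writesReg 0 = false := by rfl) (hb2 : body.writesReg 2 = false := by rfl) :
    WP W n (RAM.forLoop r body) (I n) s := by
  have hw0 : (RAM.forLoop r body).writesReg 0 = false := by
    simp [RAM.forLoop, Prog.writesReg, hb0, hr0.symm]
  have hw2 : (RAM.forLoop r body).writesReg 2 = false := by
    simp [RAM.forLoop, Prog.writesReg, hb2, hr2.symm]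
  have hwr : (RAM.forLoop r body).writesReg r = true := by simp [RAM.forLoop, Prog.writesReg]
  refine .seq <| .const (Nat.zero_le W) ?_
  refine (whileLt (fun i s₁ => I i s₁ ∧ s₁.reg r = i ∧ Frame (RAM.forLoop r body) s s₁)
    ⟨h0, by simp, .setReg hwr _ _⟩ ?_ ?_).mono fun s₁ h _ => h.1
  · rintro i hi s₁ ⟨hI, hr, hF⟩
    refine ⟨by rwa [hr, hF.reg 0 hw0, hn], .seq ?_⟩
    refine (hbody ⟨i, hi⟩ s₁ hI hr hF).mono fun s₂ hI₂ hF₂ => ?_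
    have hsucc : s₂.reg r + s₂.reg 2 = i + 1 := by
      rw [hF₂.reg r hb, hF₂.reg 2 hb2, hr, hF.reg 2 hw2, h1]
    refine .add (by lia) ?_
    rw [hsucc]
    refine ⟨hI₂, by simp, (hF.trans (hF₂.mono ?_ ?_)).trans (.setReg hwr _ _)⟩
    · exact fun r' hr' => by simp_all [RAM.forLoop, Prog.writesReg]
    · exact fun k hk => by simp_all [RAM.forLoop, Prog.writesArr]
  · rintro s₁ ⟨-, hr, hF⟩
    rw [hr, hF.reg 0 hw0, hn]
    exact lt_irrefl n

/-- The number by which the machine represents the truth value of `p`. -/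
noncomputable def flag (p : Prop) : ℕ :=
  open Classical in if p then 1 else 0

theorem flag_le_one (p : Prop) : flag p ≤ 1 := by
  rw [flag]
  split_ifs <;> simp

@[simp]
theorem flag_pos {p : Prop} : 0 < flag p ↔ p := by
  rw [flag]
  split_ifs <;> simp_all

section Loops

variable {W n r : ℕ} {body : Prog} {s : State}

/-- `e i` is the cell that iteration `i` writes. -/
theorem WP.forLoop_extend {k : ℕ} {e : Fin n → ℕ} (he : Function.Injective e) (f : Fin n → ℕ)
    (hn : s.reg 0 = n) (h1 : s.reg 2 = 1) (hW : n ≤ W)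
    (hbody : ∀ (i : Fin n) (s₁ : State), s₁.reg r = i → Frame (RAM.forLoop r body) s s₁ →
      s₁.arr k (e i) = s.arr k (e i) →
      WP W n body (fun s₂ => s₂.arr k = Function.update (s₁.arr k) (e i) (f i)) s₁)
    (hr0 : r ≠ 0 := by decide) (hr2 : r ≠ 2 := by decide) (hb : body.writesReg r = false := by rfl)
    (hb0 : body.writesReg 0 = false := by rfl) (hb2 : body.writesReg 2 = false := by rfl) :
    WP W n (RAM.forLoop r body) (fun s' => s'.arr k = Function.extend e f (s.arr k)) s := by
  refine (WP.forLoop (fun m s' =>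
    (∀ i : Fin n, s'.arr k (e i) = if (i : ℕ) < m then f i else s.arr k (e i)) ∧
      ∀ a, (¬ ∃ i, e i = a) → s'.arr k a = s.arr k a)
    hn h1 hW (by simp) ?_ hr0 hr2 hb hb0 hb2).mono fun s' h _ => ?_
  · rintro i s₁ ⟨hin, hout⟩ hi hF
    refine (hbody i s₁ hi hF (by simpa using hin i)).mono
      fun s₂ h₂ _ => ⟨fun j => ?_, fun a ha => ?_⟩
    · rcases eq_or_ne j i with rfl | hji
      · simp [h₂]
      · have hlt : (j : ℕ) < i + 1 ↔ (j : ℕ) < i := by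
          rw [Nat.lt_succ_iff_lt_or_eq, or_iff_left (Fin.val_ne_of_ne hji)]
        simp [h₂, he.ne hji, hin, hlt]
    · simp [h₂, hout a ha, Function.update_of_ne (fun h => ha ⟨i, h.symm⟩)]
  · funext a
    by_cases ha : ∃ i, e i = a
    · obtain ⟨i, rfl⟩ := ha
      rw [h.1, if_pos i.2, he.extend_apply]
    · rw [h.2 a ha, Function.extend_apply' _ _ _ ha]

theorem WP.forLoop_exists {d : ℕ} (P : Fin n → Prop) (hn : s.reg 0 = n) (h1 : s.reg 2 = 1)
    (hW : n ≤ W)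
    (hbody : ∀ (i : Fin n) (s₁ : State), s₁.reg r = i → Frame (RAM.forLoop r body) s s₁ →
      WP W n body (fun s₂ => 0 < s₂.reg d ↔ P i ∨ 0 < s₁.reg d) s₁)
    (hrd : d ≠ r := by decide) (hr0 : r ≠ 0 := by decide) (hr2 : r ≠ 2 := by decide)
    (hb : body.writesReg r = false := by rfl)
    (hb0 : body.writesReg 0 = false := by rfl) (hb2 : body.writesReg 2 = false := by rfl) :
    WP W n (RAM.forLoop r body) (fun s' => 0 < s'.reg d ↔ (∃ i, P i) ∨ 0 < s.reg d) s := by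
  refine (WP.forLoop (fun m s' => 0 < s'.reg d ↔ (∃ i : Fin n, (i : ℕ) < m ∧ P i) ∨ 0 < s.reg d)
    hn h1 hW (by simp [hrd]) ?_ hr0 hr2 hb hb0 hb2).mono fun s' h _ => by simpa using h
  intro i s₁ hI hi hF
  refine (hbody i s₁ hi hF).mono fun s₂ h₂ _ => ?_
  have hsucc : (∃ j : Fin n, (j : ℕ) < i + 1 ∧ P j) ↔ P i ∨ ∃ j : Fin n, (j : ℕ) < i ∧ P j := by
    simp only [Nat.lt_succ_iff_lt_or_eq, ← Fin.ext_iff, or_and_right, exists_or, exists_eq_left,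
      or_comm]
  rw [State.setReg_reg, if_neg hrd, h₂, hI, hsucc, or_assoc]

end Loops

end RAM

/-! ## Backward search -/

namespace RAM

/-- The fixed part of the memory while the placement program runs: the system in the format of
`inputState`, and the constants `1`, `2` and `0` in registers `2`, `3` and `4`. The word size is
large enough for the addresses of an `n × n` matrix. -/
structure Env {n : ℕ} (A : StructMatrix (Fin n) (Fin n)) (x : Fin n) (W : ℕ) (s : State) :
    Prop where
  word : n * n + 2 ≤ W
  size : s.reg 0 = n
  driven : s.reg 1 = x
  one : s.reg 2 = 1
  two : s.reg 3 = 2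
  zero : s.reg 4 = 0
  pattern : ∀ i j : Fin n, s.arr 0 (i * n + j) = flag (A i j = true)

variable {n W : ℕ} {A : StructMatrix (Fin n) (Fin n)} {x : Fin n} {s : State} {Q : State → Prop}

theorem Env.le (h : Env A x W s) : n ≤ W :=
  (Nat.le_mul_self n).trans (by have := h.word; lia)

theorem Env.frame {p : Prog} {s' : State} (h : Env A x W s) (hF : Frame p s s')
    (hr : ∀ r < 5, p.writesReg r = false := by intro r hr; interval_cases r <;> rfl)
    (hk : p.writesArr 0 = false := by rfl) : Env A x W s' where
  word := h.word
  size := (hF.reg 0 (hr 0 (by decide))).trans h.size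
  driven := (hF.reg 1 (hr 1 (by decide))).trans h.driven
  one := (hF.reg 2 (hr 2 (by decide))).trans h.one
  two := (hF.reg 3 (hr 3 (by decide))).trans h.two
  zero := (hF.reg 4 (hr 4 (by decide))).trans h.zero
  pattern := by rw [hF.arr 0 hk]; exact h.pattern

theorem Env.setReg (h : Env A x W s) {r : ℕ} (v : ℕ) (hr : 5 ≤ r := by decide) :
    Env A x W (s.setReg r v) := by
  refine h.frame (p := .const r v) (.setReg (by simp [Prog.writesReg]) s v) fun r' hr' => ?_
  simpa [Prog.writesReg] using (hr'.trans_le hr).ne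

theorem Env.setArr (h : Env A x W s) {k : ℕ} (i v : ℕ) (hk : k ≠ 0 := by decide) :
    Env A x W (s.setArr k i v) :=
  h.frame (p := .store k i v) (.setArr (by simp [Prog.writesArr]) s i v) (fun _ _ => rfl)
    (by simpa [Prog.writesArr] using hk.symm)

theorem index_lt (i j : Fin n) : (i : ℕ) * n + j < n * n := by
  simpa [add_comm, mul_comm] using (finProdFinEquiv (i, j)).2

theorem index_inj {i j i' j' : Fin n} : (i : ℕ) * n + j = i' * n + j' ↔ i = i' ∧ j = j' := by
  rw [← Prod.mk.injEq, ← finProdFinEquiv.apply_eq_iff_eq (x := (i, j)), ← Fin.val_inj]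
  simp [add_comm, mul_comm]

/-- The program that does nothing, except to overwrite the scratch register `15`. -/
def skip : Prog := .const 15 0

/-- Computes in register `r` the address of the matrix entry with row `reg a`, column `reg b`. -/
def index (r a b : ℕ) : Prog := .seq (.mul r a 0) (.add r r b)

/-- Runs `p` if the entry with row `reg a` and column `reg b` of the matrix in array `k` is
positive, and `q` otherwise. -/
def ifEntry (k a b : ℕ) (p q : Prog) : Prog :=
  .seq (index 11 a b) (.seq (.load 12 k 11) (.ifLt 4 12 p q))

theorem WP.skip (h : Q (s.setReg 15 0)) : WP W n skip Q s := .const (Nat.zero_le _) h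

theorem WP.index {r a b : ℕ} (hE : Env A x W s) {i j : Fin n} (ha : s.reg a = i) (hb : s.reg b = j)
    (h : Q (s.setReg r (i * n + j))) (hrb : b ≠ r := by decide) : WP W n (index r a b) Q s := by
  have hlt := index_lt i j
  have hW := hE.word
  refine .seq <| .mul ?_ <| .add ?_ ?_
  · rw [ha, hE.size]
    lia
  · simp only [State.setReg_reg, if_true, if_neg hrb, ha, hb, hE.size]
    lia
  · simpa [hrb, ha, hb, hE.size] using h

theorem WP.ifEntry {k a b : ℕ} {p q : Prog} (hE : Env A x W s) {i j : Fin n} (ha : s.reg a = i)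
    (hb : s.reg b = j) {P : Prop} (hP : s.arr k (i * n + j) = flag P)
    (hp : P → WP W n p Q ((s.setReg 11 (i * n + j)).setReg 12 (flag P)))
    (hq : ¬ P → WP W n q Q ((s.setReg 11 (i * n + j)).setReg 12 (flag P)))
    (hb11 : b ≠ 11 := by decide) : WP W n (ifEntry k a b p q) Q s := by
  have hW := hE.word
  have hflag := flag_le_one P
  refine .seq <| .index hE ha hb (.seq <| .load ?_ ?_) hb11
  · simp only [State.setReg_arr, State.setReg_reg, if_true, hP]
    lia
  · simp only [State.setReg_arr, State.setReg_reg, if_true, hP]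
    refine .ifLt (fun h => hp ?_) fun h => hq ?_ <;> simpa [hE.zero] using h

/-- Looks for a vertex with mark `1` in array `2`; register `8` tells whether there is one, and
register `9` holds it. -/
def scan : Prog :=
  .seq (.const 8 0) (forLoop 6 (.seq (.load 10 2 6)
    (.ifLt 10 3 (.ifLt 4 10 (.seq (.add 9 6 4) (.const 8 1)) skip) skip)))

/-- Marks with `1` the unmarked vertices `i` for which row `reg 9` of the pattern has a nonzero
entry in column `i`. -/
def markPred : Prog :=
  forLoop 6 (.seq (.load 10 2 6) (.ifLt 10 2 (ifEntry 0 9 6 (.store 2 6 2) skip) skip))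

/-- Changes the mark of the vertex `reg 9` to `2` and marks its predecessors in the digraph of the
auxiliary system, where the driven state has none. -/
def expand : Prog := .seq (.store 2 9 3) (.ifLt 9 1 markPred (.ifLt 1 9 markPred skip))

/-- Backward search in array `2`: mark `2` means processed or blocked, mark `1` means pending. -/
def search : Prog := forLoop 7 (.seq scan (.ifLt 4 8 expand skip))

theorem WP.scan (hE : Env A x W s) (hle : ∀ i : Fin n, s.arr 2 i ≤ 2) :
    WP W n scan (fun s' => (s'.reg 8 = 0 ∧ ∀ i : Fin n, s.arr 2 i ≠ 1) ∨
      (s'.reg 8 = 1 ∧ ∃ c : Fin n, s'.reg 9 = c ∧ s.arr 2 c = 1)) s := by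
  have hW := hE.word
  refine .seq <| .const (Nat.zero_le W) ?_
  replace hE := hE.setReg (r := 8) 0
  refine (WP.forLoop (fun m s' => (s'.reg 8 = 0 ∧ ∀ i : Fin n, (i : ℕ) < m → s.arr 2 i ≠ 1) ∨
      (s'.reg 8 = 1 ∧ ∃ c : Fin n, s'.reg 9 = c ∧ s.arr 2 c = 1))
    hE.size hE.one hE.le (by simp) ?_).mono fun s' h _ => by simpa using h
  intro i s₁ hI hi hF
  replace hE := hE.frame hF
  have harr : s₁.arr 2 i = s.arr 2 i := by simp [hF.arr 2 rfl]
  have hmark := hle i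
  have hskip : s.arr 2 i ≠ 1 → ∀ v, WP W n RAM.skip (fun s' =>
      ((s'.setReg 6 (i + 1)).reg 8 = 0 ∧ ∀ j : Fin n, (j : ℕ) < i + 1 → s.arr 2 j ≠ 1) ∨
      ((s'.setReg 6 (i + 1)).reg 8 = 1 ∧ ∃ c : Fin n, (s'.setReg 6 (i + 1)).reg 9 = c ∧
        s.arr 2 c = 1)) (s₁.setReg 10 v) := by
    refine fun hne v => .skip ?_
    simpa [le_iff_lt_or_eq, or_imp, forall_and, Fin.val_inj, hne] using hI
  refine .seq <| .load (by rw [hi, harr]; lia) ?_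
  rw [hi, harr]
  refine .ifLt (fun hlt => .ifLt (fun hpos => ?_) fun hpos => hskip ?_ _) fun hlt => hskip ?_ _
  · have hlt : s.arr 2 i < 2 := by simpa [hE.two] using hlt
    have hpos : 0 < s.arr 2 i := by simpa [hE.zero] using hpos
    have hiW := i.2.le.trans hE.le
    exact .seq <| .add (by simpa [hi, hE.zero]) <|
      .const (by lia) <| .inr ⟨by simp, i, by simp [hi, hE.zero], by lia⟩
  · have hpos : s.arr 2 i = 0 := by simpa [hE.zero] using hpos
    lia
  · have hlt : 1 < s.arr 2 i := by simpa [hE.two] using hlt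
    lia

open Classical in
theorem WP.markPred (hE : Env A x W s) (hle : ∀ i : Fin n, s.arr 2 i ≤ 2) {c : Fin n}
    (h9 : s.reg 9 = c) : WP W n markPred (fun s' => ∀ i : Fin n, s'.arr 2 i =
      if s.arr 2 i = 0 ∧ A c i = true then 1 else s.arr 2 i) s := by
  refine (WP.forLoop_extend (k := 2) Fin.val_injective
    (fun i : Fin n => if s.arr 2 i = 0 ∧ A c i = true then 1 else s.arr 2 i)
    hE.size hE.one hE.le fun i s₁ hi hF harr => ?_).mono
      fun s' h _ i => by rw [h, Fin.val_injective.extend_apply]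
  replace hE := hE.frame hF
  have hW := hE.word
  have hmark := hle i
  refine .seq <| .load (by rw [hi, harr]; lia) ?_
  rw [hi, harr]
  refine .ifLt (fun h0 => ?_) fun h0 => .skip ?_
  · have h0 : s.arr 2 i = 0 := by simpa [hE.one] using h0
    refine .ifEntry (i := c) (j := i) (hE.setReg _) (by simpa [hF.reg 9 rfl] using h9)
      (by simpa using hi) (by simpa using hE.pattern c i)
      (fun hA => .store ?_ ?_) fun hA => .skip ?_
    · simpa [hE.one] using (by lia : 1 ≤ W)
    · simp [hi, hE.one, h0, hA]
    · simp [hA, ← harr]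
  · have h0 : s.arr 2 i ≠ 0 := by simpa [hE.one] using h0
    rw [State.setReg_arr, State.setReg_arr, if_neg fun h => h0 h.1, ← harr, Function.update_eq_self]

open Classical in
theorem WP.expand (hE : Env A x W s) (hle : ∀ i : Fin n, s.arr 2 i ≤ 2) {c : Fin n}
    (h9 : s.reg 9 = c) : WP W n expand (fun s' => ∀ i : Fin n, s'.arr 2 i =
      if i = c then 2 else if s.arr 2 i = 0 ∧ auxEdge A x i c then 1 else s.arr 2 i) s := by
  have hW := hE.word
  refine .seq <| .store (by rw [hE.two]; lia) ?_
  rw [h9, hE.two]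
  have hdriven := hE.driven
  replace hE := hE.setArr (k := 2) c 2
  have harr : ∀ i : Fin n, (s.setArr 2 c 2).arr 2 i = if i = c then 2 else s.arr 2 i := by
    simp [Function.update_apply, Fin.val_inj]
  have hmark : c ≠ x → WP W n RAM.markPred (fun s' => ∀ i : Fin n, s'.arr 2 i =
      if i = c then 2 else if s.arr 2 i = 0 ∧ auxEdge A x i c then 1 else s.arr 2 i)
      (s.setArr 2 c 2) := by
    refine fun hcx => (WP.markPred hE (fun i => ?_) h9).mono fun s' hs' _ i => ?_
    · rw [harr]
      split_ifs
      exacts [le_rfl, hle i]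
    · rw [hs', harr]
      split_ifs <;> simp_all [auxEdge]
  refine .ifLt (fun h => hmark ?_) fun h => .ifLt (fun h' => hmark ?_) fun h' => .skip fun i => ?_
  · rintro rfl
    simp [h9, hdriven] at h
  · rintro rfl
    simp [h9, hdriven] at h'
  · have hcx : c = x := by
      simp only [State.setArr_reg, h9, hdriven] at h h'
      exact Fin.ext (by lia)
    rw [State.setReg_arr, harr]
    simp +contextual [auxEdge, hcx]

end RAM

section Searched

variable {V : Type*} {E : V → V → Prop} {m₀ μ μ' : V → ℕ}

/-- The result of a backward search along `E` from the vertices of mark `1`, where the vertices of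
mark `2` are blocked; a blocked vertex counts as found. -/
def Searched (E : V → V → Prop) (m₀ : V → ℕ) (i : V) : Prop :=
  m₀ i = 2 ∨ ∃ c, m₀ c = 1 ∧ AvoidReach E {k | m₀ k = 2} i c

/-- The marks `μ` arise from the initial marks `m₀` in a backward search along `E`: mark `2` means
processed or blocked, mark `1` means pending. -/
structure IsPartialSearch (E : V → V → Prop) (m₀ μ : V → ℕ) : Prop where
  le_two : ∀ i, μ i ≤ 2
  blocked : ∀ i, m₀ i = 2 → μ i = 2
  start : ∀ i, m₀ i = 1 → 1 ≤ μ i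
  sound : ∀ i, 1 ≤ μ i → Searched E m₀ i
  closed : ∀ i c, μ c = 2 → m₀ c ≠ 2 → E i c → 1 ≤ μ i

theorem IsPartialSearch.init (h : ∀ i, m₀ i ≤ 2) : IsPartialSearch E m₀ m₀ where
  le_two := h
  blocked _ h := h
  start _ h := h.ge
  sound i hi := by
    rcases (h i).lt_or_eq with h2 | h2
    · have h1 : m₀ i = 1 := by lia
      exact .inr ⟨i, h1, .refl (by simp [h1])⟩
    · exact .inl h2
  closed _ _ h h' := absurd h h'

theorem IsPartialSearch.step [DecidableEq V] [DecidableRel E] (h : IsPartialSearch E m₀ μ) {c : V}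
    (hc : μ c = 1)
    (hμ' : ∀ i, μ' i = if i = c then 2 else if μ i = 0 ∧ E i c then 1 else μ i) :
    IsPartialSearch E m₀ μ' := by
  have hc2 : m₀ c ≠ 2 := fun h2 => by simp [h.blocked c h2] at hc
  have hle : ∀ i, μ i ≤ μ' i := fun i => by
    have := h.le_two i
    rw [hμ']
    split_ifs <;> lia
  refine ⟨fun i => ?_, fun i hi => ?_, fun i hi => (h.start i hi).trans (hle i), fun i hi => ?_,
    fun i d hd hd2 hE => ?_⟩
  · rw [hμ']
    split_ifs
    exacts [le_rfl, one_le_two, h.le_two i]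
  · simp [hμ', h.blocked i hi]
  · by_cases h1 : 1 ≤ μ i
    · exact h.sound i h1
    rw [hμ'] at hi
    split_ifs at hi with hic hpred
    · exact absurd (hic ▸ hc.ge) h1
    · obtain ⟨d, hd, hr⟩ := (h.sound c hc.ge).resolve_left hc2
      exact or_iff_not_imp_left.2 fun hi2 => ⟨d, hd, hr.head hi2 hpred.2⟩
    · exact absurd hi h1
  · rcases eq_or_ne d c with rfl | hdc
    · rw [hμ']
      split_ifs with hid hpred
      exacts [one_le_two, le_rfl, Nat.one_le_iff_ne_zero.2 fun h0 => hpred ⟨h0, hE⟩]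
    · rw [hμ', if_neg hdc] at hd
      have hd : μ d = 2 := by split_ifs at hd <;> lia
      exact (h.closed i d hd hd2 hE).trans (hle i)

theorem IsPartialSearch.final (h : IsPartialSearch E m₀ μ) (h1 : ∀ i, μ i ≠ 1) (i : V) :
    μ i = 2 ↔ Searched E m₀ i := by
  have h2 : ∀ i, 1 ≤ μ i → μ i = 2 := fun i hi => by
    have := h.le_two i
    have := h1 i
    lia
  refine ⟨fun hi => h.sound i (by lia), ?_⟩
  rintro (hi | ⟨c, hc, hi, hr⟩)
  · exact h.blocked i hi
  · induction hr using ReflTransGen.head_induction_on with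
    | refl => exact h2 _ (h.start _ hc)
    | head hE _ ih => exact h2 _ (h.closed _ _ (ih hE.2) hE.2 hE.1)

theorem card_mark_two_lt [Fintype V] {c : V} (hc : μ c = 1) (hc' : μ' c = 2)
    (hμ : ∀ i, μ i = 2 → μ' i = 2) :
    Finset.card {i : V | μ i = 2} < Finset.card {i : V | μ' i = 2} :=
  Finset.card_lt_card <| (Finset.ssubset_iff_of_subset fun i => by simpa using hμ i).2
    ⟨c, by simpa using hc', by simp [hc]⟩

theorem searched_update_zero_one [DecidableEq V] {v i : V} :
    Searched E (Function.update (fun _ => 0) v 1) i ↔ ReflTransGen E i v := by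
  have hblocked : {k | Function.update (fun _ : V => 0) v 1 k = 2} = ∅ := by
    ext k
    rcases eq_or_ne k v with rfl | h <;> simp [*]
  have hstart : ∀ c, Function.update (fun _ : V => 0) v 1 c = 1 ↔ c = v := fun c => by
    rcases eq_or_ne c v with rfl | h <;> simp [*]
  have hi : Function.update (fun _ : V => 0) v 1 i ≠ 2 := by
    rcases eq_or_ne i v with rfl | h <;> simp [*]
  simp [Searched, hblocked, hstart, hi, AvoidReach]

theorem ne_and_searched_update_flag_two [DecidableEq V] {T : Finset V} {v i : V} :
    i ≠ v ∧ Searched E (Function.update (fun j => RAM.flag (j ∈ T)) v 2) i ↔ Escapes E T v i := by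
  set m₀ := Function.update (fun j => RAM.flag (j ∈ T)) v 2 with hm₀
  have hne : ∀ j ≠ v, m₀ j = RAM.flag (j ∈ T) := fun j hj => by simp [hm₀, hj]
  have htwo : ∀ j, m₀ j = 2 ↔ j = v := fun j => by
    rcases eq_or_ne j v with rfl | hj
    · simp [hm₀]
    · have := RAM.flag_le_one (j ∈ T)
      simp only [hne j hj, hj, iff_false]
      lia
  have hone : ∀ j, m₀ j = 1 ↔ j ∈ T ∧ j ≠ v := fun j => by
    rcases eq_or_ne j v with rfl | hj
    · simp [hm₀]
    · simp [hne j hj, RAM.flag, hj]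
  simp only [Searched, htwo, hone, Set.ofPred_eq_eq_singleton]
  constructor
  · rintro ⟨hi, h | ⟨c, hc, h⟩⟩
    exacts [absurd h hi, ⟨c, hc.1, h⟩]
  · rintro ⟨c, hc, h⟩
    exact ⟨h.1, .inr ⟨c, ⟨hc, h.notMem_right⟩, h⟩⟩

end Searched

namespace RAM

variable {n W : ℕ} {A : StructMatrix (Fin n) (Fin n)} {x : Fin n} {s : State}

theorem WP.search (hE : Env A x W s) (hle : ∀ i : Fin n, s.arr 2 i ≤ 2) :
    WP W n search (fun s' => ∀ i : Fin n, s'.arr 2 i ≤ 2 ∧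
      (s'.arr 2 i = 2 ↔ Searched (auxEdge A x) (fun i : Fin n => s.arr 2 i) i)) s := by
  classical
  refine (WP.forLoop (fun k s' =>
    IsPartialSearch (auxEdge A x) (fun i : Fin n => s.arr 2 i) (fun i => s'.arr 2 i) ∧
      ((∀ i : Fin n, s'.arr 2 i ≠ 1) ∨ k ≤ Finset.card {i : Fin n | s'.arr 2 i = 2}))
    hE.size hE.one hE.le ⟨.init hle, .inr (Nat.zero_le _)⟩ ?_).mono ?_
  · rintro k s₁ ⟨hS, hk⟩ - hF
    replace hE := hE.frame hF
    refine .seq <| (WP.scan hE hS.le_two).mono fun s₂ h₂ hF₂ => ?_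
    replace hE := hE.frame hF₂
    have harr : s₂.arr 2 = s₁.arr 2 := hF₂.arr 2 rfl
    refine .ifLt (fun hlt => ?_) fun hlt => .skip ?_
    · obtain ⟨-, c, h9, hc⟩ := h₂.resolve_left fun h => by simp [h.1, hE.zero] at hlt
      refine (WP.expand hE (by simpa only [harr] using hS.le_two) h9).mono fun s₃ h₃ _ => ?_
      simp only [harr] at h₃
      refine ⟨hS.step hc h₃, .inr ?_⟩
      refine (hk.resolve_left fun h => h c hc).trans_lt (card_mark_two_lt hc ?_ fun i hi => ?_)
      · simp [h₃]
      · simp [h₃, hi]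
    · have hnone := (h₂.resolve_right fun h => hlt (by simp [h.1, hE.zero])).2
      simp only [State.setReg_arr, harr]
      exact ⟨hS, .inl hnone⟩
  · rintro s' ⟨hS, hk⟩ - i
    refine ⟨hS.le_two i, hS.final (hk.elim id fun hk j => ?_) i⟩
    have huniv : ({i : Fin n | s'.arr 2 i = 2} : Finset (Fin n)) = Finset.univ :=
      Finset.eq_univ_of_card _ (le_antisymm (Finset.card_le_univ _) (by simpa using hk))
    have hj := huniv ▸ Finset.mem_univ j
    simp [(Finset.mem_filter.1 hj).2]

end RAM

section SinkReps

variable {V : Type*} [LinearOrder V] {E : V → V → Prop} {j k : V}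

/-- The least vertices of the sink components of a digraph. -/
def sinkReps (E : V → V → Prop) : Set V :=
  {j | ∀ k, ReflTransGen E j k → ReflTransGen E k j ∧ j ≤ k}

theorem eq_of_mem_sinkReps (hj : j ∈ sinkReps E) (hk : k ∈ sinkReps E)
    (h : ReflTransGen E j k) : j = k :=
  (hj k h).2.antisymm (hk j (hj k h).1).2

theorem exists_mem_sinkReps [Finite V] (E : V → V → Prop) (j : V) :
    ∃ s ∈ sinkReps E, ReflTransGen E j s := by
  obtain ⟨k, hjk, hmin⟩ := (Set.toFinite {k | ReflTransGen E j k}).exists_minimalFor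
    (fun k => {m | ReflTransGen E k m}) _ ⟨j, .refl⟩
  have hsink : ∀ m, ReflTransGen E k m → ReflTransGen E m k := fun m hm =>
    hmin (hjk.trans hm) (fun _ => hm.trans) .refl
  obtain ⟨s, hs, hle⟩ := Set.exists_min_image {m | ReflTransGen E k m} id (Set.toFinite _)
    ⟨k, .refl⟩
  exact ⟨s, fun m hm => ⟨(hsink m (hs.trans hm)).trans hs, hle m (hs.trans hm)⟩, hjk.trans hs⟩

theorem mem_sinkReps_iff_not_exists : j ∈ sinkReps E ↔
    ¬ ∃ k, (j ≠ k ∧ ReflTransGen E j k) ∧ (k ≠ j ∧ ReflTransGen E k j → k < j) := by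
  push Not
  refine forall_congr' fun k => ⟨fun h ⟨hne, hjk⟩ => ?_, fun h hjk => ?_⟩
  · exact ⟨⟨hne.symm, (h hjk).1⟩, (h hjk).2⟩
  · rcases eq_or_ne j k with rfl | hne
    · exact ⟨hjk, le_rfl⟩
    · exact (h ⟨hne, hjk⟩).imp_left And.right

end SinkReps

/-! ## The placement program -/

namespace RAM

/-- Copies array `k` into array `2`. -/
def copyMarks (k : ℕ) : Prog := forLoop 6 (.seq (.load 10 k 6) (.store 2 6 10))

/-- Stores in row `reg 5` of the matrix in array `k` which vertices have mark `2`. -/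
def record (k : ℕ) : Prog :=
  forLoop 6 (.seq (index 11 5 6) (.seq (.load 12 2 6) (.ifLt 12 3 (.store k 11 4) (.store k 11 2))))

/-- Stores in row `reg 5` of the matrix in array `k` which vertices other than `reg 5` have
mark `2`. -/
def recordOthers (k : ℕ) : Prog := .seq (.store 2 5 4) (record k)

/-- Performs a search with the initial marks in array `a`, except that the vertex `reg 5` has the
initial mark `reg m`, and stores which other vertices are found in row `reg 5` of the matrix in
array `k`. -/
def row (a m k : ℕ) : Prog :=
  .seq (copyMarks a) (.seq (.store 2 5 m) (.seq search (recordOthers k)))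

/-- The matrix of the search results from all vertices. -/
def table (a m k : ℕ) : Prog := forLoop 5 (row a m k)

/-- Sets register `8` to `1` if the vertex `reg 6` shows that `reg 5` is not the least vertex of a
sink component. -/
def rejectTest : Prog :=
  ifEntry 3 6 5 (ifEntry 3 5 6 (.ifLt 6 5 (.const 8 1) skip) (.const 8 1)) skip

/-- Stores in array `1` which vertices are the least vertices of the sink components, according to
the reachability matrix in array `3`. -/
def select : Prog :=
  forLoop 5 (.seq (.const 8 0) (.seq (forLoop 6 rejectTest)
    (.ifLt 4 8 (.store 1 5 4) (.store 1 5 2))))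

/-- Sets register `13` to `1` if the vertices `reg 5` and `reg 6` witness a violation. Row `v` of
the matrix in array `4` tells from which vertices one can reach a sensor avoiding `v`. -/
def violationTest : Prog :=
  ifEntry 4 5 1 (ifEntry 4 6 1 skip (ifEntry 4 6 5 skip (.const 13 1))) skip

/-- Stores in array `1` which vertices are the least vertices of the sink components. Array `5` is
not written by any program, so that all initial marks are `0`. -/
def findSinkReps : Prog := .seq (table 5 2 3) select

/-- Tells in register `13` whether the placement in array `1` has a violation. -/
def findViolation : Prog :=
  .seq (table 1 3 4) (.seq (.const 13 0) (forLoop 5 (forLoop 6 violationTest)))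

/-- Algorithm 1 with the least vertices of the sink components as the minimum placement. -/
def placement : Prog :=
  .seq (.const 2 1) (.seq (.const 3 2) (.seq findSinkReps (.seq findViolation
    (.ifLt 4 13 (.store 1 1 2) skip))))

theorem forLoop_writesArr (r k : ℕ) (body : Prog) :
    (forLoop r body).writesArr k = body.writesArr k := by
  simp [forLoop, Prog.writesArr]

theorem copyMarks_writesArr (k j : ℕ) : (copyMarks k).writesArr j = (j == 2) := by
  simp [copyMarks, forLoop_writesArr, Prog.writesArr]

theorem search_writesArr (j : ℕ) : search.writesArr j = (j == 2) := by
  simp [search, scan, expand, markPred, ifEntry, index, skip, forLoop_writesArr, Prog.writesArr]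

theorem record_writesArr (k j : ℕ) : (record k).writesArr j = (j == k) := by
  simp [record, index, forLoop_writesArr, Prog.writesArr]

theorem row_writesArr (a m k j : ℕ) : (row a m k).writesArr j = (j == 2 || j == k) := by
  cases h : j == 2 <;> simp [row, copyMarks_writesArr, search_writesArr, recordOthers,
    record_writesArr, Prog.writesArr, h]

section

variable {n W : ℕ} {A : StructMatrix (Fin n) (Fin n)} {x : Fin n} {s : State}

theorem WP.copyMarks (hE : Env A x W s) {k : ℕ} (hk : k ≠ 2) (hle : ∀ i : Fin n, s.arr k i ≤ 2) :
    WP W n (copyMarks k) (fun s' => ∀ i : Fin n, s'.arr 2 i = s.arr k i) s := by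
  refine (WP.forLoop_extend (k := 2) Fin.val_injective (fun i : Fin n => s.arr k i) hE.size hE.one
    hE.le fun i s₁ hi hF _ => ?_).mono fun s' h _ i => by
      rw [h, Fin.val_injective.extend_apply]
  have harr : s₁.arr k = s.arr k := hF.arr k (by simpa [forLoop_writesArr, Prog.writesArr] using hk)
  have hiW : s.arr k i ≤ W := (hle i).trans (by have := hE.word; lia)
  refine .seq <| .load (by rwa [hi, harr]) <| .store (by simpa [hi, harr] using hiW) ?_
  simp [hi, harr]

theorem WP.record (hE : Env A x W s) {k : ℕ} (hk0 : k ≠ 0) (hk2 : k ≠ 2) {v : Fin n}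
    (hv : s.reg 5 = v) (hle : ∀ i : Fin n, s.arr 2 i ≤ 2) :
    WP W n (record k) (fun s' => ∀ u i : Fin n, s'.arr k (u * n + i) =
      if u = v then flag (s.arr 2 i = 2) else s.arr k (u * n + i)) s := by
  have hinj : Function.Injective fun i : Fin n => (v : ℕ) * n + i := fun i j h =>
    (index_inj.1 h).2
  refine (WP.forLoop_extend (k := k) hinj (fun i : Fin n => flag (s.arr 2 i = 2)) hE.size hE.one
    hE.le fun i s₁ hi hF _ => ?_).mono fun s' h _ u i => ?_
  · replace hE := hE.frame hF (by intro r hr; interval_cases r <;> rfl)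
      (by simpa [forLoop_writesArr, Prog.writesArr, RAM.index] using hk0.symm)
    have harr : s₁.arr 2 = s.arr 2 :=
      hF.arr 2 (by simpa [forLoop_writesArr, Prog.writesArr, RAM.index] using hk2.symm)
    have hW := hE.word
    have hi2 := hle i
    refine .seq <| .index hE ((hF.reg 5 rfl).trans hv) hi <| .seq <| .load ?_ <| .ifLt
      (fun hlt => .store ?_ ?_) fun hlt => .store ?_ ?_
    · have : s.arr 2 i ≤ W := by lia
      simpa [hi, harr]
    · simp [hE.zero]
    · have hne : s.arr 2 i ≠ 2 := ne_of_lt (by simpa [hi, harr, hE.two] using hlt)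
      simp [hE.zero, flag, hne]
    · simpa [hE.one] using (by lia : 1 ≤ W)
    · have heq : s.arr 2 i = 2 := by
        have : ¬ s.arr 2 i < 2 := by simpa [hi, harr, hE.two] using hlt
        lia
      simp [hE.one, flag, heq]
  · rw [h]
    split_ifs with huv
    · rw [huv, hinj.extend_apply (fun i : Fin n => flag (s.arr 2 i = 2))]
    · exact Function.extend_apply' _ _ _ fun ⟨j, hj⟩ => huv (index_inj.1 hj).1.symm

theorem WP.recordOthers (hE : Env A x W s) {k : ℕ} (hk0 : k ≠ 0) (hk2 : k ≠ 2) {v : Fin n}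
    (hv : s.reg 5 = v) {P : Fin n → Prop}
    (hP : ∀ i : Fin n, s.arr 2 i ≤ 2 ∧ (s.arr 2 i = 2 ↔ P i)) :
    WP W n (recordOthers k) (fun s' => ∀ u i : Fin n, s'.arr k (u * n + i) =
      if u = v then flag (i ≠ v ∧ P i) else s.arr k (u * n + i)) s := by
  refine .seq <| .store (by rw [hE.zero]; exact Nat.zero_le W) ?_
  rw [hv, hE.zero]
  refine (WP.record (hE.setArr (k := 2) v 0) hk0 hk2 hv fun i => ?_).mono fun s' h _ u i => ?_
  · rcases eq_or_ne i v with rfl | hi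
    · simp
    · simp [Fin.val_ne_of_ne hi, (hP i).1]
  · have hmark : (s.setArr 2 v 0).arr 2 i = 2 ↔ i ≠ v ∧ P i := by
      rcases eq_or_ne i v with rfl | hi
      · simp
      · simp [Fin.val_ne_of_ne hi, hi, (hP i).2]
    rw [h, hmark, State.setArr_arr, if_neg hk2]

theorem WP.row (hE : Env A x W s) {a m k : ℕ} (hk0 : k ≠ 0) (hk2 : k ≠ 2) (ha : a ≠ 2)
    (hm : m < 5) (hm2 : s.reg m ≤ 2) {v : Fin n} (hv : s.reg 5 = v) {w : Fin n → ℕ}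
    (hw : ∀ i : Fin n, s.arr a i = w i) (hle : ∀ i, w i ≤ 2) :
    WP W n (row a m k) (fun s' => ∀ u i : Fin n, s'.arr k (u * n + i) = if u = v then
      flag (i ≠ v ∧ Searched (auxEdge A x) (Function.update w v (s.reg m)) i)
        else s.arr k (u * n + i)) s := by
  have hW := hE.word
  refine .seq <| (WP.copyMarks hE ha fun i => (hw i).trans_le (hle i)).mono fun s₁ h₁ hF₁ => ?_
  replace hE := hE.frame hF₁ (by intro r hr; interval_cases r <;> rfl)
  have hv₁ : s₁.reg 5 = v := (hF₁.reg 5 rfl).trans hv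
  have hm₁ : s₁.reg m = s.reg m := hF₁.reg m (by interval_cases m <;> rfl)
  refine .seq <| .store (by lia) ?_
  rw [hv₁, hm₁]
  replace hE := hE.setArr (k := 2) v (s.reg m)
  have hmarks : (fun i : Fin n => (s₁.setArr 2 v (s.reg m)).arr 2 i) =
      Function.update w v (s.reg m) := by
    funext i
    simp [Function.update_apply, Fin.val_inj, h₁, hw]
  refine .seq <| (WP.search hE fun i => ?_).mono fun s₂ h₂ hF₂ => ?_
  · rw [congrFun hmarks i, Function.update_apply]
    split_ifs
    exacts [hm2, hle i]
  · rw [hmarks] at h₂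
    replace hE := hE.frame hF₂
    have hv₂ : s₂.reg 5 = v := (hF₂.reg 5 rfl).trans hv₁
    refine (WP.recordOthers hE hk0 hk2 hv₂ h₂).mono fun s₃ h₃ _ u i => ?_
    rw [h₃, hF₂.arr k (by simpa [search_writesArr] using hk2), State.setArr_arr, if_neg hk2,
      hF₁.arr k (by simpa [copyMarks_writesArr] using hk2)]

theorem WP.table (hE : Env A x W s) {a m k : ℕ} (w : Fin n → ℕ)
    (hw : ∀ i : Fin n, s.arr a i = w i) (hle : ∀ i, w i ≤ 2) (hm2 : s.reg m ≤ 2)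
    (hk0 : k ≠ 0 := by decide) (hk2 : k ≠ 2 := by decide) (ha : a ≠ 2 := by decide)
    (hak : a ≠ k := by decide) (hm : m < 5 := by decide) :
    WP W n (table a m k) (fun s' => ∀ v i : Fin n, s'.arr k (v * n + i) =
      flag (i ≠ v ∧ Searched (auxEdge A x) (Function.update w v (s.reg m)) i)) s := by
  refine (WP.forLoop (fun l s' => ∀ v i : Fin n, (v : ℕ) < l → s'.arr k (v * n + i) =
      flag (i ≠ v ∧ Searched (auxEdge A x) (Function.update w v (s.reg m)) i))
    hE.size hE.one hE.le (fun _ _ h => absurd h (Nat.not_lt_zero _)) ?_).mono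
      fun s' h _ v i => h v i v.2
  intro v s₁ hI hv hF
  replace hE := hE.frame hF (by intro r hr; interval_cases r <;> rfl)
    (by simpa [forLoop_writesArr, row_writesArr] using hk0.symm)
  have harr : s₁.arr a = s.arr a := hF.arr a (by simp [forLoop_writesArr, row_writesArr, ha, hak])
  have hreg : s₁.reg m = s.reg m := hF.reg m (by interval_cases m <;> rfl)
  refine (WP.row hE hk0 hk2 ha hm (by rwa [hreg]) hv (by rwa [harr]) hle).mono
    fun s₂ h₂ _ u i hu => ?_
  rw [State.setReg_arr, h₂, hreg]
  split_ifs with huv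
  · rw [huv]
  · exact hI u i ((Nat.lt_succ_iff.1 hu).lt_of_ne (Fin.val_ne_of_ne huv))

theorem WP.rejectTest (hE : Env A x W s) {R : Fin n → Fin n → Prop}
    (hR : ∀ v i : Fin n, s.arr 3 (v * n + i) = flag (R i v)) {j k : Fin n} (hj : s.reg 5 = j)
    (hk : s.reg 6 = k) : WP W n rejectTest (fun s' => 0 < s'.reg 8 ↔
      (R j k ∧ (R k j → k < j)) ∨ 0 < s.reg 8) s := by
  have hW := hE.word
  refine .ifEntry hE hk hj (hR k j) (fun hjk => ?_) fun hjk => .skip (by simp [hjk])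
  refine .ifEntry ((hE.setReg _).setReg _) (by simpa using hj) (by simpa using hk) (hR j k)
    (fun hkj => ?_) fun hkj => .const (by lia) (by simp [hjk, hkj])
  refine .ifLt (fun hlt => .const (by lia) ?_) fun hlt => .skip ?_ <;>
    simp_all

theorem WP.select (hE : Env A x W s) {R : Fin n → Fin n → Prop}
    (hR : ∀ v i : Fin n, s.arr 3 (v * n + i) = flag (R i v)) :
    WP W n select (fun s' => ∀ j : Fin n, s'.arr 1 j =
      flag (¬ ∃ k, R j k ∧ (R k j → k < j))) s := by
  refine (WP.forLoop_extend (k := 1) Fin.val_injective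
    (fun j : Fin n => flag (¬ ∃ k, R j k ∧ (R k j → k < j))) hE.size hE.one hE.le
    fun j s₁ hj hF _ => ?_).mono fun s' h _ j => by rw [h, Fin.val_injective.extend_apply]
  replace hE := hE.frame hF
  have hW := hE.word
  refine .seq <| .const (Nat.zero_le W) <| .seq ?_
  replace hE := hE.setReg (r := 8) 0
  refine (WP.forLoop_exists (d := 8) (fun k => R j k ∧ (R k j → k < j)) hE.size hE.one hE.le
    fun k s₂ hk hF₂ => ?_).mono fun s₂ h₂ hF₂ => ?_
  · refine WP.rejectTest (hE.frame hF₂) (fun v i => ?_) ((hF₂.reg 5 rfl).trans hj) hk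
    rw [hF₂.arr 3 rfl, State.setReg_arr, hF.arr 3 rfl, hR]
  · replace hE := hE.frame hF₂
    have hj₂ : s₂.reg 5 = j := (hF₂.reg 5 rfl).trans hj
    have harr : s₂.arr 1 = s₁.arr 1 := hF₂.arr 1 rfl
    have h₂ : 0 < s₂.reg 8 ↔ ∃ k, R j k ∧ (R k j → k < j) := by simpa using h₂
    refine .ifLt (fun h => ?_) fun h => ?_
    · rw [hE.zero, h₂] at h
      exact .store (by simp [hE.zero]) (by simp [hj₂, hE.zero, harr, flag, h])
    · rw [hE.zero, h₂] at h
      exact .store (by rw [hE.one]; lia) (by simp [hj₂, hE.one, harr, flag, h])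

theorem WP.violationTest (hE : Env A x W s) {P : Fin n → Fin n → Prop}
    (hP : ∀ v i : Fin n, s.arr 4 (v * n + i) = flag (P v i)) {j v : Fin n} (hj : s.reg 5 = j)
    (hv : s.reg 6 = v) : WP W n violationTest (fun s' => 0 < s'.reg 13 ↔
      (P j x ∧ ¬ P v x ∧ ¬ P v j) ∨ 0 < s.reg 13) s := by
  have hW := hE.word
  refine .ifEntry hE hj hE.driven (hP j x) (fun hjx => ?_) fun hjx => .skip (by simp [hjx])
  replace hE := (hE.setReg (r := 11) (j * n + x)).setReg (r := 12) (flag (P j x))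
  refine .ifEntry hE (by simpa using hv) hE.driven (hP v x) (fun hvx => .skip (by simp [hvx]))
    fun hvx => ?_
  replace hE := (hE.setReg (r := 11) (v * n + x)).setReg (r := 12) (flag (P v x))
  exact .ifEntry hE (by simpa using hv) (by simpa using hj) (hP v j)
    (fun hvj => .skip (by simp [hvj])) fun hvj => .const (by lia) (by simp [hjx, hvx, hvj])

theorem WP.testViolations (hE : Env A x W s) {P : Fin n → Fin n → Prop}
    (hP : ∀ v i : Fin n, s.arr 4 (v * n + i) = flag (P v i)) :
    WP W n (.seq (.const 13 0) (RAM.forLoop 5 (RAM.forLoop 6 RAM.violationTest)))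
      (fun s' => 0 < s'.reg 13 ↔ ∃ j v, P j x ∧ ¬ P v x ∧ ¬ P v j) s := by
  refine .seq <| .const (Nat.zero_le W) ?_
  replace hE := hE.setReg (r := 13) 0
  refine (WP.forLoop_exists (d := 13) (fun j => ∃ v, P j x ∧ ¬ P v x ∧ ¬ P v j) hE.size hE.one
    hE.le fun j s₁ hj hF => ?_).mono fun s' h _ => by simpa using h
  replace hE := hE.frame hF
  refine WP.forLoop_exists (d := 13) _ hE.size hE.one hE.le fun v s₂ hv hF₂ => ?_
  refine WP.violationTest (hE.frame hF₂) (fun v i => ?_) ((hF₂.reg 5 rfl).trans hj) hv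
  rw [hF₂.arr 4 rfl, hF.arr 4 rfl, State.setReg_arr, hP]

end

end RAM

namespace RAM

variable {n W : ℕ} {A : StructMatrix (Fin n) (Fin n)} {x : Fin n} {s : State}

theorem Env.inputState (hW : n * n + 2 ≤ W) :
    Env A x W (((inputState A x).setReg 2 1).setReg 3 2) := by
  refine ⟨hW, rfl, rfl, rfl, rfl, rfl, fun i j => ?_⟩
  simp [RAM.inputState, flag, index_inj, and_assoc]

theorem WP.findSinkReps (hE : Env A x W s) (h0 : ∀ i, s.arr 5 i = 0) :
    WP W n findSinkReps (fun s' => ∀ j : Fin n, s'.arr 1 j =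
      flag (j ∈ sinkReps (auxEdge A x))) s := by
  refine .seq <| (WP.table hE (fun _ => 0) (fun i => h0 i) (fun _ => Nat.zero_le 2)
    (by simp [hE.one])).mono fun s₁ h₁ hF₁ => ?_
  simp only [hE.one, searched_update_zero_one] at h₁
  refine (WP.select (hE.frame hF₁) (R := fun i v => i ≠ v ∧ ReflTransGen (auxEdge A x) i v)
    h₁).mono fun s₂ h₂ _ j => ?_
  rw [h₂, mem_sinkReps_iff_not_exists]

theorem WP.findViolation (hE : Env A x W s) {T : Finset (Fin n)}
    (hT : ∀ j : Fin n, s.arr 1 j = flag (j ∈ T)) :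
    WP W n findViolation (fun s' => 0 < s'.reg 13 ↔ ∃ j v, Escapes (auxEdge A x) T j x ∧
      ¬ Escapes (auxEdge A x) T v x ∧ ¬ Escapes (auxEdge A x) T v j) s := by
  refine .seq <| (WP.table hE (fun j => flag (j ∈ T)) hT
    (fun j => (flag_le_one _).trans one_le_two) hE.two.le).mono fun s₁ h₁ hF₁ => ?_
  simp only [hE.two, ne_and_searched_update_flag_two] at h₁
  exact WP.testViolations (hE.frame hF₁) h₁

open Classical in
theorem WP.placement (hA : ∀ j, A j j = true) (hW : n * n + 2 ≤ W) :
    WP W n placement (fun s => ∃ T : Finset (Fin n), outputIs s T ∧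
      AlgorithmReturns A x (T.image Sum.inl)) (inputState A x) := by
  refine .seq <| .const (by lia) <| .seq <| .const (by lia) <| .seq ?_
  have hE := Env.inputState (A := A) (x := x) hW
  refine (WP.findSinkReps hE fun i => by simp [RAM.inputState]).mono fun s₁ h₁ hF₁ => ?_
  replace hE := hE.frame hF₁
  set T := (sinkReps (auxEdge A x)).toFinset with hT
  have hhits : Hits A x T := by simpa [Hits, hT] using exists_mem_sinkReps (auxEdge A x)
  have hmin : IsMinPlacement (auxSystem A x) (T.image Sum.inl) :=
    (isMinPlacement_iff hA).2 ⟨T, rfl, hhits, fun s hs t ht =>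
      eq_of_mem_sinkReps (Set.mem_toFinset.1 hs) (Set.mem_toFinset.1 ht)⟩
  have h₁ : ∀ j : Fin n, s₁.arr 1 j = flag (j ∈ T) := by simpa [hT] using h₁
  refine .seq <| (WP.findViolation hE h₁).mono fun s₂ h₂ hF₂ => ?_
  rw [← hasViolation_iff (hhits x)] at h₂
  replace hE := hE.frame hF₂
  replace h₁ : ∀ j : Fin n, s₂.arr 1 j = flag (j ∈ T) := by rwa [hF₂.arr 1 rfl]
  refine .ifLt (fun h => .store (by rw [hE.one]; lia) ?_) fun h => .skip ?_ <;>
    rw [hE.zero, h₂] at h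
  · refine ⟨insert x T, fun j => ?_, _, hmin, .inl ⟨h, Finset.image_insert ..⟩⟩
    rcases eq_or_ne j x with rfl | hj
    · simp [hE.driven, hE.one]
    · simp [hE.driven, Fin.val_ne_of_ne hj, hj, h₁, flag]
  · exact ⟨T, fun j => by simp [h₁, flag], _, hmin, .inr ⟨h, rfl⟩⟩

theorem placement_time (hn : 0 < n) : placement.time n ≤ 2000 * n ^ 3 := by
  obtain ⟨m, rfl⟩ : ∃ m, n = m + 1 := ⟨n - 1, by lia⟩
  simp only [placement, findSinkReps, table, row, recordOthers, select, findViolation,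
    violationTest, rejectTest, ifEntry, record, copyMarks, search, expand, markPred, scan, index,
    skip, RAM.forLoop, Prog.time]
  ring_nf
  linarith [Nat.zero_le m, Nat.zero_le (m ^ 2), Nat.zero_le (m ^ 3)]

theorem sq_add_two_le {K : ℕ} (hK : 3 ≤ K) (hn : 0 < n) : n * n + 2 ≤ K * n ^ K :=
  calc n * n + 2 ≤ 3 * n ^ 2 := by nlinarith
    _ ≤ K * n ^ K := Nat.mul_le_mul hK (Nat.pow_le_pow_right hn (by lia))

theorem exists_program : ∃ (prog : Prog) (K : ℕ), ∀ (n : ℕ) (A : StructMatrix (Fin n) (Fin n))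
    (x : Fin n), (∀ j, A j j = true) → ∃ (t : ℕ) (s : State) (T : Finset (Fin n)),
      Exec (K * n ^ K) prog (inputState A x) t s ∧ t ≤ K * n ^ 3 ∧ outputIs s T ∧
        AlgorithmReturns A x (T.image Sum.inl) := by
  refine ⟨placement, 2000, fun n A x hA => ?_⟩
  obtain ⟨t, s, hexec, ht, T, hT, hret⟩ :=
    WP.placement (x := x) hA (sq_add_two_le (by decide : 3 ≤ 2000) x.pos)
  exact ⟨t, s, T, hexec, ht.trans (placement_time x.pos), hT, hret⟩

end RAM

theorem natCast_le_mul_rpow {t K n : ℕ} (hn : 0 < n) (ht : t ≤ K * n ^ 3) :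
    (t : ℝ) ≤ K * (n : ℝ) ^ (3.5 : ℝ) := by
  have hn : (1 : ℝ) ≤ n := Nat.one_le_cast.2 hn
  calc (t : ℝ) ≤ K * (n : ℝ) ^ 3 := mod_cast ht
    _ = K * (n : ℝ) ^ (3 : ℝ) := by norm_cast
    _ ≤ K * (n : ℝ) ^ (3.5 : ℝ) := by gcongr; norm_num

theorem theorem4_general :
    (∀ (X : Type) [Fintype X] [DecidableEq X] (A : StructMatrix X X) (x : X),
      (∀ j, A j j = true) →
      (∃ R, AlgorithmReturns A x R) ∧
      (1 < numReachableSinkSCC (stateDigraph (auxSystem A x)) (Sum.inr ()) →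
        ∀ R, AlgorithmReturns A x R →
          ∃ T : Finset X, R = T.image Sum.inl ∧
            IsOptimal A (dedicatedInput x) (sensorMatrix T))) ∧
    (∃ (prog : RAM.Prog) (K : ℕ), ∀ (n : ℕ) (A : StructMatrix (Fin n) (Fin n)) (x : Fin n),
      (∀ j, A j j = true) →
      ∃ (t : ℕ) (s : RAM.State) (T : Finset (Fin n)),
        RAM.Exec (K * n ^ K) prog (RAM.inputState A x) t s ∧
        t ≤ K * n ^ 3 ∧
        RAM.outputIs s T ∧
        AlgorithmReturns A x (T.image Sum.inl)) :=
  ⟨fun _ _ _ _ _ hA =>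
    ⟨exists_algorithmReturns hA, fun hL _ hR => isOptimal_of_algorithmReturns hA hL hR⟩,
    RAM.exists_program⟩

theorem theorem4 :
    -- correctness: the algorithm has a result, and each possible result is a set of sensors on
    -- states that solves the minimal GSIO problem
    (∀ (n : ℕ) (A : StructMatrix (Fin n) (Fin n)) (x : Fin n),
      (∀ j, A j j = true) →
      1 < numReachableSinkSCC (stateDigraph (auxSystem A x)) (Sum.inr ()) →
      (∃ R, AlgorithmReturns A x R) ∧
      ∀ R, AlgorithmReturns A x R →
        ∃ T : Finset (Fin n), R = T.image Sum.inl ∧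
          IsOptimal A (dedicatedInput x) (sensorMatrix T)) ∧
    -- running time: one program carries out the algorithm within `K * n ^ 3.5` steps, on words of
    -- `O(log n)` bits
    (∃ (prog : RAM.Prog) (K : ℕ), ∀ (n : ℕ) (A : StructMatrix (Fin n) (Fin n)) (x : Fin n),
      (∀ j, A j j = true) →
      ∃ (t : ℕ) (s : RAM.State) (T : Finset (Fin n)),
        RAM.Exec (K * n ^ K) prog (RAM.inputState A x) t s ∧
        (t : ℝ) ≤ (K : ℝ) * (n : ℝ) ^ (3.5 : ℝ) ∧
        RAM.outputIs s T ∧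
        AlgorithmReturns A x (T.image Sum.inl)) := by
  obtain ⟨hcorrect, prog, K, hprog⟩ := theorem4_general
  refine ⟨fun n A x hA hL => (hcorrect _ A x hA).imp_right (· hL), prog, K, fun n A x hA => ?_⟩
  obtain ⟨t, s, T, hexec, ht, hT⟩ := hprog n A x hA
  exact ⟨t, s, T, hexec, natCast_le_mul_rpow x.pos ht, hT⟩
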